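/- Let $\Phi\subset\mathfrak h^*$ be a finite, reduced, crystallographic root system, where $\mathfrak h$ is the complexification of the ambient Euclidean space; let $\Phi^+$ be a system of positive roots, $W$ the Weyl group, $P^\vee=\{p\in\mathfrak h:\alpha(p)\in\mathbb Z\ \forall\alpha\in\Phi\}$ the coweight lattice, $H=\mathfrak h/P^\vee$, $H_{\rm reg}=H\setminus\bigcup_{\alpha\in\Phi}\{e^{2\pi i\alpha}=1\}$, and $\{u_i\},\{u^i\}$ dual bases of $\mathfrak h^*,\mathfrak h$. A root subsystem is a subset $\Psi\subset\Phi$ with $\Psi=\mathbb Z\Psi\cap\Phi$; $\Psi^+=\Psi\cap\Phi^+$. *Elliptic Lie algebra.* $\mathfrak t_{ell,\Phi}$ is the complex Lie algebra generated by elements $t_\alpha=t_{-\alpha}$ ($\alpha\in\Phi$) and by the images of two linear maps $x,y:\mathfrak h\to\mathfrak t_{ell,\Phi}$, with relations: $[t_\alpha,\sum_{\beta\in\Psi^+}t_\beta]=0$ for every root subsystem $\Psi\ni\alpha$; $[x(u),x(v)]=[y(u),y(v)]=0$; $[y(u),x(v)]=\sum_{\gamma\in\Phi^+}\gamma(u)\gamma(v)t_\gamma$;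 $[t_\alpha,x(u)]=[t_\alpha,y(u)]=0$ if $\alpha(u)=0$. It is graded by $\deg x(u)=\deg y(u)=1$, $\deg t_\alpha=2$, and $\widehat{\mathfrak t}_{ell,\Phi}$ is its completion for this grading. *KZB connection.* Let $\theta(z|\tau)$ be given, with $q=e^{2\pi i\tau}$, by $\theta(z|\tau)=\frac{e^{\pi iz}-e^{-\pi iz}}{2\pi i}\prod_{s\ge1}\frac{(1-q^se^{2\pi iz})(1-q^se^{-2\pi iz})}{(1-q^s)^2}$, let $k(z,x|\tau)=\frac{\theta(z+x|\tau)}{\theta(z|\tau)\theta(x|\tau)}-\frac1x$, expanded as a power series in $x$, put $a_\alpha=\operatorname{ad}\frac{x(\alpha^\vee)}2$, and $$\nabla_{KZB,\tau}=d-\sum_{\alpha\in\Phi^+}k(\alpha,a_\alpha|\tau)(t_\alpha)\,d\alpha+\sum_i y(u^i)\,du_i$$ with values in $\widehat{\mathfrak t}_{ell,\Phi}$, on $\{z\in\mathfrak h:\alpha(z)\notin\mathbb Z+\mathbb Z\tau\ \forall\alpha\in\Phi\}$. *Trigonometric Lie algebra.* For $c\in\mathbb C^\times$ let $\mathfrak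 t_{trig}^{c}$ be the Lie algebra generated by elements $t_\alpha=t_{-\alpha}$ and by the image of a linear map $X$ on $\mathfrak h$, with relations: $[t_\alpha,\sum_{\beta\in\Psi^+}t_\beta]=0$ for every root subsystem $\Psi\ni\alpha$ of rank $2$; $[X(u),X(v)]=0$; and $[t_\alpha,\,X(u)-c\sum_{\beta\in\Phi^+\cap w\Phi^-}\beta(u)t_\beta]=0$ for $\alpha\in\Phi^+$, $w\in W$ such that $w^{-1}\alpha$ is simple, and $u\in\mathfrak h$ with $\alpha(u)=0$. It is the universal Lie algebra for flat connections of the form $d-\sum_{\alpha\in\Phi^+}\frac{c\,d\alpha}{e^{c\alpha}-1}t_\alpha-\sum_iX(u^i)du_i$. Let $\nabla_{trig}$ be this connection on $H_{\rm reg}$ for $c=2\pi i$, with values in $\mathfrak t_{trig}^{2\pi i}$. **Proposition.** (1) As $\operatorname{Im}\tau\to\infty$, $\nabla_{KZB,\tau}$ degenerates to the connection on $H_{\rm reg}$ $$\nabla^{\deg}=d-\sum_{\alpha\in\Phi^+}\Big(\frac{2\pi i}{e^{2\pi i\alpha}-1}+\frac{2\pi i\,e^{2\pi ia_\alpha}}{e^{2\pi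 ia_\alpha}-1}-\frac1{a_\alpha}\Big)(t_\alpha)\,d\alpha+\sum_iy(u^i)\,du_i ,$$ that is: near every point of the preimage in $\mathfrak h$ of $H_{\rm reg}$, the connection form of $\nabla_{KZB,\tau}$ is defined for $\operatorname{Im}\tau$ large, and it converges locally uniformly to that of $\nabla^{\deg}$ (in each degree of $\widehat{\mathfrak t}_{ell,\Phi}$). (2) $\nabla^{\deg}$ is flat, and equals $$d-\sum_{\alpha\in\Phi^+}\frac{2\pi i\,t_\alpha}{e^{2\pi i\alpha}-1}\,d\alpha-\sum_i\xi(u^i)\,du_i,\qquad \xi(u)=-y(u)+\sum_{\alpha\in\Phi^+}\alpha(u)\Big(\frac{2\pi i\,e^{2\pi ia_\alpha}}{e^{2\pi ia_\alpha}-1}-\frac1{a_\alpha}\Big)(t_\alpha).$$ (3) There is a unique Lie algebra homomorphism $\mathfrak t_{trig}^{2\pi i}\to\widehat{\mathfrak t}_{ell,\Phi}$ with $t_\alpha\mapsto t_\alpha$ and $X(u)\mapsto\xi(u)$, and it carries $\nabla_{trig}$ to $\nabla^{\deg}$. Equivalently, there is a unique Lie algebra homomorphism $\mathfrak t_{trig}^{1}\to\widehat{\mathfrak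 t}_{ell,\Phi}$ with $t_\alpha\mapsto t_\alpha$ and $X(u)\mapsto\frac1{2\pi i}\xi(u)$. -/

import Mathlib

open scoped Topology

noncomputable section

namespace KZB

/-! ### Completion of a Lie algebra with respect to a sequence of ideals -/

section Completion

variable {L : Type*} [LieRing L] [LieAlgebra ℂ L]

/-- The carrier of the inverse limit of the quotients `L ⧸ F n` of a Lie algebra by a decreasing
sequence of ideals: the sequences of classes which, up to any given stage, come from a single
element of `L`. -/
def completionSubmodule (F : ℕ → LieIdeal ℂ L) : Submodule ℂ (∀ n, L ⧸ F n) where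
  carrier := {a | ∀ n, ∃ l : L, ∀ m ≤ n, a m = LieSubmodule.Quotient.mk l}
  add_mem' := by
    intro a b ha hb n
    obtain ⟨l, hl⟩ := ha n
    obtain ⟨k, hk⟩ := hb n
    exact ⟨l + k, fun m hm => by rw [Pi.add_apply, hl m hm, hk m hm]; rfl⟩
  zero_mem' := fun n => ⟨0, fun m _ => rfl⟩
  smul_mem' := by
    intro c a ha n
    obtain ⟨l, hl⟩ := ha n
    exact ⟨c • l, fun m hm => by rw [Pi.smul_apply, hl m hm]; rfl⟩

/-- The completion `lim L ⧸ F n` of a Lie algebra along a decreasing sequence of ideals. -/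
def Completion (F : ℕ → LieIdeal ℂ L) : Type _ := completionSubmodule F

variable {F : ℕ → LieIdeal ℂ L}

instance : AddCommGroup (Completion F) := inferInstanceAs (AddCommGroup (completionSubmodule F))

instance : Module ℂ (Completion F) := inferInstanceAs (Module ℂ (completionSubmodule F))

/-- The `n`-th component of an element of the completion. -/
def Completion.proj (n : ℕ) : Completion F →ₗ[ℂ] L ⧸ F n :=
  (LinearMap.proj n).comp (completionSubmodule F).subtype

theorem Completion.ext_proj {a b : Completion F}
    (h : ∀ n, Completion.proj n a = Completion.proj n b) : a = b :=
  Subtype.ext (funext h)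

/-- The Lie bracket of the completion is computed componentwise. -/
instance : Bracket (Completion F) (Completion F) where
  bracket a b := ⟨fun n => ⁅Completion.proj n a, Completion.proj n b⁆, by
    intro n
    obtain ⟨l, hl⟩ := a.2 n
    obtain ⟨k, hk⟩ := b.2 n
    refine ⟨⁅l, k⁆, fun m hm => ?_⟩
    have h1 : Completion.proj m a = LieSubmodule.Quotient.mk l := hl m hm
    have h2 : Completion.proj m b = LieSubmodule.Quotient.mk k := hk m hm
    exact (congrArg₂ (fun p q => ⁅p, q⁆) h1 h2).trans
      (LieSubmodule.Quotient.mk_bracket _ l k).symm⟩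

theorem Completion.proj_lie (n : ℕ) (a b : Completion F) :
    Completion.proj n ⁅a, b⁆ = ⁅Completion.proj n a, Completion.proj n b⁆ := rfl

instance : LieRing (Completion F) where
  add_lie a b c := Completion.ext_proj fun n => by
    simp only [Completion.proj_lie, map_add, add_lie]
  lie_add a b c := Completion.ext_proj fun n => by
    simp only [Completion.proj_lie, map_add, lie_add]
  lie_self a := Completion.ext_proj fun n => by
    simp only [Completion.proj_lie, map_zero, lie_self]
  leibniz_lie a b c := Completion.ext_proj fun n => by
    simp only [Completion.proj_lie, map_add, leibniz_lie (Completion.proj n a)]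

instance : LieAlgebra ℂ (Completion F) where
  lie_smul c a b := Completion.ext_proj fun n => by
    simp only [Completion.proj_lie, map_smul, lie_smul]

/-- The topology of the completion: the inverse limit of the canonical (module) topologies of the
complex vector spaces `L ⧸ F n`. -/
instance : TopologicalSpace (Completion F) :=
  ⨅ n, TopologicalSpace.induced (Completion.proj n) (moduleTopology ℂ (L ⧸ F n))

/-- The canonical map from a Lie algebra to its completion. -/
def toCompletion (F : ℕ → LieIdeal ℂ L) : L →ₗ⁅ℂ⁆ Completion F where
  toFun l := ⟨fun _ => LieSubmodule.Quotient.mk l, fun _ => ⟨l, fun _ _ => rfl⟩⟩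
  map_add' _ _ := rfl
  map_smul' _ _ := rfl
  map_lie' {l k} := Completion.ext_proj fun _ => LieSubmodule.Quotient.mk_bracket _ l k

/-- For a power series `f = ∑ f_k X^k`, the element `f(ad a)(c) = ∑ f_k (ad a)^k c` of the
completion; modulo `F n` only the terms with `k < n` contribute, because of `h`. -/
def adSeries (f : PowerSeries ℂ) (a c : L)
    (h : ∀ n k, n ≤ k → ((LieAlgebra.ad ℂ L a) ^ k) c ∈ F n) : Completion F :=
  ⟨fun n => LieSubmodule.Quotient.mk
      (∑ k ∈ Finset.range n, PowerSeries.coeff k f • ((LieAlgebra.ad ℂ L a) ^ k) c), by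
    intro n
    refine ⟨∑ k ∈ Finset.range n, PowerSeries.coeff k f • ((LieAlgebra.ad ℂ L a) ^ k) c,
      fun m hm => ?_⟩
    refine ((Submodule.Quotient.eq (F m).toSubmodule).2 ?_).symm
    rw [← Finset.sum_sdiff (Finset.range_mono hm), add_sub_cancel_right]
    refine Submodule.sum_mem _ fun k hk => Submodule.smul_mem _ _ (h m k ?_)
    simp only [Finset.mem_sdiff, Finset.mem_range, not_lt] at hk
    exact hk.2⟩

end Completion

/-! ### Theta function and the power series which enter the connections -/

open Complex in
/-- The theta function, by its product formula: with `u = e^{2πiz}` and `q = e^{2πiτ}`,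
`θ(z|τ) = (u^{1/2} - u^{-1/2})/(2πi) ∏_{s>0} (1 - q^s u)(1 - q^s u⁻¹)(1 - q^s)⁻²`. -/
def theta (z : ℂ) (τ : UpperHalfPlane) : ℂ :=
  (exp (Real.pi * I * z) - exp (-(Real.pi * I * z))) / (2 * Real.pi * I) *
    ∏' s : ℕ, ((1 - exp (2 * Real.pi * I * τ) ^ (s + 1) * exp (2 * Real.pi * I * z)) *
      (1 - exp (2 * Real.pi * I * τ) ^ (s + 1) * exp (-(2 * Real.pi * I * z))) /
        (1 - exp (2 * Real.pi * I * τ) ^ (s + 1)) ^ 2)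

/-- The Taylor series `∑ f⁽ⁿ⁾(z)/n! Xⁿ` of `x ↦ f (z + x)` at `x = 0`. -/
def taylor (f : ℂ → ℂ) (z : ℂ) : PowerSeries ℂ :=
  PowerSeries.mk fun n => iteratedDeriv n f z / (n.factorial : ℂ)

/-- The part of a Laurent series in non-negative degrees. It is only applied below to Laurent series
without terms of negative degree. -/
def regularPart (f : LaurentSeries ℂ) : PowerSeries ℂ :=
  PowerSeries.mk fun n => f.coeff (n : ℤ)

/-- For `z ∉ ℤ + ℤτ`, the expansion in powers of `x` of
`k(z, x|τ) = θ(z + x|τ) / (θ(z|τ) θ(x|τ)) - 1/x`. -/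
def kSeries (z : ℂ) (τ : UpperHalfPlane) : PowerSeries ℂ :=
  regularPart
    (HahnSeries.ofPowerSeries ℤ ℂ (taylor (theta · τ) z) /
        (HahnSeries.C (theta z τ) * HahnSeries.ofPowerSeries ℤ ℂ (taylor (theta · τ) 0)) -
      HahnSeries.single (-1) 1)

/-- The power series `e^{2πix} = ∑ (2πi)ⁿ/n! xⁿ`, as a Laurent series. -/
def expLaurent : LaurentSeries ℂ :=
  HahnSeries.ofPowerSeries ℤ ℂ
    (PowerSeries.rescale (2 * Real.pi * Complex.I) (PowerSeries.exp ℂ))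

/-- The expansion in powers of `x` of `2πi e^{2πix} / (e^{2πix} - 1) - 1/x`. -/
def hSeries : PowerSeries ℂ :=
  regularPart
    (HahnSeries.C (2 * Real.pi * Complex.I) * expLaurent / (expLaurent - 1) -
      HahnSeries.single (-1) 1)

/-! ### The trigonometric torus and the regular loci -/

section RootSystem

variable {ι M N : Type*} [AddCommGroup M] [Module ℂ M] [AddCommGroup N] [Module ℂ N]

/-- The coweight lattice `P^∨`, i.e. the dual in `𝔥` of the root lattice. -/
def coweightLattice (P : RootPairing ι ℂ M N) : AddSubgroup N where
  carrier := {p | ∀ i, ∃ n : ℤ, P.root' i p = n}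
  add_mem' := by
    intro p q hp hq i
    obtain ⟨m, hm⟩ := hp i
    obtain ⟨n, hn⟩ := hq i
    exact ⟨m + n, by rw [map_add, hm, hn]; push_cast; rfl⟩
  zero_mem' := fun i => ⟨0, by simp⟩
  neg_mem' := by
    intro p hp i
    obtain ⟨m, hm⟩ := hp i
    exact ⟨-m, by rw [map_neg, hm]; push_cast; rfl⟩

/-- The torus `H = 𝔥 / P^∨`. -/
abbrev Torus (P : RootPairing ι ℂ M N) : Type _ := N ⧸ coweightLattice P

/-- The function `e^{2πiα}` on `H = 𝔥 / P^∨`. -/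
def expRoot (P : RootPairing ι ℂ M N) (i : ι) : Torus P → ℂ :=
  Quotient.lift (fun z : N => Complex.exp (2 * Real.pi * Complex.I * P.root' i z)) (by
    intro z w hzw
    obtain ⟨n, hn⟩ := (QuotientAddGroup.leftRel_apply.1 hzw) i
    rw [map_add, map_neg, neg_add_eq_iff_eq_add] at hn
    refine (Complex.exp_eq_exp_iff_exists_int.2 ⟨-n, ?_⟩)
    rw [hn]
    push_cast
    ring)

/-- The regular locus `H_reg = H ∖ ⋃_α {e^{2πiα} = 1}`. -/
def torusReg (P : RootPairing ι ℂ M N) : Set (Torus P) := {h | ∀ i, expRoot P i h ≠ 1}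

/-- The preimage in `𝔥` of the elliptic configuration space `T_reg`: the points `z` such that
`α(z) ∉ ℤ + ℤτ` for every root `α`. -/
def ellReg (P : RootPairing ι ℂ M N) (τ : UpperHalfPlane) : Set N :=
  {z | ∀ i, ∀ m n : ℤ, P.root' i z ≠ m + n * (τ : ℂ)}

/-- `Ψ` is (the index set of) a root subsystem: it contains every root in its integral span. -/
def IsRootSubsystem (P : RootPairing ι ℂ M N) (Ψ : Set ι) : Prop :=
  ∀ i, P.root i ∈ Submodule.span ℤ (P.root '' Ψ) → i ∈ Ψ

open scoped Classical in
/-- The positive roots attached to a base. -/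
def posRoots [Fintype ι] {P : RootPairing ι ℂ M N} (b : P.Base) : Finset ι :=
  Finset.univ.filter fun i => b.IsPos i

end RootSystem

/-! ### The elliptic Lie algebra -/

/-- Generators `t_α`, `x(u)`, `y(u)` of the elliptic Lie algebra. -/
inductive EllGen (ι N : Type*) : Type _
  | t (i : ι) : EllGen ι N
  | x (u : N) : EllGen ι N
  | y (u : N) : EllGen ι N

/-- Generators `t_α`, `X(u)` of the trigonometric Lie algebra. -/
inductive TrigGen (ι N : Type*) : Type _
  | t (i : ι) : TrigGen ι N
  | X (u : N) : TrigGen ι N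

section Algebras

variable {ι M N : Type*} [Fintype ι] [AddCommGroup M] [Module ℂ M] [AddCommGroup N] [Module ℂ N]
  {P : RootPairing ι ℂ M N}

/-- The generator `t_α` in the free Lie algebra. -/
abbrev ft (N : Type*) (i : ι) : FreeLieAlgebra ℂ (EllGen ι N) := FreeLieAlgebra.of ℂ (EllGen.t i)

/-- The generator `x(u)` in the free Lie algebra. -/
abbrev fx (ι : Type*) (u : N) : FreeLieAlgebra ℂ (EllGen ι N) := FreeLieAlgebra.of ℂ (EllGen.x u)

/-- The generator `y(u)` in the free Lie algebra. -/
abbrev fy (ι : Type*) (u : N) : FreeLieAlgebra ℂ (EllGen ι N) := FreeLieAlgebra.of ℂ (EllGen.y u)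

open scoped Classical in
/-- The defining relators of the elliptic Lie algebra of the root system. -/
inductive EllRel (b : P.Base) : FreeLieAlgebra ℂ (EllGen ι N) → Prop
  | t_neg (i j : ι) (h : P.root j = -P.root i) : EllRel b (ft N j - ft N i)
  | x_add (u v : N) : EllRel b (fx ι (u + v) - (fx ι u + fx ι v))
  | x_smul (c : ℂ) (u : N) : EllRel b (fx ι (c • u) - c • fx ι u)
  | y_add (u v : N) : EllRel b (fy ι (u + v) - (fy ι u + fy ι v))
  | y_smul (c : ℂ) (u : N) : EllRel b (fy ι (c • u) - c • fy ι u)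
  | tt (Ψ : Set ι) (hΨ : IsRootSubsystem P Ψ) (i : ι) (hi : i ∈ Ψ) :
      EllRel b ⁅ft N i, ∑ j ∈ (posRoots b).filter (· ∈ Ψ), ft N j⁆
  | xx (u v : N) : EllRel b ⁅fx ι u, fx ι v⁆
  | yy (u v : N) : EllRel b ⁅fy ι u, fy ι v⁆
  | yx (u v : N) :
      EllRel b (⁅fy ι u, fx ι v⁆ - ∑ j ∈ posRoots b, (P.root' j v * P.root' j u) • ft N j)
  | tx (i : ι) (u : N) (h : P.root' i u = 0) : EllRel b ⁅ft N i, fx ι u⁆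
  | ty (i : ι) (u : N) (h : P.root' i u = 0) : EllRel b ⁅ft N i, fy ι u⁆

/-- The ideal generated by the defining relators of the elliptic Lie algebra. -/
def ellIdeal (b : P.Base) : LieIdeal ℂ (FreeLieAlgebra ℂ (EllGen ι N)) :=
  LieSubmodule.lieSpan ℂ (FreeLieAlgebra ℂ (EllGen ι N)) {a | EllRel b a}

/-- The elliptic Lie algebra `𝔱_ell` of the root system. -/
abbrev EllLie (b : P.Base) : Type _ := FreeLieAlgebra ℂ (EllGen ι N) ⧸ ellIdeal b

/-- The element `t_α` of the elliptic Lie algebra. -/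
def ellT (b : P.Base) (i : ι) : EllLie b := LieSubmodule.Quotient.mk (ft N i)

/-- Relators vanish in the elliptic Lie algebra. -/
theorem mk_eq_of_ellRel (b : P.Base) {p q : FreeLieAlgebra ℂ (EllGen ι N)}
    (h : EllRel b (p - q)) :
    (LieSubmodule.Quotient.mk p : EllLie b) = LieSubmodule.Quotient.mk q :=
  (Submodule.Quotient.eq (ellIdeal b).toSubmodule).2 (LieSubmodule.subset_lieSpan h)

/-- The linear map `x : 𝔥 → 𝔱_ell`. -/
def ellX (b : P.Base) : N →ₗ[ℂ] EllLie b where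
  toFun u := LieSubmodule.Quotient.mk (fx ι u)
  map_add' u v := mk_eq_of_ellRel b (EllRel.x_add u v)
  map_smul' c u := mk_eq_of_ellRel b (EllRel.x_smul c u)

/-- The linear map `y : 𝔥 → 𝔱_ell`. -/
def ellY (b : P.Base) : N →ₗ[ℂ] EllLie b where
  toFun u := LieSubmodule.Quotient.mk (fy ι u)
  map_add' u v := mk_eq_of_ellRel b (EllRel.y_add u v)
  map_smul' c u := mk_eq_of_ellRel b (EllRel.y_smul c u)

/-- `EllWeight b n a`: the element `a` is an iterated bracket of generators, homogeneous of degree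
`n` for the grading `deg x(u) = deg y(u) = 1`, `deg t_α = 2`. -/
inductive EllWeight (b : P.Base) : ℕ → EllLie b → Prop
  | x (u : N) : EllWeight b 1 (ellX b u)
  | y (u : N) : EllWeight b 1 (ellY b u)
  | t (i : ι) : EllWeight b 2 (ellT b i)
  | lie {m n : ℕ} {a c : EllLie b} (ha : EllWeight b m a) (hc : EllWeight b n c) :
      EllWeight b (m + n) ⁅a, c⁆

/-- The ideal of elements of degree at least `n` in the graded Lie algebra `𝔱_ell`. -/
def ellFiltration (b : P.Base) (n : ℕ) : LieIdeal ℂ (EllLie b) :=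
  LieSubmodule.lieSpan ℂ (EllLie b) {a | ∃ m, n ≤ m ∧ EllWeight b m a}

/-- The completion of the elliptic Lie algebra with respect to its grading. -/
abbrev EllHat (b : P.Base) : Type _ := Completion (ellFiltration b)

theorem ad_pow_mem_ellFiltration (b : P.Base) (u : N) (i : ι) (n k : ℕ) (hnk : n ≤ k) :
    ((LieAlgebra.ad ℂ (EllLie b) (ellX b u)) ^ k) (ellT b i) ∈ ellFiltration b n := by
  have key : ∀ k, EllWeight b (k + 2)
      (((LieAlgebra.ad ℂ (EllLie b) (ellX b u)) ^ k) (ellT b i)) := by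
    intro k
    induction k with
    | zero => simpa using EllWeight.t i
    | succ k ih =>
      rw [pow_succ', Module.End.mul_apply, LieAlgebra.ad_apply,
        show k + 1 + 2 = 1 + (k + 2) by ring]
      exact EllWeight.lie (EllWeight.x u) ih
  exact LieSubmodule.subset_lieSpan ⟨k + 2, by omega, key k⟩

/-- The image of `t_α` in the completion. -/
def hatT (b : P.Base) (i : ι) : EllHat b := toCompletion (ellFiltration b) (ellT b i)

/-- The linear map `y` with values in the completion. -/
def hatY (b : P.Base) : N →ₗ[ℂ] EllHat b :=
  (toCompletion (ellFiltration b)).toLinearMap.comp (ellY b)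

/-- The element `f(ad (x_{α^∨}/2))(t_α)` of the completion, for a power series `f`. -/
def hatSeries (b : P.Base) (f : PowerSeries ℂ) (i : ι) : EllHat b :=
  adSeries f (ellX b ((1 / 2 : ℂ) • P.coroot i)) (ellT b i)
    (ad_pow_mem_ellFiltration b _ i)

/-! ### The connections

A connection `∇ = d - A` on a trivial bundle over an open subset of `𝔥`, or of the torus
`H = 𝔥 / P^∨`, is encoded by its connection form: the value of `A` at a point is a linear map from
the tangent space `𝔥` to the Lie algebra. If `u_i`, `u^i` are dual bases, then the value of
`∑ f(u^i) du_i` on `u` is `f u`. -/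

/-- Form of the KZB connection:
`∇_{KZB,τ} = d - ∑_{α>0} k(α, ad (x_{α^∨}/2)|τ)(t_α) dα + ∑ y(u^i) du_i`. -/
def kzbForm (b : P.Base) (τ : UpperHalfPlane) (z : N) : N →ₗ[ℂ] EllHat b :=
  ∑ i ∈ posRoots b, (P.root' i).smulRight (hatSeries b (kSeries (P.root' i z) τ) i) - hatY b

/-- Form of the degenerate connection on `H_reg`: `∇^deg = d -
∑_{α>0} (2πi/(e^{2πiα} - 1) + 2πi e^{2πi a}/(e^{2πi a} - 1) - 1/a)(t_α) dα + ∑ y(u^i) du_i`,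
with `a = ad (x_{α^∨}/2)`. -/
def degForm (b : P.Base) (h : Torus P) : N →ₗ[ℂ] EllHat b :=
  ∑ i ∈ posRoots b, (P.root' i).smulRight
    (hatSeries b
      (PowerSeries.C (2 * Real.pi * Complex.I / (expRoot P i h - 1)) + hSeries) i) - hatY b

/-- The linear map
`u ↦ -y(u) + ∑_{α>0} α(u) (2πi e^{2πi a}/(e^{2πi a} - 1) - 1/a)(t_α)`, `a = ad (x_{α^∨}/2)`. -/
def hatXi (b : P.Base) : N →ₗ[ℂ] EllHat b :=
  -hatY b + ∑ i ∈ posRoots b, (P.root' i).smulRight (hatSeries b hSeries i)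

/-- Flatness on `U ⊆ 𝔥` of the connection `d - A`: the directional derivatives of the coefficients
of `A` exist and `∂_u A(v) - ∂_v A(u) = [A(u), A(v)]` for all constant vector fields `u`, `v`. -/
def IsFlatOn {V g : Type*} [AddCommGroup V] [Module ℂ V] [LieRing g] [LieAlgebra ℂ g]
    [TopologicalSpace g] (A : V → V →ₗ[ℂ] g) (U : Set V) : Prop :=
  ∀ z ∈ U, ∀ u v : V, ∃ a c : g,
    Filter.Tendsto (fun s : ℂ => s⁻¹ • (A (z + s • u) v - A z v)) (𝓝[≠] 0) (𝓝 a) ∧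
    Filter.Tendsto (fun s : ℂ => s⁻¹ • (A (z + s • v) u - A z u)) (𝓝[≠] 0) (𝓝 c) ∧
    a - c = ⁅A z u, A z v⁆

/-! ### The trigonometric Lie algebra -/

/-- The generator `t_α` in the free Lie algebra. -/
abbrev gt (N : Type*) (i : ι) : FreeLieAlgebra ℂ (TrigGen ι N) := FreeLieAlgebra.of ℂ (TrigGen.t i)

/-- The generator `X(u)` in the free Lie algebra. -/
abbrev gX (ι : Type*) (u : N) : FreeLieAlgebra ℂ (TrigGen ι N) := FreeLieAlgebra.of ℂ (TrigGen.X u)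

open scoped Classical in
/-- The defining relators of the trigonometric Lie algebra. They express the flatness of
`d - ∑_{α>0} c dα/(e^{cα} - 1) t_α - ∑ X(u^i) du_i`. In `tX`, with `X_w(u) =
X(u) - c ∑_{β ∈ Φ₊ ∩ wΦ₋} β(u) t_β`, the relator is `[t_α, X_w(u)]`. -/
inductive TrigRel (b : P.Base) (c : ℂ) : FreeLieAlgebra ℂ (TrigGen ι N) → Prop
  | t_neg (i j : ι) (h : P.root j = -P.root i) : TrigRel b c (gt N j - gt N i)
  | X_add (u v : N) : TrigRel b c (gX ι (u + v) - (gX ι u + gX ι v))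
  | X_smul (a : ℂ) (u : N) : TrigRel b c (gX ι (a • u) - a • gX ι u)
  | tt (Ψ : Set ι) (hΨ : IsRootSubsystem P Ψ)
      (hr : Module.finrank ℂ (Submodule.span ℂ (P.root '' Ψ)) = 2) (i : ι) (hi : i ∈ Ψ) :
      TrigRel b c ⁅gt N i, ∑ j ∈ (posRoots b).filter (· ∈ Ψ), gt N j⁆
  | XX (u v : N) : TrigRel b c ⁅gX ι u, gX ι v⁆
  | tX (i : ι) (hi : b.IsPos i) (w : P.weylGroup)
      (hw : P.weylGroupToPerm w⁻¹ i ∈ b.support) (u : N) (hu : P.root' i u = 0) :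
      TrigRel b c ⁅gt N i, gX ι u -
        c • ∑ j ∈ (posRoots b).filter (fun j => ¬ b.IsPos (P.weylGroupToPerm w⁻¹ j)),
          P.root' j u • gt N j⁆

/-- The ideal generated by the defining relators of the trigonometric Lie algebra. -/
def trigIdeal (b : P.Base) (c : ℂ) : LieIdeal ℂ (FreeLieAlgebra ℂ (TrigGen ι N)) :=
  LieSubmodule.lieSpan ℂ (FreeLieAlgebra ℂ (TrigGen ι N)) {a | TrigRel b c a}

/-- The trigonometric Lie algebra `𝔱_trig`, for the normalization `c` of the exponentials. -/
abbrev TrigLie (b : P.Base) (c : ℂ) : Type _ := FreeLieAlgebra ℂ (TrigGen ι N) ⧸ trigIdeal b c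

/-- The element `t_α` of the trigonometric Lie algebra. -/
def trigT (b : P.Base) (c : ℂ) (i : ι) : TrigLie b c := LieSubmodule.Quotient.mk (gt N i)

/-- Relators vanish in the trigonometric Lie algebra. -/
theorem mk_eq_of_trigRel (b : P.Base) (c : ℂ) {p q : FreeLieAlgebra ℂ (TrigGen ι N)}
    (h : TrigRel b c (p - q)) :
    (LieSubmodule.Quotient.mk p : TrigLie b c) = LieSubmodule.Quotient.mk q :=
  (Submodule.Quotient.eq (trigIdeal b c).toSubmodule).2 (LieSubmodule.subset_lieSpan h)

/-- The linear map `X : 𝔥 → 𝔱_trig`. -/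
def trigX (b : P.Base) (c : ℂ) : N →ₗ[ℂ] TrigLie b c where
  toFun u := LieSubmodule.Quotient.mk (gX ι u)
  map_add' u v := mk_eq_of_trigRel b c (TrigRel.X_add u v)
  map_smul' a u := mk_eq_of_trigRel b c (TrigRel.X_smul a u)

/-- Form of the universal trigonometric connection on `H_reg`:
`∇_trig = d - ∑_{α>0} 2πi dα/(e^{2πiα} - 1) t_α - ∑ X(u^i) du_i`. -/
def trigForm (b : P.Base) (h : Torus P) : N →ₗ[ℂ] TrigLie b (2 * Real.pi * Complex.I) :=
  ∑ i ∈ posRoots b, (P.root' i).smulRight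
    ((2 * Real.pi * Complex.I / (expRoot P i h - 1)) • trigT b (2 * Real.pi * Complex.I) i) +
  trigX b (2 * Real.pi * Complex.I)

end Algebras

end KZB

end

noncomputable section

namespace KZB

set_option linter.unusedSectionVars false

/-! ### Root strings in the `t_α` relations -/

section Strings

variable {ι M N : Type*} [AddCommGroup M] [Module ℂ M] [AddCommGroup N] [Module ℂ N]

/-! Flatness and the homomorphism both come from one identity, `lie_cotForm_eq_zero`. Attach a
number c_α to each root and put A_c(u) = ∑_{α>0} α(u) (c_α + g(a_α))(t_α) - y(u), where g(x) = π
cot(πx) - 1/x. If c_{-α} = -c_α, and c_α c_β + c_β c_γ + c_γ c_α = π² whenever α + β + γ = 0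
(`IsCotFamily`), then all the elements A_c(u) commute.

Three families are used. With c_α = π cot(πα(z)), A_c is the form of ∇^deg at z. The point z enters
only through functions of α(z) multiplying dα, so the form is closed and flatness amounts to
[A_c(u), A_c(v)] = 0. With c_α = ±πi according to the sign of w⁻¹α, A_c(u) is ξ(u) - 2πi ∑ β(u) t_β
over Φ⁺ ∩ wΦ⁻; for w = 1 this gives [ξ(u), ξ(v)] = 0. If moreover w⁻¹α is simple, the value at α may
be replaced by any s (and that at -α by -s). This changes A_c(u) by a multiple α(u)(s - c_α) of t_α,
so comparing two values of s gives the relation between t_α and X_w(v) for α(v) = 0.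

For the identity itself, expand [A_c(u), A_c(v)]. Brackets of two t-series are polynomials in
commuting operators ad x applied to [t_α, t_β]; brackets of y with a t-series become divided
differences, through [y, x] = ∑ t. The result is a sum over pairs of roots of (α ∧ β)(u, v)
H_{αβ}[t_α, t_β]. The relations among the t_α allow one to write [t_α, t_β] = T_α(β) + T_α(-β),
where T (`stringTail`) is a partial sum along a root string, vanishes if α + β is not a root, and is
invariant under cyclic rotation of triples with α + β + γ = 0
(`IsHolonomyFamily.stringTail_cyclic`). The sum thus reduces to such triples, and there H_{αβ} +
H_{βγ} + H_{γα} = 0 is the addition formula of the cotangent combined with the quadratic condition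
on c (`pairPoly_cyclic`).

For the limit, q → 0 and dominated convergence of the product show that θ tends to sin(πz)/π,
locally uniformly and with all derivatives. Each coefficient of k in x depends continuously on
Taylor coefficients of θ, and the limiting kernel is π sin(π(z+x)) / (sin πz sin πx) - 1/x = π cot
πz + π cot πx - 1/x (`kernelSeries_sinPi`). -/

theorem root_negIdx (P : RootPairing ι ℂ M N) (i : ι) :
    P.root (P.reflectionPerm i i) = -P.root i := by simp

theorem root'_negIdx (P : RootPairing ι ℂ M N) (i : ι) :
    P.root' (P.reflectionPerm i i) = -P.root' i := by
  ext u; simp [RootPairing.root']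

theorem coroot_negIdx (P : RootPairing ι ℂ M N) (i : ι) :
    P.coroot (P.reflectionPerm i i) = -P.coroot i := by simp

theorem negIdx_negIdx (P : RootPairing ι ℂ M N) (i : ι) :
    P.reflectionPerm (P.reflectionPerm i i) (P.reflectionPerm i i) = i :=
  P.root.injective (by rw [root_negIdx, root_negIdx, neg_neg])

/-- The negation of roots, as a permutation of the index set. -/
def negIdx (P : RootPairing ι ℂ M N) : ι ≃ ι where
  toFun i := P.reflectionPerm i i
  invFun i := P.reflectionPerm i i
  left_inv := negIdx_negIdx P
  right_inv := negIdx_negIdx P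

theorem root_ne_zero (P : RootPairing ι ℂ M N) (i : ι) : P.root i ≠ 0 := P.ne_zero i

theorem zsmul_root_eq_zero {P : RootPairing ι ℂ M N} {i : ι} {n : ℤ} (h : n • P.root i = 0) :
    n = 0 := by
  rw [← Int.cast_smul_eq_zsmul ℂ, smul_eq_zero] at h
  rcases h with h | h
  · exact_mod_cast h
  · exact absurd h (root_ne_zero P i)

/-- For two roots which are not proportional there is a vector on which the first one takes the
value `1` and the second one the value `0`. -/
theorem exists_dual_vector [Finite ι] (P : RootPairing ι ℂ M N) [P.IsReduced] {i j : ι}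
    (h : i ≠ j) (h' : P.root i ≠ -P.root j) :
    ∃ u : N, P.root' i u = 1 ∧ P.root' j u = 0 := by
  have hl := RootPairing.IsReduced.linearIndependent P h h'
  have : IsAddTorsionFree M := by
    exact .of_isTorsionFree ℂ M
  have hw : P.pairing i j * P.pairing j i ≠ 4 :=
    P.coxeterWeight_ne_four_of_linearIndependent hl
  have hw' : 4 - P.pairing i j * P.pairing j i ≠ 0 := sub_ne_zero.2 hw.symm
  -- Cramer's rule in the plane of the two coroots: the determinant of their pairing matrix is 4 -
  -- p_ij p_ji, non-zero because the roots are independent.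
  refine ⟨(4 - P.pairing i j * P.pairing j i)⁻¹ • ((2 : ℂ) • P.coroot i - P.pairing j i • P.coroot j),
    ?_, ?_⟩
  · simp only [map_smul, map_sub, RootPairing.root'_coroot_eq_pairing, RootPairing.pairing_same,
      smul_eq_mul]
    field_simp
    ring
  · simp only [map_smul, map_sub, RootPairing.root'_coroot_eq_pairing, RootPairing.pairing_same,
      smul_eq_mul]
    ring

/-- A root which lies in `ℤ α` is `±α`. -/
theorem eq_or_eq_neg_of_root_eq_zsmul [Finite ι] (P : RootPairing ι ℂ M N) [P.IsReduced] {i k : ι}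
    {n : ℤ} (h : P.root k = n • P.root i) : k = i ∨ k = P.reflectionPerm i i := by
  by_contra! hc
  obtain ⟨u, hu, hu'⟩ := exists_dual_vector P hc.1 (fun h' => hc.2 (P.root_eq_neg_iff.1 h'))
  have h1 : P.root' k u = n • P.root' i u := by
    simp only [RootPairing.root', h, map_zsmul, LinearMap.smul_apply]
  rw [hu, hu', smul_zero] at h1
  exact one_ne_zero h1

/-- A family of elements of a Lie algebra indexed by the roots, which satisfies the relations
`t_{-α} = t_α` and `[t_α, ∑_{β ∈ Ψ} t_β] = 0` for root subsystems `Ψ ∋ α`. -/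
structure IsHolonomyFamily [Fintype ι] (P : RootPairing ι ℂ M N) {L : Type*} [LieRing L]
    (t : ι → L) : Prop where
  neg (i : ι) : t (P.reflectionPerm i i) = t i
  lie_sum (Ψ : Set ι) (hΨ : IsRootSubsystem P Ψ) (i : ι) (hi : i ∈ Ψ) :
    open scoped Classical in ∑ k with k ∈ Ψ, ⁅t i, t k⁆ = 0

variable [Fintype ι] {P : RootPairing ι ℂ M N} {L : Type*} [LieRing L] [LieAlgebra ℂ L] {t : ι → L}

theorem IsHolonomyFamily.lie_eq_zero [P.IsReduced] (ht : IsHolonomyFamily P t) {i k : ι}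
    {n : ℤ} (h : P.root k = n • P.root i) : ⁅t i, t k⁆ = 0 := by
  rcases eq_or_eq_neg_of_root_eq_zsmul P h with rfl | rfl
  · exact lie_self _
  · rw [ht.neg, lie_self]

-- Let S(q) be the sum over the roots in qβ + ℤα. The roots in ℤα + qℤβ form a root subsystem, so
-- ∑_r S(rq) = 0. Since S is even, S(0) = 0 and S vanishes far out, descending induction on q > 0
-- leaves 2 S(q) = 0; the claim is q = 1.
open scoped Classical in
theorem IsHolonomyFamily.sum_string [P.IsReduced] (ht : IsHolonomyFamily P t) (i j : ι) :
    ∑ k with ∃ n : ℤ, P.root k = P.root j + n • P.root i, ⁅t i, t k⁆ = 0 := by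
  by_cases hij : j = i ∨ P.root j = -P.root i
  · refine Finset.sum_eq_zero fun k hk => ?_
    obtain ⟨n, hn⟩ := (Finset.mem_filter.1 hk).2
    rcases hij with rfl | hij
    · exact ht.lie_eq_zero (n := 1 + n) (by rw [hn]; module)
    · exact ht.lie_eq_zero (n := -1 + n) (by rw [hn, hij]; module)
  push Not at hij
  obtain ⟨u, hu, hu'⟩ := exists_dual_vector P hij.1 hij.2
  have hlev : ∀ {k : ι} {p q : ℤ}, P.root k = p • P.root i + q • P.root j → P.root' k u = q := by
    intro k p q h
    have : P.root' k u = p • P.root' i u + q • P.root' j u := by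
      simp only [RootPairing.root', h, map_add, map_zsmul, LinearMap.add_apply,
        LinearMap.smul_apply]
    rw [this, hu, hu']
    simp
  let S : ℤ → L := fun q => ∑ k with ∃ p : ℤ, P.root k = p • P.root i + q • P.root j, ⁅t i, t k⁆
  have hSneg : ∀ q, S (-q) = S q := by
    intro q
    refine Finset.sum_equiv (negIdx P) (fun k => ?_) (fun k _ => ?_)
    · simp only [Finset.mem_filter, Finset.mem_univ, true_and, negIdx, Equiv.coe_fn_mk,
        root_negIdx]
      constructor
      · rintro ⟨p, hp⟩
        exact ⟨-p, by rw [hp]; module⟩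
      · rintro ⟨p, hp⟩
        exact ⟨-p, by rw [← neg_neg (P.root k), hp]; module⟩
    · simp only [negIdx, Equiv.coe_fn_mk, ht.neg]
  have hS0 : S 0 = 0 := Finset.sum_eq_zero fun k hk => by
    obtain ⟨n, hn⟩ := (Finset.mem_filter.1 hk).2
    exact ht.lie_eq_zero (n := n) (by rw [hn]; module)
  obtain ⟨B, hB⟩ : ∃ B : ℕ, ∀ q : ℤ, B ≤ q → S q = 0 := by
    obtain ⟨B, hB⟩ := (Set.finite_range fun k => ‖P.root' k u‖).bddAbove
    obtain ⟨m, hm⟩ := exists_nat_gt B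
    refine ⟨m, fun q hq => Finset.sum_eq_zero fun k hk => ?_⟩
    obtain ⟨n, hn⟩ := (Finset.mem_filter.1 hk).2
    have h1 := hB ⟨k, rfl⟩
    simp only [hlev hn, Complex.norm_intCast] at h1
    have h2 : (m : ℝ) ≤ q := by exact_mod_cast hq
    linarith [le_abs_self (q : ℝ)]
  have main : ∀ n : ℕ, ∀ q : ℤ, 0 < q → (B : ℤ) ≤ q + n → S q = 0 := by
    intro n
    induction n with
    | zero => exact fun q _ h => hB q (by simpa using h)
    | succ n ih =>
      intro q hq hBq
      let Ψ : Set ι := {k | ∃ p r : ℤ, P.root k = p • P.root i + (r * q) • P.root j}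
      have hΨ : IsRootSubsystem P Ψ := by
        intro k hk
        have hle : Submodule.span ℤ (P.root '' Ψ) ≤
            Submodule.span ℤ {P.root i, q • P.root j} := by
          rw [Submodule.span_le]
          rintro _ ⟨l, ⟨p, r, hl⟩, rfl⟩
          exact Submodule.mem_span_pair.2 ⟨p, r, by rw [hl, mul_smul]⟩
        obtain ⟨p, r, h⟩ := Submodule.mem_span_pair.1 (hle hk)
        exact ⟨p, r, by rw [← h, mul_smul]⟩
      have hi : i ∈ Ψ := ⟨1, 0, by module⟩
      have h0 := ht.lie_sum Ψ hΨ i hi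
      have hlevel : ∀ k ∈ Ψ, ∃ r : ℤ, P.root' k u = r * q := by
        rintro k ⟨p, r, h⟩
        exact ⟨r, by rw [hlev h]; push_cast; ring⟩
      choose! lev hlev' using hlevel
      have hfib : ∀ r : ℤ, ∑ k with k ∈ Ψ ∧ lev k = r, ⁅t i, t k⁆ = S (r * q) := by
        intro r
        refine Finset.sum_congr (Finset.filter_congr fun k _ => ?_) fun _ _ => rfl
        constructor
        · rintro ⟨hk, rfl⟩
          obtain ⟨p, r, h⟩ := id hk
          have := hlev' k hk
          rw [hlev h] at this
          exact ⟨p, by rw [h]; congr 2; exact_mod_cast this⟩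
        · rintro ⟨p, h⟩
          have hk : k ∈ Ψ := ⟨p, r, h⟩
          refine ⟨hk, ?_⟩
          have := hlev' k hk
          rw [hlev h] at this
          have h3 : r * q = lev k * q := by exact_mod_cast this
          exact (mul_right_cancel₀ hq.ne' h3).symm
      have hzero : ∀ r : ℤ, r ≠ 1 ∧ r ≠ -1 → S (r * q) = 0 := by
        have hpos : ∀ r : ℤ, 1 < r → S (r * q) = 0 := fun r hr =>
          ih (r * q) (by positivity) (by push_cast at hBq; nlinarith)
        rintro r ⟨h1, h2⟩
        rcases lt_trichotomy r 0 with h | rfl | h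
        · rw [← hSneg, ← neg_mul]
          exact hpos _ (by omega)
        · rw [zero_mul, hS0]
        · exact hpos _ (by omega)
      -- The levels ±1 are adjoined so that they can be singled out even when no root lies there;
      -- empty levels contribute 0.
      have h1 : ∑ r ∈ Finset.univ.image lev ∪ {1, -1}, S (r * q) = 0 := by
        rw [← h0, ← Finset.sum_fiberwise_of_maps_to (g := lev)
          (t := Finset.univ.image lev ∪ {1, -1}) (fun k _ => by simp)]
        refine Finset.sum_congr rfl fun r _ => ?_
        rw [← hfib, Finset.filter_filter]
      rw [Finset.sum_eq_add_of_mem (1 : ℤ) (-1) (by simp) (by simp) (by norm_num)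
        (fun c _ hc => hzero c hc), one_mul, neg_one_mul, hSneg, ← two_smul ℂ] at h1
      exact (smul_eq_zero.1 h1).resolve_left two_ne_zero
  have := main B 1 one_pos (by omega)
  rw [← this]
  refine Finset.sum_congr (Finset.filter_congr fun k _ => ?_) fun _ _ => rfl
  exact exists_congr fun n => by rw [one_smul, add_comm]

end Strings

/-! ### Tails of root strings and sums over zero triples -/

section StringTails

variable {ι M N : Type*} [Fintype ι] [AddCommGroup M] [Module ℂ M] [AddCommGroup N] [Module ℂ N]
  {P : RootPairing ι ℂ M N} {L : Type*} [LieRing L] [LieAlgebra ℂ L] {t : ι → L}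

open scoped Classical in
/-- The sum of the brackets `[t_α, t_β]` over the roots `β` in `m - ℕ α`. -/
def stringTail (P : RootPairing ι ℂ M N) (t : ι → L) (i : ι) (m : M) : L :=
  ∑ k with ∃ n : ℕ, P.root k = m - n • P.root i, ⁅t i, t k⁆

theorem lie_eq_stringTail_sub (P : RootPairing ι ℂ M N) (t : ι → L) (i j : ι) :
    ⁅t i, t j⁆ = stringTail P t i (P.root j) - stringTail P t i (P.root j - P.root i) := by
  classical
  have hset : (Finset.univ.filter fun k => ∃ n : ℕ, P.root k = P.root j - n • P.root i) =
      insert j (Finset.univ.filter fun k => ∃ n : ℕ,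
        P.root k = P.root j - P.root i - n • P.root i) := by
    ext k
    simp only [Finset.mem_filter, Finset.mem_univ, true_and, Finset.mem_insert]
    constructor
    · rintro ⟨n, hn⟩
      rcases n with _ | n
      · exact Or.inl (P.root.injective (by simpa using hn))
      · exact Or.inr ⟨n, by rw [hn]; module⟩
    · rintro (rfl | ⟨n, hn⟩)
      · exact ⟨0, by simp⟩
      · exact ⟨n + 1, by rw [hn]; module⟩
  have hj : j ∉ Finset.univ.filter fun k => ∃ n : ℕ,
        P.root k = P.root j - P.root i - n • P.root i := by
    simp only [Finset.mem_filter, Finset.mem_univ, true_and, not_exists]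
    intro n hn
    have h : ((n : ℤ) + 1) • P.root i = 0 := by
      have h2 : P.root j - (P.root j - P.root i - n • P.root i) = 0 := sub_eq_zero.2 hn
      rw [← h2]; module
    have := zsmul_root_eq_zero h
    omega
  rw [stringTail, hset, Finset.sum_insert hj, stringTail, add_sub_cancel_right]

theorem IsHolonomyFamily.stringTail_neg_neg (ht : IsHolonomyFamily P t) (i : ι) (m : M) :
    stringTail P t (P.reflectionPerm i i) (-m) = stringTail P t i m := by
  classical
  refine Finset.sum_equiv (negIdx P) (fun k => ?_) (fun k _ => ?_)
  · simp only [Finset.mem_filter, Finset.mem_univ, true_and, negIdx, Equiv.coe_fn_mk, root_negIdx]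
    refine exists_congr fun n => ?_
    rw [neg_eq_iff_eq_neg]
    exact ⟨fun h => by rw [h]; module, fun h => by rw [h]; module⟩
  · simp only [negIdx, Equiv.coe_fn_mk, ht.neg]

/-- After negating its roots, the second tail runs over β + α, β + 2α, and so on. Together with the
first it exhausts the α-string through β, whose total is zero by `sum_string`. -/
theorem IsHolonomyFamily.stringTail_add [P.IsReduced] (ht : IsHolonomyFamily P t) (i j : ι) :
    stringTail P t i (P.root j) + stringTail P t i (-P.root j - P.root i) = 0 := by
  classical
  have h2 : stringTail P t i (-P.root j - P.root i) =
      ∑ k with ∃ n : ℕ, P.root k = P.root j + ((n : ℤ) + 1) • P.root i, ⁅t i, t k⁆ := by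
    refine Finset.sum_equiv (negIdx P) (fun k => ?_) (fun k _ => ?_)
    · simp only [Finset.mem_filter, Finset.mem_univ, true_and, negIdx, Equiv.coe_fn_mk,
        root_negIdx]
      refine exists_congr fun n => ?_
      rw [neg_eq_iff_eq_neg]
      exact ⟨fun h => by rw [h]; module, fun h => by rw [h]; module⟩
    · simp only [negIdx, Equiv.coe_fn_mk, ht.neg]
  rw [h2, stringTail, ← Finset.sum_union, ← ht.sum_string i j]
  · refine Finset.sum_congr ?_ fun _ _ => rfl
    ext k
    simp only [Finset.mem_union, Finset.mem_filter, Finset.mem_univ, true_and]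
    constructor
    · rintro (⟨n, hn⟩ | ⟨n, hn⟩)
      · exact ⟨-n, by rw [hn]; module⟩
      · exact ⟨n + 1, hn⟩
    · rintro ⟨n, hn⟩
      rcases lt_or_ge 0 n with h | h
      · refine Or.inr ⟨(n - 1).toNat, ?_⟩
        rw [Int.toNat_of_nonneg (by omega), sub_add_cancel, hn]
      · refine Or.inl ⟨(-n).toNat, ?_⟩
        rw [← natCast_zsmul, Int.toNat_of_nonneg (by omega), hn]
        module
  · rw [Finset.disjoint_filter]
    rintro k - ⟨n, hn⟩ ⟨n', hn'⟩
    have h : ((n : ℤ) + n' + 1) • P.root i = 0 := by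
      have h2 : P.root j + ((n' : ℤ) + 1) • P.root i - (P.root j - n • P.root i) = 0 :=
        sub_eq_zero.2 (hn'.symm.trans hn)
      rw [← h2]; module
    have := zsmul_root_eq_zero h
    omega

/-- The tail is minus the sum over the roots β + nα with n ≥ 1. Root strings are unbroken, so if β +
α is not a root there are none; proportional α and β contribute only zero brackets. -/
theorem IsHolonomyFamily.stringTail_eq_zero [P.IsReduced] [P.IsCrystallographic]
    (ht : IsHolonomyFamily P t) {i j : ι}
    (h : P.root j + P.root i ∉ Set.range P.root) : stringTail P t i (P.root j) = 0 := by
  classical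
  rw [eq_neg_of_add_eq_zero_left (ht.stringTail_add i j), neg_eq_zero]
  by_cases hij : j = i ∨ P.root j = -P.root i
  · refine Finset.sum_eq_zero fun k hk => ?_
    obtain ⟨n, hn⟩ := (Finset.mem_filter.1 hk).2
    rcases hij with rfl | hij
    · exact ht.lie_eq_zero (n := -2 - n) (by rw [hn]; module)
    · exact ht.lie_eq_zero (n := -n) (by rw [hn, hij]; module)
  push Not at hij
  have hl := RootPairing.IsReduced.linearIndependent P hij.1.symm
    (fun h' => hij.2 (by rw [h', neg_neg]))
  refine Finset.sum_eq_zero fun k hk => ?_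
  obtain ⟨n, hn⟩ := (Finset.mem_filter.1 hk).2
  exfalso
  have h1 : P.root j + (n + 1) • P.root i ∈ Set.range P.root :=
    ⟨P.reflectionPerm k k, by rw [root_negIdx, hn]; module⟩
  rw [P.root_add_nsmul_mem_range_iff_le_chainTopCoeff hl] at h1
  apply h
  have := (P.root_add_nsmul_mem_range_iff_le_chainTopCoeff hl (n := 1)).2 (by omega)
  rwa [one_smul] at this

/-- The sum of `stringTail` over the two orders of a pair of roots vanishes. -/
theorem IsHolonomyFamily.stringTail_antisymm [P.IsReduced] [P.IsCrystallographic] (b : P.Base)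
    (ht : IsHolonomyFamily P t) (i j : ι) :
    stringTail P t i (P.root j) + stringTail P t j (P.root i) = 0 := by
  -- D is symmetric, odd in the second argument, and zero when the sum of its arguments is not a
  -- root. If γ = α + β is a root, then D(α, β) = D(β, γ) + D(α, γ), where the total height has
  -- grown when α and β are positive: a descending induction on height settles positive pairs, and
  -- oddness the others.
  let D : ι → ι → L := fun i j => stringTail P t i (P.root j) + stringTail P t j (P.root i)
  have hcomm : ∀ i j, D i j = D j i := fun i j => add_comm _ _
  have hneg : ∀ i j, D i (P.reflectionPerm j j) = -D i j := by
    intro i j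
    have h1 := lie_eq_stringTail_sub P t i j
    have h2 := lie_eq_stringTail_sub P t j i
    have h3 := ht.stringTail_add i (P.reflectionPerm j j)
    have h4 := ht.stringTail_add j (P.reflectionPerm i i)
    rw [root_negIdx, neg_neg] at h3 h4
    have h5 := ht.stringTail_neg_neg j (-P.root i)
    rw [neg_neg] at h5
    have h6 : ⁅t i, t j⁆ + ⁅t j, t i⁆ = 0 := by rw [← lie_skew, neg_add_cancel]
    simp only [D, root_negIdx, h5]
    rw [h1, h2] at h6
    rw [eq_neg_iff_add_eq_zero, ← h6, eq_neg_of_add_eq_zero_left h3, eq_neg_of_add_eq_zero_left h4]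
    abel
  have hzero : ∀ i j, P.root j + P.root i ∉ Set.range P.root → D i j = 0 := by
    intro i j h
    simp only [D]
    rw [ht.stringTail_eq_zero h, ht.stringTail_eq_zero (by rwa [add_comm]), add_zero]
  have hcyc : ∀ i j k, P.root k = P.root i + P.root j → D i j = D j k + D i k := by
    intro i j k h
    have h1 := ht.stringTail_add i (P.reflectionPerm k k)
    have h2 := ht.stringTail_add j (P.reflectionPerm k k)
    have h3 := ht.stringTail_add (P.reflectionPerm k k) i
    have e1 : P.root i + P.root j - P.root i = P.root j := by abel
    have e2 : P.root i + P.root j - P.root j = P.root i := by abel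
    have e3 : -P.root i - -(P.root i + P.root j) = P.root j := by abel
    rw [root_negIdx, neg_neg, h] at h1 h2
    rw [root_negIdx, h] at h3
    rw [e1] at h1
    rw [e2] at h2
    rw [e3] at h3
    have h4 : D i j + (D j (P.reflectionPerm k k) + D i (P.reflectionPerm k k)) = 0 := by
      simp only [D, root_negIdx, h]
      rw [eq_neg_of_add_eq_zero_left h1, eq_neg_of_add_eq_zero_left h2,
        eq_neg_of_add_eq_zero_left h3]
      abel
    rw [hneg, hneg] at h4
    rw [eq_neg_of_add_eq_zero_left h4]
    abel
  obtain ⟨B, hB⟩ : ∃ B : ℤ, ∀ i, b.height i ≤ B := by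
    obtain ⟨B, hB⟩ := (Set.finite_range b.height).bddAbove
    exact ⟨B, fun i => hB ⟨i, rfl⟩⟩
  -- No height exceeds B, so the case n = 0 is vacuous; n measures how far the total height may lie
  -- below the bound 2B.
  have hpos : ∀ n : ℕ, ∀ i j, b.IsPos i → b.IsPos j → 2 * B < b.height i + b.height j + n →
      D i j = 0 := by
    intro n
    induction n with
    | zero =>
      intro i j _ _ h
      have := hB i
      have := hB j
      push_cast at h
      omega
    | succ n ih =>
      intro i j hi hj h
      by_cases hr : P.root j + P.root i ∈ Set.range P.root
      · obtain ⟨k, hk⟩ := hr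
        rw [add_comm] at hk
        have hkh := b.height_add hk
        have hkp := hi.add hj hk
        rw [RootPairing.Base.isPos_iff] at hi hj
        push_cast at h
        rw [hcyc i j k hk, ih j k hj hkp (by omega), ih i k hi hkp (by omega), add_zero]
      · exact hzero i j hr
  have hpos' : ∀ i j, b.IsPos i → b.IsPos j → D i j = 0 := fun i j hi hj =>
    hpos (2 * B - b.height i - b.height j + 1).toNat i j hi hj (by omega)
  let := P.indexNeg
  have hposl : ∀ i j, b.IsPos i → D i j = 0 := by
    intro i j hi
    rcases RootPairing.Base.IsPos.or_neg b j with h | h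
    · exact hpos' i j hi h
    · exact neg_eq_zero.1 ((hneg i j).symm.trans (hpos' i _ hi h))
  rcases RootPairing.Base.IsPos.or_neg b i with h | h
  · exact hposl i j h
  · have := hposl _ j h
    rw [hcomm] at this
    rw [← neg_eq_zero]
    change -D i j = 0
    rw [hcomm i j, ← hneg]
    exact this

/-- A bracket is the difference of two consecutive tails, and `stringTail_add` turns the shorter one
into a tail starting at -β. -/
theorem IsHolonomyFamily.lie_eq [P.IsReduced] (ht : IsHolonomyFamily P t) (i j : ι) :
    ⁅t i, t j⁆ = stringTail P t i (P.root j) +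
      stringTail P t i (P.root (P.reflectionPerm j j)) := by
  have h := ht.stringTail_add i (P.reflectionPerm j j)
  rw [lie_eq_stringTail_sub P t i j, eq_neg_of_add_eq_zero_left h, root_negIdx, neg_neg,
    sub_eq_add_neg]

theorem IsHolonomyFamily.stringTail_cyclic [P.IsReduced] [P.IsCrystallographic] (b : P.Base)
    (ht : IsHolonomyFamily P t) {i j k : ι} (h : P.root i + P.root j + P.root k = 0) :
    stringTail P t j (P.root k) = stringTail P t i (P.root j) := by
  have h1 := ht.stringTail_add j i
  have h2 : -P.root i - P.root j = P.root k := by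
    rw [← sub_eq_zero, ← neg_eq_zero, ← h]; abel
  rw [h2] at h1
  rw [eq_neg_of_add_eq_zero_right h1, eq_neg_of_add_eq_zero_left (ht.stringTail_antisymm b i j)]

open scoped Classical in
/-- The triples of roots with sum zero. -/
def zeroTriples (P : RootPairing ι ℂ M N) : Finset (ι × ι × ι) :=
  Finset.univ.filter fun x => P.root x.1 + P.root x.2.1 + P.root x.2.2 = 0

/-- The third root of a zero triple is determined by the first two, and a pair which cannot be
completed to a triple has zero tail. -/
theorem IsHolonomyFamily.sum_stringTail [P.IsReduced] [P.IsCrystallographic]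
    (ht : IsHolonomyFamily P t) {V : Type*} [AddCommGroup V] (H : ι → ι → L →+ V) :
    ∑ i, ∑ j, H i j (stringTail P t i (P.root j)) =
      ∑ x ∈ zeroTriples P, H x.1 x.2.1 (stringTail P t x.1 (P.root x.2.1)) := by
  classical
  rw [zeroTriples, Finset.sum_filter, Fintype.sum_prod_type]
  refine Finset.sum_congr rfl fun i _ => ?_
  rw [Fintype.sum_prod_type]
  refine Finset.sum_congr rfl fun j _ => ?_
  by_cases h : P.root j + P.root i ∈ Set.range P.root
  · obtain ⟨k, hk⟩ := h
    rw [Finset.sum_eq_single (P.reflectionPerm k k), if_pos]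
    · rw [root_negIdx, hk]; abel
    · intro l _ hl
      rw [if_neg]
      intro h
      apply hl
      apply P.root.injective
      rw [root_negIdx, hk, ← sub_eq_zero, ← h]
      abel
    · simp
  · simp [ht.stringTail_eq_zero h]

/-- A weighted sum of the brackets `[t_α, t_β]` vanishes if the weights are even and satisfy a
three-term identity on the triples of roots with sum zero. -/
theorem IsHolonomyFamily.sum_lie_eq_zero [P.IsReduced] [P.IsCrystallographic] (b : P.Base)
    (ht : IsHolonomyFamily P t) {V : Type*} [AddCommGroup V] [Module ℂ V]
    (H : ι → ι → L →ₗ[ℂ] V)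
    (heven : ∀ i j, H i (P.reflectionPerm j j) (stringTail P t i (P.root j)) =
      H i j (stringTail P t i (P.root j)))
    (hcyc : ∀ i j k, P.root i + P.root j + P.root k = 0 →
      (H i j + H j k + H k i) (stringTail P t i (P.root j)) = 0) :
    ∑ i, ∑ j, H i j ⁅t i, t j⁆ = 0 := by
  classical
  -- Evenness makes the two halves of [t_α, t_β] = T_α(β) + T_α(-β) contribute equally, so the sum
  -- is 2S. Rotating the triples, with T unchanged, writes S in three ways whose sum is zero.
  let S : V := ∑ i, ∑ j, H i j (stringTail P t i (P.root j))
  have h1 : ∑ i, ∑ j, H i j ⁅t i, t j⁆ = (2 : ℂ) • S := by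
    simp only [ht.lie_eq, map_add, Finset.sum_add_distrib, two_smul, S]
    congr 1
    refine Finset.sum_congr rfl fun i _ => ?_
    rw [← (negIdx P).sum_comp]
    refine Finset.sum_congr rfl fun j _ => ?_
    simp only [negIdx, Equiv.coe_fn_mk, heven, negIdx_negIdx]
  have hS : S = ∑ x ∈ zeroTriples P, H x.1 x.2.1 (stringTail P t x.1 (P.root x.2.1)) :=
    ht.sum_stringTail fun i j => (H i j).toAddMonoidHom
  have hmem : ∀ {x}, x ∈ zeroTriples P ↔ P.root x.1 + P.root x.2.1 + P.root x.2.2 = 0 := by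
    simp [zeroTriples]
  have hrot : ∀ G : ι × ι × ι → V, ∑ x ∈ zeroTriples P, G (x.2.1, x.2.2, x.1) =
      ∑ x ∈ zeroTriples P, G x := by
    intro G
    refine Finset.sum_nbij' (fun x => (x.2.1, x.2.2, x.1)) (fun x => (x.2.2, x.1, x.2.1))
      ?_ ?_ (fun _ _ => rfl) (fun _ _ => rfl) (fun _ _ => rfl)
    · intro x hx
      rw [hmem] at hx ⊢
      rw [← hx]; abel
    · intro x hx
      rw [hmem] at hx ⊢
      rw [← hx]; abel
  have hS2 : S = ∑ x ∈ zeroTriples P, H x.2.1 x.2.2 (stringTail P t x.1 (P.root x.2.1)) := by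
    rw [hS, ← hrot]
    refine Finset.sum_congr rfl fun x hx => ?_
    simp only [ht.stringTail_cyclic b (hmem.1 hx)]
  have hS3 : S = ∑ x ∈ zeroTriples P, H x.2.2 x.1 (stringTail P t x.1 (P.root x.2.1)) := by
    rw [hS2, ← hrot]
    refine Finset.sum_congr rfl fun x hx => ?_
    simp only [ht.stringTail_cyclic b (hmem.1 hx)]
  have h3 : (3 : ℂ) • S = 0 := by
    have : (3 : ℂ) • S = S + S + S := by module
    rw [this]
    nth_rewrite 1 [hS]
    nth_rewrite 1 [hS2]
    rw [hS3, ← Finset.sum_add_distrib, ← Finset.sum_add_distrib]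
    exact Finset.sum_eq_zero fun x hx => hcyc x.1 x.2.1 x.2.2 (hmem.1 hx)
  rw [h1, (smul_eq_zero.1 h3).resolve_left (by norm_num), smul_zero]

end StringTails

/-! ### Cotangent series and the three-term identity -/

section Series

open PowerSeries (rescale)

local notation "ofPS" => HahnSeries.ofPowerSeries ℤ ℂ

theorem ofPS_C (c : ℂ) : ofPS (PowerSeries.C c) = HahnSeries.C c :=
  HahnSeries.ofPowerSeries_C c

theorem ofPS_X_ne_zero : ofPS PowerSeries.X ≠ 0 := by
  rw [HahnSeries.ofPowerSeries_X]
  exact HahnSeries.single_ne_zero one_ne_zero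

theorem single_neg_one_eq : (HahnSeries.single (-1 : ℤ) (1 : ℂ)) = (ofPS PowerSeries.X)⁻¹ := by
  rw [HahnSeries.ofPowerSeries_X]
  refine eq_inv_of_mul_eq_one_left ?_
  rw [HahnSeries.single_mul_single]
  simp

theorem regularPart_ofPS (f : PowerSeries ℂ) : regularPart (ofPS f) = f := by
  ext n
  rw [regularPart, PowerSeries.coeff_mk, HahnSeries.ofPowerSeries_apply_coeff]

/-- For power series `a`, `v` with the same non-zero constant term, the power series
`(a / v - 1) / X`. -/
def shiftedQuotient (a v : PowerSeries ℂ) : PowerSeries ℂ :=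
  PowerSeries.mk (fun n => PowerSeries.coeff (n + 1) (a - v)) * v⁻¹

theorem X_mul_mul_shiftedQuotient {a v : PowerSeries ℂ}
    (h : PowerSeries.constantCoeff a = PowerSeries.constantCoeff v)
    (hv : PowerSeries.constantCoeff v ≠ 0) :
    PowerSeries.X * v * shiftedQuotient a v = a - v := by
  have : a - v = PowerSeries.X * PowerSeries.mk (fun n => PowerSeries.coeff (n + 1) (a - v)) := by
    have := PowerSeries.sub_const_eq_X_mul_shift (a - v)
    rw [map_sub, h, sub_self, map_zero, sub_zero] at this
    exact this
  rw [shiftedQuotient, mul_assoc, ← mul_assoc v, mul_comm v, mul_assoc, PowerSeries.mul_inv_cancel _ hv,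
    mul_one, ← this]

/-- Here a/(Xv) - 1/X = (a/v - 1)/X, and equality of the constant terms removes the pole. This
replaces Laurent series by explicit power series. -/
theorem regularPart_div_sub {a v : PowerSeries ℂ}
    (h : PowerSeries.constantCoeff a = PowerSeries.constantCoeff v)
    (hv : PowerSeries.constantCoeff v ≠ 0) :
    regularPart (ofPS a / ofPS (PowerSeries.X * v) - HahnSeries.single (-1) 1) =
      shiftedQuotient a v := by
  have hv' : ofPS v ≠ 0 := by
    intro h0
    rw [HahnSeries.ofPowerSeries_injective (h0.trans (map_zero _).symm)] at hv
    simp at hv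
  rw [← regularPart_ofPS (shiftedQuotient a v)]
  congr 1
  have h1 := congrArg ofPS (X_mul_mul_shiftedQuotient h hv)
  simp only [map_mul, map_sub] at h1 ⊢
  have hX := ofPS_X_ne_zero
  rw [single_neg_one_eq]
  field_simp
  rw [mul_assoc, mul_comm (ofPS v), ← mul_assoc] at h1 ⊢
  linear_combination -h1

/-- The power series `e^{2πixX}`. -/
def expS (x : ℂ) : PowerSeries ℂ :=
  rescale (2 * Real.pi * Complex.I * x) (PowerSeries.exp ℂ)

theorem expS_mul (x y : ℂ) : expS x * expS y = expS (x + y) := by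
  rw [expS, expS, expS, PowerSeries.exp_mul_exp_eq_exp_add, mul_add]

theorem expS_zero : expS 0 = 1 := by
  simp [expS]

theorem rescale_expS (x y : ℂ) : rescale x (expS y) = expS (x * y) := by
  rw [expS, expS, PowerSeries.rescale_rescale]
  congr 2
  ring

theorem two_pi_I_ne_zero : (2 * Real.pi * Complex.I : ℂ) ≠ 0 := Complex.two_pi_I_ne_zero

theorem expS_ne_one {x : ℂ} (hx : x ≠ 0) : expS x ≠ 1 := by
  intro h
  have := congrArg (PowerSeries.coeff 1) h
  simp [expS, PowerSeries.coeff_rescale, PowerSeries.coeff_exp, hx, PowerSeries.coeff_one] at this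

theorem X_mul_hSeries : PowerSeries.X * (expS 1 - 1) * hSeries =
    PowerSeries.C (2 * Real.pi * Complex.I) * PowerSeries.X * expS 1 - (expS 1 - 1) := by
  set v : PowerSeries ℂ := PowerSeries.mk fun n => PowerSeries.coeff (n + 1) (expS 1) with hv
  have hE : expS 1 - 1 = PowerSeries.X * v := by
    have := PowerSeries.sub_const_eq_X_mul_shift (expS 1)
    have h1 : PowerSeries.constantCoeff (expS 1) = 1 := by
      rw [← PowerSeries.coeff_zero_eq_constantCoeff_apply, expS, PowerSeries.coeff_rescale]
      simp
    rwa [h1, map_one] at this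
  have hv0 : PowerSeries.constantCoeff v = 2 * Real.pi * Complex.I := by
    rw [← PowerSeries.coeff_zero_eq_constantCoeff_apply, hv, PowerSeries.coeff_mk, expS,
      PowerSeries.coeff_rescale]
    simp [PowerSeries.coeff_exp]
  have ha : PowerSeries.constantCoeff (PowerSeries.C (2 * Real.pi * Complex.I) * expS 1) =
      PowerSeries.constantCoeff v := by
    rw [hv0, map_mul, ← PowerSeries.coeff_zero_eq_constantCoeff_apply (expS 1), expS,
      PowerSeries.coeff_rescale]
    simp
  have hs : hSeries = shiftedQuotient (PowerSeries.C (2 * Real.pi * Complex.I) * expS 1) v := by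
    have h1 : ofPS (PowerSeries.C (2 * Real.pi * Complex.I) * expS 1) =
        HahnSeries.C (2 * Real.pi * Complex.I) * expLaurent := by
      rw [map_mul, ofPS_C, expLaurent, expS, mul_one]
    have h2 : ofPS (expS 1 - 1) = expLaurent - 1 := by
      rw [map_sub, map_one, expLaurent, expS, mul_one]
    rw [← regularPart_div_sub ha (by rw [hv0]; exact two_pi_I_ne_zero), ← hE, h1, h2, hSeries]
  have := X_mul_mul_shiftedQuotient ha (by rw [hv0]; exact two_pi_I_ne_zero)
  rw [← hs] at this
  rw [hE, mul_assoc PowerSeries.X, this]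
  ring

/-- `πi (e^{2πixX} + 1) / (e^{2πixX} - 1) = π cot (πxX)` as a Laurent series. -/
def cotL (x : ℂ) : LaurentSeries ℂ :=
  HahnSeries.C (Real.pi * Complex.I) * (ofPS (expS x) + 1) / (ofPS (expS x) - 1)

theorem ofPS_expS_ne_one {x : ℂ} (hx : x ≠ 0) : ofPS (expS x) - 1 ≠ 0 := by
  rw [sub_ne_zero]
  intro h
  exact expS_ne_one hx (HahnSeries.ofPowerSeries_injective (h.trans (map_one _).symm))

theorem cotL_neg {x : ℂ} (hx : x ≠ 0) : cotL (-x) = -cotL x := by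
  have h1 := ofPS_expS_ne_one hx
  have h2 := ofPS_expS_ne_one (neg_ne_zero.2 hx)
  have h3 := congrArg ofPS (expS_mul x (-x))
  rw [map_mul, add_neg_cancel, expS_zero, map_one] at h3
  rw [cotL, cotL]
  field_simp
  linear_combination 2 * h3

/-- The addition formula of the cotangent, as a rational identity in a = e^{2πixX} and e =
e^{2πi(y-x)X}, whose product is e^{2πiyX}. -/
theorem cotL_sub_mul {x y : ℂ} (hx : x ≠ 0) (hy : y ≠ 0) (hxy : y - x ≠ 0) :
    cotL (y - x) * (cotL x - cotL y) = cotL x * cotL y + HahnSeries.C ((Real.pi : ℂ) ^ 2) := by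
  have h1 := ofPS_expS_ne_one hx
  have h2 := ofPS_expS_ne_one hy
  have h3 := ofPS_expS_ne_one hxy
  have h4 := congrArg ofPS (expS_mul (y - x) x)
  rw [map_mul, sub_add_cancel] at h4
  have hpi : HahnSeries.C ((Real.pi : ℂ) ^ 2) =
      -(HahnSeries.C (Γ := ℤ) ((Real.pi : ℂ) * Complex.I)) ^ 2 := by
    rw [← map_pow, ← map_neg, mul_pow, Complex.I_sq]
    simp
  rw [hpi, cotL, cotL, cotL, ← h4]
  rw [← h4] at h2
  generalize ofPS (expS x) = a at *
  generalize ofPS (expS (y - x)) = e at *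
  field_simp
  ring

/-- The power series `c + π cot (πX) - 1/X`. -/
def cotSeries (c : ℂ) : PowerSeries ℂ := PowerSeries.C (c - Real.pi * Complex.I) + hSeries

/-- Rests on 2πi E/(E - 1) = πi + πi (E + 1)/(E - 1): the h-series is πi plus a cotangent, minus the
pole. -/
theorem ofPS_rescale_hSeries {x : ℂ} (hx : x ≠ 0) :
    ofPS (rescale x hSeries) = HahnSeries.C (Real.pi * Complex.I) + cotL x -
      (HahnSeries.C x * ofPS PowerSeries.X)⁻¹ := by
  have h1 := ofPS_expS_ne_one hx
  have h := congrArg (fun f => ofPS (rescale x f)) X_mul_hSeries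
  have hXr : rescale x (PowerSeries.X : PowerSeries ℂ) = PowerSeries.C x * PowerSeries.X := by
    rw [PowerSeries.rescale_X]
  have hCr : ∀ c : ℂ, rescale x (PowerSeries.C c) = PowerSeries.C c := by
    intro c
    ext n
    rw [PowerSeries.coeff_rescale, PowerSeries.coeff_C]
    split_ifs with hn
    · simp [hn]
    · simp
  simp only [map_mul, map_sub, map_one, hXr, hCr, rescale_expS, mul_one, ofPS_C] at h
  have hX := ofPS_X_ne_zero
  have hx' : HahnSeries.C (Γ := ℤ) x ≠ 0 := HahnSeries.C_ne_zero hx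
  have h2 : HahnSeries.C (Γ := ℤ) (2 : ℂ) = 2 := map_ofNat _ 2
  rw [h2] at h
  rw [cotL, map_mul]
  field_simp
  linear_combination h

theorem ofPS_rescale_cotSeries (c : ℂ) {x : ℂ} (hx : x ≠ 0) :
    ofPS (rescale x (cotSeries c)) = HahnSeries.C c + cotL x -
      (HahnSeries.C x * ofPS PowerSeries.X)⁻¹ := by
  have hCr : ∀ c : ℂ, rescale x (PowerSeries.C c) = PowerSeries.C c := by
    intro c
    ext n
    rw [PowerSeries.coeff_rescale, PowerSeries.coeff_C]
    split_ifs with hn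
    · simp [hn]
    · simp
  rw [cotSeries, map_add, map_add, ofPS_rescale_hSeries hx, hCr, ofPS_C, map_sub]
  ring

/-- Comes from the oddness of π cot(πX) - 1/X: changing the signs of c and of X negates the whole
series. -/
theorem coeff_cotSeries_neg (c : ℂ) (n : ℕ) :
    PowerSeries.coeff n (cotSeries (-c)) = -((-1) ^ n * PowerSeries.coeff n (cotSeries c)) := by
  have h : rescale (-1 : ℂ) (cotSeries c) = -rescale (1 : ℂ) (cotSeries (-c)) := by
    apply HahnSeries.ofPowerSeries_injective (Γ := ℤ)
    rw [map_neg, ofPS_rescale_cotSeries c (neg_ne_zero.2 one_ne_zero),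
      ofPS_rescale_cotSeries (-c) one_ne_zero, cotL_neg one_ne_zero, map_neg, map_neg]
    simp only [map_one, neg_mul, one_mul, inv_neg]
    ring
  have := congrArg (PowerSeries.coeff n) h
  rw [PowerSeries.coeff_rescale, map_neg, PowerSeries.coeff_rescale, one_pow, one_mul] at this
  rw [this, neg_neg]

/-- The component of degree `d` of
`f(x) f'(y) - (f'(ex + y) - f'(y)) / x - (f(x + e'y) - f(x)) / y`. -/
def pairPoly {R : Type*} [Ring R] [Algebra ℂ R] (f f' : PowerSeries ℂ) (e e' : ℂ) (d : ℕ)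
    (x y : R) : R :=
  ∑ ij ∈ Finset.HasAntidiagonal.antidiagonal d,
      (PowerSeries.coeff ij.1 f * PowerSeries.coeff ij.2 f') • (x ^ ij.1 * y ^ ij.2) -
    (PowerSeries.coeff (d + 1) f' * e) • ∑ s ∈ Finset.range (d + 1), (e • x + y) ^ s * y ^ (d - s) -
    (PowerSeries.coeff (d + 1) f * e') • ∑ s ∈ Finset.range (d + 1), (x + e' • y) ^ s * x ^ (d - s)

theorem map_pairPoly {R S : Type*} [Ring R] [Algebra ℂ R] [Ring S] [Algebra ℂ S] (φ : R →ₐ[ℂ] S)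
    (f f' : PowerSeries ℂ) (e e' : ℂ) (d : ℕ) (x y : R) :
    φ (pairPoly f f' e e' d x y) = pairPoly f f' e e' d (φ x) (φ y) := by
  simp only [pairPoly, map_sub, map_sum, map_smul, map_mul, map_pow, map_add]

/-- Negating y, c, e and e' leaves ex and e'y compatible with the oddness of the cotangent, so each
of the three parts changes sign. This provides the evenness hypothesis of
`IsHolonomyFamily.sum_lie_eq_zero`. -/
theorem pairPoly_neg {R : Type*} [Ring R] [Algebra ℂ R] (f : PowerSeries ℂ) (c e e' : ℂ) (d : ℕ)
    (x y : R) :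
    pairPoly f (cotSeries (-c)) (-e) (-e') d x (-y) = -pairPoly f (cotSeries c) e e' d x y := by
  have h1 : ∑ ij ∈ Finset.HasAntidiagonal.antidiagonal d, (PowerSeries.coeff ij.1 f *
      PowerSeries.coeff ij.2 (cotSeries (-c))) • (x ^ ij.1 * (-y) ^ ij.2) =
      -∑ ij ∈ Finset.HasAntidiagonal.antidiagonal d, (PowerSeries.coeff ij.1 f *
      PowerSeries.coeff ij.2 (cotSeries c)) • (x ^ ij.1 * y ^ ij.2) := by
    rw [← Finset.sum_neg_distrib]
    refine Finset.sum_congr rfl fun ij _ => ?_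
    rw [coeff_cotSeries_neg, neg_pow y, ← neg_smul]
    rcases neg_one_pow_eq_or R ij.2 with h | h <;> rcases Nat.even_or_odd ij.2 with h' | h'
    · simp [h'.neg_one_pow]
    · simp [h'.neg_one_pow]
    · simp [h'.neg_one_pow]
    · simp [h'.neg_one_pow]
  have h2 : ∑ s ∈ Finset.range (d + 1), (-e • x + -y) ^ s * (-y) ^ (d - s) =
      (-1 : ℂ) ^ d • ∑ s ∈ Finset.range (d + 1), (e • x + y) ^ s * y ^ (d - s) := by
    rw [Finset.smul_sum]
    refine Finset.sum_congr rfl fun s hs => ?_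
    have hs' : s + (d - s) = d := by have := Finset.mem_range.1 hs; omega
    have : -e • x + -y = (-1 : ℂ) • (e • x + y) := by module
    rw [this, show -y = (-1 : ℂ) • y by module, smul_pow, smul_pow, smul_mul_smul_comm, ← pow_add,
      hs']
  have h3 : -e' • -y = e' • y := by module
  rw [pairPoly, pairPoly, h1, h2, h3, coeff_cotSeries_neg, smul_smul]
  have h4 : -((-1 : ℂ) ^ (d + 1) * PowerSeries.coeff (d + 1) (cotSeries c)) * -e * (-1) ^ d =
      -(PowerSeries.coeff (d + 1) (cotSeries c) * e) := by
    have : ((-1 : ℂ) ^ d) * (-1) ^ d = 1 := by rw [← mul_pow]; simp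
    rw [pow_succ]
    linear_combination (-PowerSeries.coeff (d + 1) (cotSeries c) * e) * this
  rw [h4]
  module

/-- The sums over s are the divided differences of powers; multiplication by xy makes them
telescope, and the factor X accounts for the coefficients of index d + 1. -/
theorem C_mul_X_mul_mk_pairPoly (f f' : PowerSeries ℂ) (e e' x y : ℂ) :
    PowerSeries.C (x * y) * PowerSeries.X * PowerSeries.mk (fun d => pairPoly f f' e e' d x y) =
      PowerSeries.C (x * y) * PowerSeries.X * (rescale x f * rescale y f') -
        PowerSeries.C y * (rescale (e * x + y) f' - rescale y f') -
        PowerSeries.C x * (rescale (x + e' * y) f - rescale x f) := by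
  ext n
  simp only [map_sub, mul_assoc (PowerSeries.C _), PowerSeries.coeff_C_mul]
  cases n with
  | zero => simp
  | succ d =>
    rw [PowerSeries.coeff_succ_X_mul, PowerSeries.coeff_succ_X_mul]
    simp only [PowerSeries.coeff_mk, PowerSeries.coeff_rescale, pairPoly, PowerSeries.coeff_mul,
      smul_eq_mul]
    have h1 := (Commute.all (e * x + y) y).geom_sum₂_mul (d + 1)
    have h2 := (Commute.all (x + e' * y) x).geom_sum₂_mul (d + 1)
    have h3 : ∑ ij ∈ Finset.HasAntidiagonal.antidiagonal d, PowerSeries.coeff ij.1 f * PowerSeries.coeff ij.2 f' *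
        (x ^ ij.1 * y ^ ij.2) = ∑ ij ∈ Finset.HasAntidiagonal.antidiagonal d, x ^ ij.1 * PowerSeries.coeff ij.1 f *
        (y ^ ij.2 * PowerSeries.coeff ij.2 f') := Finset.sum_congr rfl fun _ _ => by ring
    simp only [Nat.add_sub_cancel] at h1 h2
    rw [h3]
    linear_combination (-y * PowerSeries.coeff (d + 1) f') * h1 -
      (x * PowerSeries.coeff (d + 1) f) * h2

/-- The subtracted terms f'(y) and f(x) of the divided differences complete f(x) f'(y) to (f(x) +
1/x)(f'(y) + 1/y) - 1/(xy), and f(x) + 1/x is the pure c + π cot(πx). -/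
theorem ofPS_mk_pairPoly (c c' e e' : ℂ) {x y : ℂ} (hx : x ≠ 0) (hy : y ≠ 0) :
    ofPS (PowerSeries.mk fun d => pairPoly (cotSeries c) (cotSeries c') e e' d x y) =
      (HahnSeries.C c + cotL x) * (HahnSeries.C c' + cotL y) -
        (HahnSeries.C (x * y))⁻¹ * (ofPS PowerSeries.X)⁻¹ ^ 2 -
        (HahnSeries.C x * ofPS PowerSeries.X)⁻¹ * ofPS (rescale (e * x + y) (cotSeries c')) -
        (HahnSeries.C y * ofPS PowerSeries.X)⁻¹ * ofPS (rescale (x + e' * y) (cotSeries c)) := by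
  have h := congrArg ofPS (C_mul_X_mul_mk_pairPoly (cotSeries c) (cotSeries c') e e' x y)
  simp only [map_mul, map_sub, ofPS_C, ofPS_rescale_cotSeries _ hx,
    ofPS_rescale_cotSeries _ hy] at h
  have hX := ofPS_X_ne_zero
  have hx' : HahnSeries.C (Γ := ℤ) x ≠ 0 := HahnSeries.C_ne_zero hx
  have hy' : HahnSeries.C (Γ := ℤ) y ≠ 0 := HahnSeries.C_ne_zero hy
  rw [map_mul]
  generalize ofPS (rescale (e * x + y) (cotSeries c')) = A at *
  generalize ofPS (rescale (x + e' * y) (cotSeries c)) = B at *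
  generalize ofPS (PowerSeries.mk fun d => _) = Z at *
  generalize ofPS PowerSeries.X = T at *
  generalize HahnSeries.C (Γ := ℤ) x = X at *
  generalize HahnSeries.C (Γ := ℤ) y = Y at *
  generalize cotL x = kx at *
  generalize cotL y = ky at *
  have h5 : X * Y * T ≠ 0 := mul_ne_zero (mul_ne_zero hx' hy') hX
  apply mul_left_cancel₀ h5
  rw [h]
  field_simp
  ring

/-- The three-term identity for the values of `pairPoly` at complex numbers. -/
theorem pairPoly_cyclic_complex {c₁ c₂ c₃ : ℂ} (hc : c₁ * c₂ + c₂ * c₃ + c₃ * c₁ = Real.pi ^ 2)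
    {e₁₂ e₂₁ e₂₃ e₃₂ e₃₁ e₁₃ : ℂ} (h₁ : e₂₁ + e₃₁ = -1) (h₂ : e₁₂ + e₃₂ = -1) (h₃ : e₁₃ + e₂₃ = -1)
    (d : ℕ) {p q : ℂ} (hp : p ≠ 0) (hq : q ≠ 0) (hpq : q - p ≠ 0) :
    pairPoly (cotSeries c₁) (cotSeries c₂) e₁₂ e₂₁ d p q +
      pairPoly (cotSeries c₂) (cotSeries c₃) e₂₃ e₃₂ d (q - p) (-p) +
      pairPoly (cotSeries c₃) (cotSeries c₁) e₃₁ e₁₃ d (-q) (p - q) = 0 := by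
  have hpq' : p - q ≠ 0 := by rwa [← neg_sub, neg_ne_zero]
  have h : (PowerSeries.mk fun d => pairPoly (cotSeries c₁) (cotSeries c₂) e₁₂ e₂₁ d p q) +
      (PowerSeries.mk fun d => pairPoly (cotSeries c₂) (cotSeries c₃) e₂₃ e₃₂ d (q - p) (-p)) +
      (PowerSeries.mk fun d => pairPoly (cotSeries c₃) (cotSeries c₁) e₃₁ e₁₃ d (-q) (p - q)) =
      0 := by
    apply HahnSeries.ofPowerSeries_injective (Γ := ℤ)
    rw [map_add, map_add, map_zero, ofPS_mk_pairPoly _ _ _ _ hp hq,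
      ofPS_mk_pairPoly _ _ _ _ hpq (neg_ne_zero.2 hp),
      ofPS_mk_pairPoly _ _ _ _ (neg_ne_zero.2 hq) hpq', cotL_neg hp, cotL_neg hq,
      ← neg_sub q p, cotL_neg hpq]
    -- The conditions on the e's identify the shifted arguments in pairs, so these terms cancel
    -- (`e2`), as do the double poles (`e1`). What is left is the cotangent formula, with π²
    -- supplied by the condition on the c's.
    have r1 : q - p + e₃₂ * -p = e₁₂ * p + q := by linear_combination (-p) * h₂
    have r2 : e₃₁ * -q + -(q - p) = p + e₂₁ * q := by linear_combination (-q) * h₁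
    have r3 : e₂₃ * (q - p) + -p = -q + e₁₃ * -(q - p) := by linear_combination (q - p) * h₃
    rw [r1, r2, r3]
    have hcot := cotL_sub_mul hp hq hpq
    have hc' := congrArg (HahnSeries.C (Γ := ℤ)) hc
    simp only [map_mul, map_add, map_neg, map_sub] at hc' ⊢
    rw [← hc'] at hcot
    have hX := ofPS_X_ne_zero
    have hp' : HahnSeries.C (Γ := ℤ) p ≠ 0 := HahnSeries.C_ne_zero hp
    have hq' : HahnSeries.C (Γ := ℤ) q ≠ 0 := HahnSeries.C_ne_zero hq
    have hqp' : HahnSeries.C (Γ := ℤ) q - HahnSeries.C (Γ := ℤ) p ≠ 0 := by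
      rw [← map_sub]; exact HahnSeries.C_ne_zero hpq
    generalize ofPS (rescale (e₁₂ * p + q) (cotSeries c₂)) = A at *
    generalize ofPS (rescale (p + e₂₁ * q) (cotSeries c₁)) = B at *
    generalize ofPS (rescale (-q + e₁₃ * -(q - p)) (cotSeries c₃)) = D at *
    generalize ofPS PowerSeries.X = T at *
    generalize HahnSeries.C (Γ := ℤ) p = X at *
    generalize HahnSeries.C (Γ := ℤ) q = Y at *
    generalize HahnSeries.C (Γ := ℤ) c₁ = C₁ at *
    generalize HahnSeries.C (Γ := ℤ) c₂ = C₂ at *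
    generalize HahnSeries.C (Γ := ℤ) c₃ = C₃ at *
    generalize cotL p = kp at *
    generalize cotL q = kq at *
    generalize cotL (q - p) = k at *
    have e1 : (X * Y)⁻¹ * T⁻¹ ^ 2 + ((Y - X) * -X)⁻¹ * T⁻¹ ^ 2 + (-Y * -(Y - X))⁻¹ * T⁻¹ ^ 2 =
        0 := by
      field_simp
      ring
    have e2 : ((Y - X) * T)⁻¹ * D + (-Y * T)⁻¹ * B + (-X * T)⁻¹ * A + (-(Y - X) * T)⁻¹ * D +
        (X * T)⁻¹ * A + (Y * T)⁻¹ * B = 0 := by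
      simp only [neg_mul, inv_neg]
      ring
    linear_combination -hcot - e1 - e2
  have := congrArg (PowerSeries.coeff d) h
  simpa using this

theorem exists_algHom_of_commute {R : Type*} [Ring R] [Algebra ℂ R] {p q : R} (h : Commute p q) :
    ∃ φ : MvPolynomial (Fin 2) ℂ →ₐ[ℂ] R, φ (MvPolynomial.X 0) = p ∧ φ (MvPolynomial.X 1) = q := by
  have hcomm : ∀ a ∈ ({p, q} : Set R), ∀ b ∈ ({p, q} : Set R), a * b = b * a := by
    rintro a (rfl | rfl) b (rfl | rfl)
    exacts [rfl, h, h.symm, rfl]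
  let A := Algebra.adjoin ℂ ({p, q} : Set R)
  have : IsMulCommutative A := Algebra.isMulCommutative_adjoin ℂ hcomm
  let : CommRing A := { (inferInstance : Ring A) with mul_comm := mul_comm' }
  let p' : A := ⟨p, Algebra.subset_adjoin (by simp)⟩
  let q' : A := ⟨q, Algebra.subset_adjoin (by simp)⟩
  refine ⟨A.val.comp (MvPolynomial.aeval (R := ℂ) ![p', q']), ?_, ?_⟩ <;>
  simp [p', q']

/-- The three-term identity for the values of `pairPoly` at commuting elements of an algebra. -/
theorem pairPoly_cyclic {R : Type*} [Ring R] [Algebra ℂ R] {c₁ c₂ c₃ : ℂ}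
    (hc : c₁ * c₂ + c₂ * c₃ + c₃ * c₁ = Real.pi ^ 2)
    {e₁₂ e₂₁ e₂₃ e₃₂ e₃₁ e₁₃ : ℂ} (h₁ : e₂₁ + e₃₁ = -1) (h₂ : e₁₂ + e₃₂ = -1) (h₃ : e₁₃ + e₂₃ = -1)
    (d : ℕ) {p q : R} (h : Commute p q) :
    pairPoly (cotSeries c₁) (cotSeries c₂) e₁₂ e₂₁ d p q +
      pairPoly (cotSeries c₂) (cotSeries c₃) e₂₃ e₃₂ d (q - p) (-p) +
      pairPoly (cotSeries c₃) (cotSeries c₁) e₃₁ e₁₃ d (-q) (p - q) = 0 := by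
  obtain ⟨φ, rfl, rfl⟩ := exists_algHom_of_commute h
  simp only [← map_neg, ← map_sub, ← map_pairPoly, ← map_add]
  rw [← map_zero φ]
  congr 1
  set T : MvPolynomial (Fin 2) ℂ := _ + _ with hT
  -- The identity is known at complex points off p = 0, q = 0 and p = q. Multiplying by these three
  -- linear forms gives a polynomial vanishing everywhere, and they can be cancelled in the domain
  -- of polynomials.
  have hz : MvPolynomial.X 0 * MvPolynomial.X 1 * (MvPolynomial.X 1 - MvPolynomial.X 0) * T = 0 := by
    refine MvPolynomial.funext fun x => ?_
    rw [map_mul, map_mul, map_mul, map_sub, MvPolynomial.eval_X, MvPolynomial.eval_X, map_zero]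
    by_cases hx : x 0 * x 1 * (x 1 - x 0) = 0
    · rw [hx, zero_mul]
    · obtain ⟨⟨h0, h1⟩, h2⟩ : (x 0 ≠ 0 ∧ x 1 ≠ 0) ∧ x 1 - x 0 ≠ 0 := by
        simpa [mul_eq_zero, not_or] using hx
      have := pairPoly_cyclic_complex hc h₁ h₂ h₃ d h0 h1 h2
      have hev := fun f f' e e' y z =>
        map_pairPoly (MvPolynomial.aeval (R := ℂ) (S₁ := ℂ) x) f f' e e' d y z
      rw [hT]
      change _ * (MvPolynomial.aeval (R := ℂ) (S₁ := ℂ) x) _ = 0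
      rw [map_add, map_add, hev, hev, hev]
      simp only [map_sub, map_neg, MvPolynomial.aeval_X]
      rw [this, mul_zero]
  refine (mul_eq_zero.1 hz).resolve_left (mul_ne_zero (mul_ne_zero ?_ ?_) ?_)
  · exact MvPolynomial.X_ne_zero _
  · exact MvPolynomial.X_ne_zero _
  · rw [sub_ne_zero]
    intro h
    simpa using MvPolynomial.X_injective h

end Series

/-! ### Relations of the elliptic Lie algebra -/

section EllRelations

variable {ι M N : Type*} [Fintype ι] [AddCommGroup M] [Module ℂ M] [AddCommGroup N] [Module ℂ N]
  {P : RootPairing ι ℂ M N}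

theorem mem_posRoots {b : P.Base} {i : ι} : i ∈ posRoots b ↔ b.IsPos i := by
  simp [posRoots]

theorem isPos_negIdx_iff (b : P.Base) (i : ι) : b.IsPos (P.reflectionPerm i i) ↔ ¬ b.IsPos i := by
  let := P.indexNeg
  exact RootPairing.Base.IsPos.neg_iff_not b i

theorem sum_eq_two_smul_sum_posRoots (b : P.Base) {V : Type*} [AddCommGroup V] [Module ℂ V]
    {G : ι → V} (hG : ∀ i, G (P.reflectionPerm i i) = G i) :
    ∑ i, G i = (2 : ℂ) • ∑ i ∈ posRoots b, G i := by
  classical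
  rw [two_smul, ← Finset.sum_add_sum_compl (posRoots b)]
  congr 1
  refine Finset.sum_equiv (negIdx P) (fun i => ?_) (fun i _ => (hG i).symm)
  simp only [Finset.mem_compl, mem_posRoots, negIdx, Equiv.coe_fn_mk, isPos_negIdx_iff]

theorem ellT_negIdx (b : P.Base) (i : ι) : ellT b (P.reflectionPerm i i) = ellT b i :=
  mk_eq_of_ellRel b (EllRel.t_neg i _ (root_negIdx P i))

theorem mk_eq_zero_of_ellRel (b : P.Base) {p : FreeLieAlgebra ℂ (EllGen ι N)} (h : EllRel b p) :
    (LieSubmodule.Quotient.mk p : EllLie b) = 0 :=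
  LieSubmodule.Quotient.mk_eq_zero'.2 (LieSubmodule.subset_lieSpan h)

theorem IsRootSubsystem.negIdx_mem_iff {Ψ : Set ι} (hΨ : IsRootSubsystem P Ψ) (i : ι) :
    P.reflectionPerm i i ∈ Ψ ↔ i ∈ Ψ := by
  have h : ∀ i ∈ Ψ, P.reflectionPerm i i ∈ Ψ := fun i hi => hΨ _ (by
    rw [root_negIdx]
    exact neg_mem (Submodule.subset_span ⟨i, hi, rfl⟩))
  exact ⟨fun hi => by simpa [negIdx_negIdx] using h _ hi, h i⟩

open scoped Classical in
theorem lie_ellT_sum (b : P.Base) {Ψ : Set ι} (hΨ : IsRootSubsystem P Ψ) {i : ι} (hi : i ∈ Ψ) :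
    ⁅ellT b i, ∑ j ∈ (posRoots b).filter (· ∈ Ψ), ellT b j⁆ = 0 := by
  have h := mk_eq_zero_of_ellRel b (EllRel.tt Ψ hΨ i hi)
  rw [LieSubmodule.Quotient.mk_bracket] at h
  have h2 : (LieSubmodule.Quotient.mk (∑ j ∈ (posRoots b).filter (· ∈ Ψ), ft N j) : EllLie b) =
      ∑ j ∈ (posRoots b).filter (· ∈ Ψ), ellT b j :=
    map_sum (LieSubmodule.Quotient.mk' (ellIdeal b)) _ _
  rw [← h2, ← h]
  rfl

theorem isHolonomyFamily_ellT (b : P.Base) : IsHolonomyFamily P (ellT b) where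
  neg := ellT_negIdx b
  lie_sum Ψ hΨ i hi := by
    classical
    rw [Finset.sum_filter, sum_eq_two_smul_sum_posRoots b, ← Finset.sum_filter]
    · have h := lie_ellT_sum b hΨ hi
      rw [lie_sum] at h
      refine Eq.trans ?_ (smul_zero (2 : ℂ))
      rw [← h]
    · intro k
      simp only [hΨ.negIdx_mem_iff, ellT_negIdx]

theorem lie_ellX_ellX (b : P.Base) (u v : N) : ⁅ellX b u, ellX b v⁆ = 0 :=
  (LieSubmodule.Quotient.mk_bracket _ _ _).symm.trans (mk_eq_zero_of_ellRel b (EllRel.xx u v))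

theorem lie_ellY_ellY (b : P.Base) (u v : N) : ⁅ellY b u, ellY b v⁆ = 0 :=
  (LieSubmodule.Quotient.mk_bracket _ _ _).symm.trans (mk_eq_zero_of_ellRel b (EllRel.yy u v))

theorem lie_ellY_ellX (b : P.Base) (u v : N) :
    ⁅ellY b u, ellX b v⁆ = ∑ j ∈ posRoots b, (P.root' j v * P.root' j u) • ellT b j := by
  have h := mk_eq_of_ellRel b (EllRel.yx (b := b) u v)
  rw [LieSubmodule.Quotient.mk_bracket] at h
  refine Eq.trans h ?_
  refine (map_sum (LieSubmodule.Quotient.mk' (ellIdeal b)) _ _).trans ?_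
  exact Finset.sum_congr rfl fun j _ => rfl

theorem lie_ellT_ellX (b : P.Base) {i : ι} {u : N} (h : P.root' i u = 0) :
    ⁅ellT b i, ellX b u⁆ = 0 :=
  (LieSubmodule.Quotient.mk_bracket _ _ _).symm.trans (mk_eq_zero_of_ellRel b (EllRel.tx i u h))

theorem lie_ellT_ellY (b : P.Base) {i : ι} {u : N} (h : P.root' i u = 0) :
    ⁅ellT b i, ellY b u⁆ = 0 :=
  (LieSubmodule.Quotient.mk_bracket _ _ _).symm.trans (mk_eq_zero_of_ellRel b (EllRel.ty i u h))

end EllRelations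

/-! ### Commuting operators and commutators with powers -/

section CommutingOperators

variable {V : Type*} [AddCommGroup V] [Module ℂ V]

/-- Commutativity brings each factor next to m, where it can be exchanged for its partner. It
permits changing the vector u in ad x(u) as long as its effect on m is the same. -/
theorem pow_mul_pow_apply_congr {A A' B B' : Module.End ℂ V} {m : V} (hA : A m = A' m)
    (hB : B m = B' m) (hAA : Commute A A') (hBB : Commute B B') (hAB : Commute A B')
    (hAB' : Commute A' B') (k l : ℕ) : (A ^ k * B ^ l) m = (A' ^ k * B' ^ l) m := by
  have hpow : ∀ {C C' : Module.End ℂ V}, C m = C' m → Commute C C' → ∀ n : ℕ,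
      (C ^ n) m = (C' ^ n) m := by
    intro C C' h hC n
    induction n with
    | zero => rfl
    | succ n ih =>
      rw [pow_succ, Module.End.mul_apply, h, ← Module.End.mul_apply, (hC.pow_left n).eq,
        Module.End.mul_apply, ih, pow_succ', Module.End.mul_apply]
  rw [Module.End.mul_apply, hpow hB hBB, ← Module.End.mul_apply, (hAB.pow_pow k l).eq,
    Module.End.mul_apply, hpow hA hAA, ← Module.End.mul_apply, (hAB'.pow_pow k l).eq]

theorem pairPoly_apply_congr {p q p' q' : Module.End ℂ V} {m : V} (hp : p m = p' m)
    (hq : q m = q' m) (hpp : Commute p p') (hqq : Commute q q') (hpq : Commute p q')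
    (hpq' : Commute p' q') (hqp : Commute q p') (f f' : PowerSeries ℂ) (e e' : ℂ) (d : ℕ) :
    pairPoly f f' e e' d p q m = pairPoly f f' e e' d p' q' m := by
  have h1 : ∀ e : ℂ, Commute (e • p + q) (e • p' + q') := fun e =>
    (((hpp.smul_left e).add_left hqp).smul_right e).add_right ((hpq.smul_left e).add_left hqq)
  have h2 : ∀ e : ℂ, Commute (p + e • q) (p' + e • q') := fun e =>
    (hpp.add_left (hqp.smul_left e)).add_right ((hpq.add_left (hqq.smul_left e)).smul_right e)
  simp only [pairPoly, LinearMap.sub_apply, LinearMap.smul_apply, LinearMap.sum_apply]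
  refine congrArg₂ (· - ·) (congrArg₂ (· - ·) (Finset.sum_congr rfl fun ij _ => congrArg _ ?_)
    (congrArg _ (Finset.sum_congr rfl fun s _ => ?_)))
    (congrArg _ (Finset.sum_congr rfl fun s _ => ?_))
  · exact pow_mul_pow_apply_congr hp hq hpp hqq hpq hpq' _ _
  · refine pow_mul_pow_apply_congr ?_ hq (h1 e) hqq ((hpq.smul_left e).add_left hqq)
      ((hpq'.smul_left e).add_left (Commute.refl _)) _ _
    simp [hp, hq]
  · refine pow_mul_pow_apply_congr ?_ hp (h2 e') hpp (hpp.add_left (hqp.smul_left e'))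
      ((Commute.refl _).add_left (hpq'.symm.smul_left e')) _ _
    simp [hp, hq]

theorem mul_pow_eq_add_sum {R : Type*} [Ring R] (Y X : R) (n : ℕ) :
    Y * X ^ n = X ^ n * Y + ∑ s ∈ Finset.range n, X ^ s * (Y * X - X * Y) * X ^ (n - 1 - s) := by
  induction n with
  | zero => simp
  | succ n ih =>
    have h : ∑ s ∈ Finset.range n, X ^ s * (Y * X - X * Y) * X ^ (n - s) =
        (∑ s ∈ Finset.range n, X ^ s * (Y * X - X * Y) * X ^ (n - 1 - s)) * X := by
      rw [Finset.sum_mul]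
      refine Finset.sum_congr rfl fun s hs => ?_
      have : n - s = n - 1 - s + 1 := by have := Finset.mem_range.1 hs; omega
      rw [this, pow_succ]
      simp only [mul_assoc]
    rw [Finset.sum_range_succ, Nat.add_sub_cancel, h, pow_succ, ← mul_assoc, ih, Nat.sub_self]
    noncomm_ring

end CommutingOperators

/-! ### Powers of a derivation that kills one factor of a bracket -/

section LieOperators

variable {L : Type*} [LieRing L] [LieAlgebra ℂ L]

theorem ad_pow_lie_of_left {z a : L} (h : ⁅z, a⁆ = 0) (c : L) (n : ℕ) :
    (LieAlgebra.ad ℂ L z ^ n) ⁅a, c⁆ = ⁅a, (LieAlgebra.ad ℂ L z ^ n) c⁆ := by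
  induction n with
  | zero => rfl
  | succ n ih =>
    rw [pow_succ', Module.End.mul_apply, ih, Module.End.mul_apply, LieAlgebra.ad_apply, leibniz_lie,
      h, zero_lie, zero_add, LieAlgebra.ad_apply]

theorem ad_pow_lie_of_right {z c : L} (h : ⁅z, c⁆ = 0) (a : L) (n : ℕ) :
    (LieAlgebra.ad ℂ L z ^ n) ⁅a, c⁆ = ⁅(LieAlgebra.ad ℂ L z ^ n) a, c⁆ := by
  rw [← lie_skew, map_neg, ad_pow_lie_of_left h, lie_skew]

end LieOperators

/-! ### Operators ad x(u) and the flatness identity -/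

section FlatnessIdentity

variable {ι M N : Type*} [Fintype ι] [AddCommGroup M] [Module ℂ M] [AddCommGroup N] [Module ℂ N]
  {P : RootPairing ι ℂ M N}

/-- The linear map `u ↦ ad (x(u))`. -/
def adX (b : P.Base) : N →ₗ[ℂ] Module.End ℂ (EllLie b) where
  toFun u := LieAlgebra.ad ℂ (EllLie b) (ellX b u)
  map_add' u v := by
    ext a
    rw [LieAlgebra.ad_apply, map_add, add_lie]
    rfl
  map_smul' c u := by
    ext a
    rw [LieAlgebra.ad_apply, map_smul, smul_lie]
    rfl

theorem adX_apply (b : P.Base) (u : N) (a : EllLie b) : adX b u a = ⁅ellX b u, a⁆ := rfl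

theorem adX_eq (b : P.Base) (u : N) : adX b u = LieAlgebra.ad ℂ (EllLie b) (ellX b u) := rfl

theorem commute_adX (b : P.Base) (u v : N) : Commute (adX b u) (adX b v) := by
  refine LinearMap.ext fun a => ?_
  rw [Module.End.mul_apply, Module.End.mul_apply, adX_apply, adX_apply, adX_apply, adX_apply,
    leibniz_lie, lie_ellX_ellX, zero_lie, zero_add]

theorem adX_ellT_eq_zero (b : P.Base) {i : ι} {u : N} (h : P.root' i u = 0) :
    adX b u (ellT b i) = 0 := by
  rw [adX_apply, ← lie_skew, lie_ellT_ellX b h, neg_zero]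

theorem adX_ellT_congr (b : P.Base) {i : ι} {u v : N} (h : P.root' i u = P.root' i v) :
    adX b u (ellT b i) = adX b v (ellT b i) := by
  rw [← sub_eq_zero, ← LinearMap.sub_apply, ← map_sub]
  exact adX_ellT_eq_zero b (by rw [map_sub, h, sub_self])

theorem adX_lie_eq_zero (b : P.Base) {i j : ι} {u : N} (hi : P.root' i u = 0)
    (hj : P.root' j u = 0) : adX b u ⁅ellT b i, ellT b j⁆ = 0 := by
  rw [adX_apply, leibniz_lie, ← adX_apply, ← adX_apply, adX_ellT_eq_zero b hi,
    adX_ellT_eq_zero b hj, zero_lie, lie_zero, add_zero]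

theorem adX_stringTail_eq_zero (b : P.Base) {i j : ι} {u : N} (hi : P.root' i u = 0)
    (hj : P.root' j u = 0) : adX b u (stringTail P (ellT b) i (P.root j)) = 0 := by
  classical
  rw [stringTail, map_sum]
  refine Finset.sum_eq_zero fun k hk => adX_lie_eq_zero b hi ?_
  obtain ⟨n, hn⟩ := (Finset.mem_filter.1 hk).2
  have : P.root' k u = P.root' j u - n • P.root' i u := by
    simp only [RootPairing.root', hn, map_sub, map_nsmul, LinearMap.sub_apply, LinearMap.smul_apply]
  rw [this, hi, hj, smul_zero, sub_zero]

/-- Every root in the tail is a combination of α and β, so a vector killed by both acts by zero on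
each bracket. Hence any vectors with the right values of α and β may stand for the dual vectors. -/
theorem adX_stringTail_congr (b : P.Base) {i j : ι} {u v : N} (hi : P.root' i u = P.root' i v)
    (hj : P.root' j u = P.root' j v) :
    adX b u (stringTail P (ellT b) i (P.root j)) = adX b v (stringTail P (ellT b) i (P.root j)) := by
  rw [← sub_eq_zero, ← LinearMap.sub_apply, ← map_sub]
  exact adX_stringTail_eq_zero b (by rw [map_sub, hi, sub_self]) (by rw [map_sub, hj, sub_self])

open scoped Classical in
/-- A vector on which the root `i` takes the value `1` and the root `j` takes the value `0`, if
these roots are not proportional. -/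
def dualVec [P.IsReduced] (i j : ι) : N :=
  if h : i ≠ j ∧ P.root i ≠ -P.root j then (exists_dual_vector P h.1 h.2).choose else 0

theorem dualVec_spec [P.IsReduced] {i j : ι} (h : i ≠ j) (h' : P.root i ≠ -P.root j) :
    P.root' i (dualVec (P := P) i j) = 1 ∧ P.root' j (dualVec (P := P) i j) = 0 := by
  rw [dualVec, dif_pos ⟨h, h'⟩]
  exact (exists_dual_vector P h h').choose_spec

/-- The vector `α^∨ / 2`. -/
def halfCoroot (P : RootPairing ι ℂ M N) (i : ι) : N := (1 / 2 : ℂ) • P.coroot i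

theorem root'_halfCoroot_self (P : RootPairing ι ℂ M N) (i : ι) :
    P.root' i (halfCoroot P i) = 1 := by
  rw [halfCoroot, map_smul, RootPairing.root'_coroot_eq_pairing, RootPairing.pairing_same]
  norm_num

theorem halfCoroot_negIdx (P : RootPairing ι ℂ M N) (i : ι) :
    halfCoroot P (P.reflectionPerm i i) = -halfCoroot P i := by
  rw [halfCoroot, coroot_negIdx, smul_neg, halfCoroot]

/-- The form `α(u) β(v) - β(u) α(v)`. -/
def wedge (P : RootPairing ι ℂ M N) (u v : N) (i j : ι) : ℂ :=
  P.root' i u * P.root' j v - P.root' j u * P.root' i v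

theorem wedge_swap (P : RootPairing ι ℂ M N) (u v : N) (i j : ι) :
    wedge P u v j i = -wedge P u v i j := by
  rw [wedge, wedge]; ring

theorem wedge_ne_zero {u v : N} {i j : ι} (h : wedge P u v i j ≠ 0) :
    i ≠ j ∧ P.root i ≠ -P.root j := by
  constructor
  · rintro rfl
    exact h (by rw [wedge, sub_self])
  · intro h'
    apply h
    have : P.root' i = -P.root' j := by simp [RootPairing.root', h']
    rw [wedge, this]
    simp only [LinearMap.neg_apply]
    ring

theorem root'_of_add_eq_zero {i j k : ι} (h : P.root i + P.root j + P.root k = 0) (u : N) :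
    P.root' i u + P.root' j u + P.root' k u = 0 := by
  have := congrArg (fun m => P.toLinearMap m u) h
  simpa [RootPairing.root'] using this

/-- Equality α = β would make 2α a root, against reducedness, and α = -β would force γ = 0. -/
theorem ne_and_ne_neg_of_add_eq_zero [P.IsReduced] {i j k : ι}
    (h : P.root i + P.root j + P.root k = 0) : i ≠ j ∧ P.root i ≠ -P.root j := by
  constructor
  · rintro rfl
    have h2 : P.root (P.reflectionPerm k k) = (2 : ℤ) • P.root i := by
      rw [root_negIdx, ← sub_eq_zero, ← neg_eq_zero, ← h]; module
    rcases eq_or_eq_neg_of_root_eq_zsmul P h2 with h4 | h4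
    · rw [h4] at h2
      have h3 : (1 : ℤ) • P.root i = 0 := by
        have : (1 : ℤ) • P.root i = (2 : ℤ) • P.root i - P.root i := by module
        rw [this, ← h2, sub_self]
      have := zsmul_root_eq_zero h3
      norm_num at this
    · rw [h4, root_negIdx] at h2
      have h3 : (3 : ℤ) • P.root i = 0 := by
        have : (3 : ℤ) • P.root i = (2 : ℤ) • P.root i - (-P.root i) := by module
        rw [this, ← h2, sub_self]
      have := zsmul_root_eq_zero h3
      norm_num at this
  · intro h'
    rw [h', neg_add_cancel, zero_add] at h
    exact root_ne_zero P k h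

/-- The operators which enter the flatness identity. -/
def pairOp [P.IsReduced] (b : P.Base) (c : ι → ℂ) (u v : N) (d : ℕ) (i j : ι) :
    Module.End ℂ (EllLie b) :=
  wedge P u v i j • pairPoly (cotSeries (c i)) (cotSeries (c j)) (P.root' i (halfCoroot P j))
    (P.root' j (halfCoroot P i)) d (adX b (dualVec (P := P) i j)) (adX b (dualVec (P := P) j i))

/-- A family of complex numbers which behaves like `π cot (πα(z))`. -/
structure IsCotFamily (P : RootPairing ι ℂ M N) (c : ι → ℂ) : Prop where
  neg (i : ι) : c (P.reflectionPerm i i) = -c i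
  add_eq (i j k : ι) (h : P.root i + P.root j + P.root k = 0) :
    c i * c j + c j * c k + c k * c i = (Real.pi : ℂ) ^ 2

theorem pairPoly_adX_stringTail_congr (b : P.Base) {i j : ι} {u v u' v' : N}
    (h1 : P.root' i u = P.root' i u') (h2 : P.root' j u = P.root' j u')
    (h3 : P.root' i v = P.root' i v') (h4 : P.root' j v = P.root' j v')
    (f f' : PowerSeries ℂ) (e e' : ℂ) (d : ℕ) :
    pairPoly f f' e e' d (adX b u) (adX b v) (stringTail P (ellT b) i (P.root j)) =
      pairPoly f f' e e' d (adX b u') (adX b v') (stringTail P (ellT b) i (P.root j)) :=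
  pairPoly_apply_congr (adX_stringTail_congr b h1 h2) (adX_stringTail_congr b h3 h4)
    (commute_adX b _ _) (commute_adX b _ _) (commute_adX b _ _) (commute_adX b _ _)
    (commute_adX b _ _) _ _ _ _ _

theorem sum_pairOp_lie_eq_zero [P.IsReduced] [P.IsCrystallographic] (b : P.Base) {c : ι → ℂ}
    (hc : IsCotFamily P c) (u v : N) (d : ℕ) :
    ∑ i, ∑ j, pairOp b c u v d i j ⁅ellT b i, ellT b j⁆ = 0 := by
  refine (isHolonomyFamily_ellT b).sum_lie_eq_zero b _ (fun i j => ?_) (fun i j k h => ?_)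
  · rw [pairOp, pairOp, LinearMap.smul_apply, LinearMap.smul_apply]
    have hw : wedge P u v i (P.reflectionPerm j j) = -wedge P u v i j := by
      simp only [wedge, root'_negIdx, LinearMap.neg_apply]; ring
    rw [hw]
    -- When the wedge vanishes the roots may be proportional and `dualVec` may take its default
    -- value 0; otherwise it really is dual.
    by_cases hij : wedge P u v i j = 0
    · rw [hij, neg_zero, zero_smul, zero_smul]
    obtain ⟨h1, h2⟩ := wedge_ne_zero hij
    obtain ⟨h3, h4⟩ := dualVec_spec h1 h2
    have h2' : P.root j ≠ -P.root i := fun h => h2 (by rw [h, neg_neg])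
    obtain ⟨h5, h6⟩ := dualVec_spec h1.symm h2'
    have h7 : i ≠ P.reflectionPerm j j := fun h => h2 (P.root_eq_neg_iff.2 h)
    have h8 : P.root i ≠ -P.root (P.reflectionPerm j j) := by
      rw [root_negIdx, neg_neg]
      exact fun h => h1 (P.root.injective h)
    obtain ⟨h9, h10⟩ := dualVec_spec h7 h8
    obtain ⟨h11, h12⟩ := dualVec_spec (P := P) h7.symm (fun h => h8 (by rw [h, neg_neg]))
    simp only [root'_negIdx, LinearMap.neg_apply, neg_eq_zero] at h10 h11
    rw [pairPoly_adX_stringTail_congr b (h9.trans h3.symm) (h10.trans h4.symm)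
      (v' := -dualVec (P := P) j i) (by rw [map_neg, h12, h6, neg_zero])
      (by rw [map_neg, h5, ← h11, neg_neg]), map_neg, halfCoroot_negIdx, map_neg, hc.neg,
      root'_negIdx, LinearMap.neg_apply, pairPoly_neg, LinearMap.neg_apply, smul_neg, neg_smul,
      neg_neg]
  · have hr := root'_of_add_eq_zero h
    have hne := ne_and_ne_neg_of_add_eq_zero h
    have hjk := ne_and_ne_neg_of_add_eq_zero (P := P) (i := j) (j := k) (k := i)
      (by rw [← h]; abel)
    have hki := ne_and_ne_neg_of_add_eq_zero (P := P) (i := k) (j := i) (k := j)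
      (by rw [← h]; abel)
    have hw1 : wedge P u v j k = wedge P u v i j := by
      have e1 := hr u
      have e2 := hr v
      simp only [wedge]
      linear_combination P.root' j u * e2 - P.root' j v * e1
    have hw2 : wedge P u v k i = wedge P u v i j := by
      have e1 := hr u
      have e2 := hr v
      simp only [wedge]
      linear_combination P.root' i v * e1 - P.root' i u * e2
    obtain ⟨h1, h2⟩ := dualVec_spec hne.1 hne.2
    obtain ⟨h3, h4⟩ := dualVec_spec hne.1.symm (fun h => hne.2 (by rw [h, neg_neg]))
    obtain ⟨h5, h6⟩ := dualVec_spec hjk.1 hjk.2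
    obtain ⟨h7, h8⟩ := dualVec_spec hjk.1.symm (fun h => hjk.2 (by rw [h, neg_neg]))
    obtain ⟨h9, h10⟩ := dualVec_spec hki.1 hki.2
    obtain ⟨h11, h12⟩ := dualVec_spec hki.1.symm (fun h => hki.2 (by rw [h, neg_neg]))
    simp only [LinearMap.add_apply, pairOp, hw1, hw2, LinearMap.smul_apply]
    rw [← smul_add, ← smul_add]
    have hrr := fun w => eq_neg_of_add_eq_zero_right (hr w)
    -- Let p, q be dual to (α, β). As γ = -α - β, the vectors q - p, -p take the required values for
    -- (β, γ), and -q, p - q for (γ, α), which is the shape of `pairPoly_cyclic`. Its conditions on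
    -- the e's say that the three roots of the triple add up to 0 on each half coroot, where the
    -- corresponding root takes the value 1.
    rw [pairPoly_adX_stringTail_congr b (u := dualVec (P := P) j k) (v := dualVec (P := P) k j)
        (u' := dualVec (P := P) j i - dualVec (P := P) i j) (v' := -dualVec (P := P) i j),
      pairPoly_adX_stringTail_congr b (u := dualVec (P := P) k i) (v := dualVec (P := P) i k)
        (u' := -dualVec (P := P) j i) (v' := dualVec (P := P) i j - dualVec (P := P) j i)]
    · simp only [map_neg, map_sub]
      rw [← LinearMap.add_apply, ← LinearMap.add_apply, pairPoly_cyclic (hc.add_eq i j k h),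
        LinearMap.zero_apply, smul_zero]
      · linear_combination hr (halfCoroot P i) - root'_halfCoroot_self P i
      · linear_combination hr (halfCoroot P j) - root'_halfCoroot_self P j
      · linear_combination hr (halfCoroot P k) - root'_halfCoroot_self P k
      · exact commute_adX b _ _
    all_goals
      have e1 := hr (dualVec (P := P) j k)
      have e2 := hr (dualVec (P := P) k j)
      have e3 := hr (dualVec (P := P) k i)
      have e4 := hr (dualVec (P := P) i k)
      simp only [map_neg, map_sub]
      grind

end FlatnessIdentity

/-! ### Expansion of the bracket of the connection form -/

section BracketComputation

variable {ι M N : Type*} [Fintype ι] [AddCommGroup M] [Module ℂ M] [AddCommGroup N] [Module ℂ N]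
  {P : RootPairing ι ℂ M N}

theorem adX_pow_ellT_congr (b : P.Base) {i : ι} {u v : N} (h : P.root' i u = P.root' i v) (n : ℕ) :
    (adX b u ^ n) (ellT b i) = (adX b v ^ n) (ellT b i) := by
  have := pow_mul_pow_apply_congr (adX_ellT_congr b h) (adX_ellT_congr b h) (commute_adX b u v)
    (commute_adX b u v) (commute_adX b u v) (commute_adX b v v) n 0
  simpa using this

/-- On t_α the half coroot may be replaced by a vector where α = 1 and β = 0; its ad x kills t_β, so
as a derivation it acts on the first factor alone. The same holds with the roles exchanged. -/
theorem lie_pow_pow [P.IsReduced] (b : P.Base) {i j : ι} (h : i ≠ j ∧ P.root i ≠ -P.root j)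
    (k l : ℕ) :
    ⁅(adX b (halfCoroot P i) ^ k) (ellT b i), (adX b (halfCoroot P j) ^ l) (ellT b j)⁆ =
      (adX b (dualVec (P := P) i j) ^ k * adX b (dualVec (P := P) j i) ^ l)
        ⁅ellT b i, ellT b j⁆ := by
  obtain ⟨h1, h2⟩ := dualVec_spec h.1 h.2
  obtain ⟨h3, h4⟩ := dualVec_spec h.1.symm (fun h' => h.2 (by rw [h', neg_neg]))
  rw [adX_pow_ellT_congr b ((root'_halfCoroot_self P i).trans h1.symm),
    adX_pow_ellT_congr b ((root'_halfCoroot_self P j).trans h3.symm), Module.End.mul_apply,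
    adX_eq b (dualVec (P := P) j i), ad_pow_lie_of_left (adX_ellT_eq_zero b h4),
    adX_eq b (dualVec (P := P) i j), ad_pow_lie_of_right]
  rw [← adX_apply, ← adX_eq, ← Module.End.mul_apply, ((commute_adX b _ _).pow_right l).eq,
    Module.End.mul_apply, adX_ellT_eq_zero b h2, map_zero]

/-- The half coroot of β acts on both factors of [t_α, t_β]; since β is 1 on it, its action is that
of α(h_β) p + q for the dual vectors p, q. -/
theorem pow_lie_pow [P.IsReduced] (b : P.Base) {i j : ι} (h : i ≠ j ∧ P.root i ≠ -P.root j)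
    (s l : ℕ) :
    (adX b (halfCoroot P j) ^ s) ⁅ellT b i, (adX b (halfCoroot P j) ^ l) (ellT b j)⁆ =
      ((P.root' i (halfCoroot P j) • adX b (dualVec (P := P) i j) +
        adX b (dualVec (P := P) j i)) ^ s * adX b (dualVec (P := P) j i) ^ l)
        ⁅ellT b i, ellT b j⁆ := by
  obtain ⟨h1, h2⟩ := dualVec_spec h.1 h.2
  obtain ⟨h3, h4⟩ := dualVec_spec h.1.symm (fun h' => h.2 (by rw [h', neg_neg]))
  have h5 := lie_pow_pow b h 0 l
  rw [pow_zero, pow_zero, one_mul, Module.End.one_apply] at h5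
  rw [h5, ← Module.End.mul_apply, ← map_smul, ← map_add]
  refine pow_mul_pow_apply_congr ?_ rfl (commute_adX b _ _) (Commute.refl _) (commute_adX b _ _)
    (commute_adX b _ _) s l
  rw [← sub_eq_zero, ← LinearMap.sub_apply, ← map_sub]
  refine adX_lie_eq_zero b ?_ ?_
  · rw [map_sub, map_add, map_smul, h1, h4]
    simp
  · rw [map_sub, map_add, map_smul, h2, h3, root'_halfCoroot_self]
    simp

/-- As β(w) = 0, y(w) commutes with t_β. Moving it through the powers leaves only the commutators
[y(w), x(h_β)], which are sums of t_α. -/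
theorem lie_ellY_pow (b : P.Base) {j : ι} {w : N} (hw : P.root' j w = 0) (d : ℕ) :
    ⁅ellY b w, (adX b (halfCoroot P j) ^ (d + 1)) (ellT b j)⁆ =
      ∑ i ∈ posRoots b, (P.root' i w * P.root' i (halfCoroot P j)) •
        ∑ s ∈ Finset.range (d + 1), (adX b (halfCoroot P j) ^ s)
          ⁅ellT b i, (adX b (halfCoroot P j) ^ (d - s)) (ellT b j)⁆ := by
  have h := LinearMap.congr_fun (mul_pow_eq_add_sum (LieAlgebra.ad ℂ (EllLie b) (ellY b w))
    (adX b (halfCoroot P j)) (d + 1)) (ellT b j)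
  have h0 : LieAlgebra.ad ℂ (EllLie b) (ellY b w) (ellT b j) = 0 := by
    rw [LieAlgebra.ad_apply, ← lie_skew, lie_ellT_ellY b hw, neg_zero]
  have hcomm : ∀ a : EllLie b, (LieAlgebra.ad ℂ (EllLie b) (ellY b w) * adX b (halfCoroot P j) -
      adX b (halfCoroot P j) * LieAlgebra.ad ℂ (EllLie b) (ellY b w)) a =
      ∑ i ∈ posRoots b, (P.root' i w * P.root' i (halfCoroot P j)) • ⁅ellT b i, a⁆ := by
    intro a
    rw [LinearMap.sub_apply, Module.End.mul_apply, Module.End.mul_apply, LieAlgebra.ad_apply,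
      LieAlgebra.ad_apply, adX_apply, adX_apply, leibniz_lie, add_sub_cancel_right,
      lie_ellY_ellX, sum_lie]
    exact Finset.sum_congr rfl fun i _ => by rw [smul_lie, mul_comm]
  rw [Module.End.mul_apply, LieAlgebra.ad_apply, LinearMap.add_apply, Module.End.mul_apply, h0,
    map_zero, zero_add, LinearMap.sum_apply] at h
  rw [h]
  simp only [Module.End.mul_apply, hcomm, map_sum, map_smul, Nat.add_sub_cancel]
  rw [Finset.sum_comm]
  exact Finset.sum_congr rfl fun i _ => (Finset.smul_sum).symm

/-- The vector β(v)u - β(u)v is killed by β, and α takes on it the value (α ∧ β)(u, v). The factor 2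
extends the sum from positive roots to all roots. -/
theorem two_smul_lie_ellY_pow [P.IsReduced] (b : P.Base) (u v : N) (j : ι) (d : ℕ) :
    (2 : ℂ) • ⁅ellY b (P.root' j v • u - P.root' j u • v),
        (adX b (halfCoroot P j) ^ (d + 1)) (ellT b j)⁆ =
      ∑ i, (wedge P u v i j * P.root' i (halfCoroot P j)) •
        ∑ s ∈ Finset.range (d + 1), ((P.root' i (halfCoroot P j) • adX b (dualVec (P := P) i j) +
        adX b (dualVec (P := P) j i)) ^ s * adX b (dualVec (P := P) j i) ^ (d - s))
        ⁅ellT b i, ellT b j⁆ := by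
  have hw : ∀ i, P.root' i (P.root' j v • u - P.root' j u • v) = wedge P u v i j := by
    intro i
    simp only [map_sub, map_smul, smul_eq_mul, wedge]
    ring
  rw [lie_ellY_pow b (by rw [hw, wedge, sub_self]), ← sum_eq_two_smul_sum_posRoots b]
  · refine Finset.sum_congr rfl fun i _ => ?_
    rw [hw]
    by_cases h0 : wedge P u v i j = 0
    · rw [h0, zero_mul, zero_smul, zero_smul]
    · congr 1
      exact Finset.sum_congr rfl fun s _ => pow_lie_pow b (wedge_ne_zero h0) s (d - s)
  · intro i
    simp only [root'_negIdx, ellT_negIdx, LinearMap.neg_apply, neg_mul_neg]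

theorem adX_pow_weight (b : P.Base) (u : N) {m : ℕ} {a : EllLie b} (ha : EllWeight b m a) (k : ℕ) :
    EllWeight b (k + m) ((adX b u ^ k) a) := by
  induction k with
  | zero => simpa using ha
  | succ k ih =>
    rw [pow_succ', Module.End.mul_apply, adX_apply, add_right_comm, add_comm]
    exact EllWeight.lie (EllWeight.x u) ih

theorem mem_ellFiltration_of_weight (b : P.Base) {m n : ℕ} (h : n ≤ m) {a : EllLie b}
    (ha : EllWeight b m a) : a ∈ ellFiltration b n :=
  LieSubmodule.subset_lieSpan ⟨m, h, ha⟩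

/-- The truncation of the series `f(ad (x(α^∨) / 2))(t_α)` at degree `n`. -/
def truncSeries (b : P.Base) (f : PowerSeries ℂ) (n : ℕ) (i : ι) : EllLie b :=
  ∑ k ∈ Finset.range n, PowerSeries.coeff k f • (adX b (halfCoroot P i) ^ k) (ellT b i)

theorem sum_range_product_eq {V : Type*} [AddCommGroup V] (n : ℕ) (G : ℕ × ℕ → V)
    (hG : ∀ x : ℕ × ℕ, n ≤ x.1 + x.2 → G x = 0) :
    ∑ k ∈ Finset.range n, ∑ l ∈ Finset.range n, G (k, l) =
      ∑ d ∈ Finset.range n, ∑ x ∈ Finset.HasAntidiagonal.antidiagonal d, G x := by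
  rw [← Finset.sum_product',
    ← Finset.sum_filter_add_sum_filter_not _ (fun x : ℕ × ℕ => x.1 + x.2 < n)]
  rw [Finset.sum_eq_zero (s := Finset.filter (fun x : ℕ × ℕ => ¬ x.1 + x.2 < n) _), add_zero]
  · rw [← Finset.sum_fiberwise_of_maps_to (g := fun x : ℕ × ℕ => x.1 + x.2)
      (t := Finset.range n)]
    · refine Finset.sum_congr rfl fun d hd => Finset.sum_congr ?_ fun _ _ => rfl
      ext x
      have := Finset.mem_range.1 hd
      simp only [Finset.mem_filter, Finset.mem_product, Finset.mem_range,
        Finset.HasAntidiagonal.mem_antidiagonal]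
      omega
    · intro x hx
      exact Finset.mem_range.2 (Finset.mem_filter.1 hx).2
  · intro x hx
    exact hG x (not_lt.1 (Finset.mem_filter.1 hx).2)

variable {V : Type*} [AddCommGroup V] [Module ℂ V]

/-- A term of total degree d has weight d + 4, so those with d ≥ n die under π and the square of
exponents may be cut down to antidiagonals. -/
theorem map_lie_truncSeries [P.IsReduced] (b : P.Base) (f f' : PowerSeries ℂ) (n : ℕ) {i j : ι}
    (h : i ≠ j ∧ P.root i ≠ -P.root j) (π : EllLie b →ₗ[ℂ] V)
    (hπ : ∀ a ∈ ellFiltration b n, π a = 0) :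
    π ⁅truncSeries b f n i, truncSeries b f' n j⁆ = ∑ d ∈ Finset.range n,
      π ((∑ x ∈ Finset.HasAntidiagonal.antidiagonal d,
        (PowerSeries.coeff x.1 f * PowerSeries.coeff x.2 f') •
        (adX b (dualVec (P := P) i j) ^ x.1 * adX b (dualVec (P := P) j i) ^ x.2))
          ⁅ellT b i, ellT b j⁆) := by
  have h1 := sum_range_product_eq n (fun x => π ((PowerSeries.coeff x.1 f *
    PowerSeries.coeff x.2 f') • (adX b (dualVec (P := P) i j) ^ x.1 *
      adX b (dualVec (P := P) j i) ^ x.2) ⁅ellT b i, ellT b j⁆)) (fun x hx => by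
      rw [map_smul, hπ, smul_zero]
      rw [Module.End.mul_apply]
      refine mem_ellFiltration_of_weight b ?_ (adX_pow_weight b _ (adX_pow_weight b _
        (EllWeight.lie (EllWeight.t i) (EllWeight.t j)) x.2) x.1)
      omega)
  simp only [LinearMap.sum_apply, LinearMap.smul_apply, map_sum]
  rw [← h1, truncSeries, truncSeries, sum_lie, map_sum]
  refine Finset.sum_congr rfl fun k _ => ?_
  rw [lie_sum, map_sum]
  refine Finset.sum_congr rfl fun l _ => ?_
  rw [smul_lie, lie_smul, lie_pow_pow b h, smul_smul]

/-- The constant term drops out because y(w) commutes with t_β, hence the shift to d + 1. The extra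
exponent n costs nothing: its term has weight n + 3 and dies under π. -/
theorem map_lie_ellY_truncSeries (b : P.Base) (f : PowerSeries ℂ) (n : ℕ) {j : ι} {w : N}
    (hw : P.root' j w = 0) (π : EllLie b →ₗ[ℂ] V) (hπ : ∀ a ∈ ellFiltration b n, π a = 0) :
    π ⁅ellY b w, truncSeries b f n j⁆ = ∑ d ∈ Finset.range n, PowerSeries.coeff (d + 1) f •
      π ⁅ellY b w, (adX b (halfCoroot P j) ^ (d + 1)) (ellT b j)⁆ := by
  have h1 : ∑ k ∈ Finset.range (n + 1), PowerSeries.coeff k f •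
      π ⁅ellY b w, (adX b (halfCoroot P j) ^ k) (ellT b j)⁆ =
      ∑ d ∈ Finset.range n, PowerSeries.coeff (d + 1) f •
      π ⁅ellY b w, (adX b (halfCoroot P j) ^ (d + 1)) (ellT b j)⁆ := by
    rw [Finset.sum_range_succ', pow_zero, Module.End.one_apply, ← lie_skew, lie_ellT_ellY b hw,
      neg_zero, map_zero, smul_zero, add_zero]
  have h2 : π ⁅ellY b w, (adX b (halfCoroot P j) ^ n) (ellT b j)⁆ = 0 := by
    refine hπ _ (mem_ellFiltration_of_weight b ?_ (EllWeight.lie (EllWeight.y w)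
      (adX_pow_weight b _ (EllWeight.t j) n)))
    omega
  rw [← h1, Finset.sum_range_succ, h2, smul_zero, add_zero, truncSeries, lie_sum, map_sum]
  exact Finset.sum_congr rfl fun k _ => by rw [lie_smul, map_smul]

theorem truncSeries_negIdx (b : P.Base) {c : ι → ℂ} (hc : IsCotFamily P c) (n : ℕ) (i : ι) :
    truncSeries b (cotSeries (c (P.reflectionPerm i i))) n (P.reflectionPerm i i) =
      -truncSeries b (cotSeries (c i)) n i := by
  rw [truncSeries, truncSeries, ← Finset.sum_neg_distrib]
  refine Finset.sum_congr rfl fun k _ => ?_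
  rw [hc.neg, coeff_cotSeries_neg, halfCoroot_negIdx, map_neg, ellT_negIdx, ← neg_smul]
  have h : -adX b (halfCoroot P i) = (-1 : ℂ) • adX b (halfCoroot P i) := by module
  rw [h, smul_pow, LinearMap.smul_apply, smul_smul]
  congr 1
  have : ((-1 : ℂ) ^ k) * (-1) ^ k = 1 := by rw [← mul_pow]; simp
  linear_combination (-PowerSeries.coeff k (cotSeries (c i))) * this

/-- The truncation of the coefficient of the connection form. -/
def truncForm (b : P.Base) (c : ι → ℂ) (n : ℕ) (u : N) : EllLie b :=
  ∑ i ∈ posRoots b, P.root' i u • truncSeries b (cotSeries (c i)) n i - ellY b u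

/-- The factor 8 is 2 · 2 for extending both sums from positive roots to all roots, times 2 for
antisymmetrizing the double sum; [y, y] = 0 removes the last term. -/
theorem eight_smul_lie_truncForm (b : P.Base) {c : ι → ℂ} (hc : IsCotFamily P c) (n : ℕ)
    (u v : N) : (8 : ℂ) • ⁅truncForm b c n u, truncForm b c n v⁆ =
      ∑ i, ∑ j, wedge P u v i j •
        ⁅truncSeries b (cotSeries (c i)) n i, truncSeries b (cotSeries (c j)) n j⁆ -
      (4 : ℂ) • ∑ j, ⁅ellY b (P.root' j v • u - P.root' j u • v),
        truncSeries b (cotSeries (c j)) n j⁆ := by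
  set B : ι → EllLie b := fun i => truncSeries b (cotSeries (c i)) n i with hB
  let S : N → EllLie b := fun u => ∑ i, P.root' i u • B i
  have h2 : ∀ u, (2 : ℂ) • truncForm b c n u = S u - (2 : ℂ) • ellY b u := by
    intro u
    rw [truncForm, smul_sub, ← sum_eq_two_smul_sum_posRoots b]
    intro i
    rw [root'_negIdx, truncSeries_negIdx b hc, LinearMap.neg_apply, smul_neg, neg_smul, neg_neg]
  have hS : ∀ u v, ⁅S u, S v⁆ = ∑ i, ∑ j, (P.root' i u * P.root' j v) • ⁅B i, B j⁆ := by
    intro u v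
    rw [sum_lie]
    refine Finset.sum_congr rfl fun i _ => ?_
    rw [lie_sum]
    exact Finset.sum_congr rfl fun j _ => by rw [smul_lie, lie_smul, smul_smul]
  have hS2 : (2 : ℂ) • ⁅S u, S v⁆ = ∑ i, ∑ j, wedge P u v i j • ⁅B i, B j⁆ := by
    rw [two_smul]
    nth_rewrite 2 [← lie_skew]
    rw [hS, hS, ← sub_eq_add_neg, ← Finset.sum_sub_distrib]
    refine Finset.sum_congr rfl fun i _ => ?_
    rw [← Finset.sum_sub_distrib]
    refine Finset.sum_congr rfl fun j _ => ?_
    rw [← sub_smul, wedge]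
    congr 1
    ring
  have hyS : ∀ u v, ⁅ellY b u, S v⁆ = ∑ j, P.root' j v • ⁅ellY b u, B j⁆ := by
    intro u v
    rw [lie_sum]
    exact Finset.sum_congr rfl fun j _ => by rw [lie_smul]
  have hy : ⁅ellY b u, S v⁆ - ⁅ellY b v, S u⁆ =
      ∑ j, ⁅ellY b (P.root' j v • u - P.root' j u • v), B j⁆ := by
    rw [hyS, hyS, ← Finset.sum_sub_distrib]
    refine Finset.sum_congr rfl fun j _ => ?_
    rw [map_sub, map_smul, map_smul, sub_lie, smul_lie, smul_lie]
  have h4 : (4 : ℂ) • ⁅truncForm b c n u, truncForm b c n v⁆ =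
      ⁅S u, S v⁆ - (2 : ℂ) • (⁅ellY b u, S v⁆ - ⁅ellY b v, S u⁆) := by
    have : (4 : ℂ) • ⁅truncForm b c n u, truncForm b c n v⁆ =
        ⁅(2 : ℂ) • truncForm b c n u, (2 : ℂ) • truncForm b c n v⁆ := by
      rw [smul_lie, lie_smul, smul_smul]; norm_num
    rw [this, h2, h2, sub_lie, lie_sub, lie_sub, lie_smul, smul_lie, smul_lie, lie_smul,
      lie_ellY_ellY, ← lie_skew (S u) (ellY b v)]
    module
  have h8 : (8 : ℂ) • ⁅truncForm b c n u, truncForm b c n v⁆ =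
      (2 : ℂ) • (4 : ℂ) • ⁅truncForm b c n u, truncForm b c n v⁆ := by
    rw [smul_smul]; norm_num
  rw [h8, h4, smul_sub, hS2, hy, smul_smul, show (2 : ℂ) * 2 = 4 by norm_num]

theorem map_lie_truncForm_eq_zero [P.IsReduced] [P.IsCrystallographic] (b : P.Base) {c : ι → ℂ}
    (hc : IsCotFamily P c) (n : ℕ) (u v : N) (π : EllLie b →ₗ[ℂ] V)
    (hπ : ∀ a ∈ ellFiltration b n, π a = 0) :
    π ⁅truncForm b c n u, truncForm b c n v⁆ = 0 := by
  -- W collects the brackets of two t-series, U the divided differences coming from y; up to the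
  -- wedge, `pairOp` is W minus U and its transpose.
  let U : ℕ → ι → ι → Module.End ℂ (EllLie b) := fun d i j =>
    (PowerSeries.coeff (d + 1) (cotSeries (c j)) * P.root' i (halfCoroot P j)) •
      ∑ s ∈ Finset.range (d + 1), (P.root' i (halfCoroot P j) • adX b (dualVec (P := P) i j) +
        adX b (dualVec (P := P) j i)) ^ s * adX b (dualVec (P := P) j i) ^ (d - s)
  let W : ℕ → ι → ι → Module.End ℂ (EllLie b) := fun d i j =>
    ∑ x ∈ Finset.HasAntidiagonal.antidiagonal d,
      (PowerSeries.coeff x.1 (cotSeries (c i)) * PowerSeries.coeff x.2 (cotSeries (c j))) •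
        (adX b (dualVec (P := P) i j) ^ x.1 * adX b (dualVec (P := P) j i) ^ x.2)
  have hop : ∀ d i j, pairOp b c u v d i j = wedge P u v i j • (W d i j - U d i j - U d j i) := by
    intro d i j
    simp only [pairOp, pairPoly, W, U]
    congr! 5 with s _
    rw [add_comm]
  -- The wedge and the bracket are both antisymmetric, so U and its transpose have the same sum; of
  -- the two copies of U arising from y, one is transposed in this way.
  have hswap : ∀ d, ∑ i, ∑ j, wedge P u v i j • U d j i ⁅ellT b i, ellT b j⁆ =
      ∑ i, ∑ j, wedge P u v i j • U d i j ⁅ellT b i, ellT b j⁆ := by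
    intro d
    rw [Finset.sum_comm]
    refine Finset.sum_congr rfl fun i _ => Finset.sum_congr rfl fun j _ => ?_
    rw [wedge_swap, ← lie_skew, map_neg, smul_neg, neg_smul, neg_neg]
  have hzero := fun d => sum_pairOp_lie_eq_zero b hc u v d
  have h1 : π (∑ i, ∑ j, wedge P u v i j •
        ⁅truncSeries b (cotSeries (c i)) n i, truncSeries b (cotSeries (c j)) n j⁆) =
      ∑ d ∈ Finset.range n, π (∑ i, ∑ j, wedge P u v i j • W d i j ⁅ellT b i, ellT b j⁆) := by
    simp only [map_sum]
    rw [Finset.sum_comm (s := Finset.range n)]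
    refine Finset.sum_congr rfl fun i _ => ?_
    rw [Finset.sum_comm (s := Finset.range n)]
    refine Finset.sum_congr rfl fun j _ => ?_
    by_cases h0 : wedge P u v i j = 0
    · simp [h0]
    · rw [map_smul, map_lie_truncSeries b _ _ n (wedge_ne_zero h0) π hπ, Finset.smul_sum]
      exact Finset.sum_congr rfl fun d _ => (map_smul π _ _).symm
  have h2 : (2 : ℂ) • π (∑ j, ⁅ellY b (P.root' j v • u - P.root' j u • v),
        truncSeries b (cotSeries (c j)) n j⁆) =
      ∑ d ∈ Finset.range n, π (∑ i, ∑ j, wedge P u v i j • U d i j ⁅ellT b i, ellT b j⁆) := by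
    have h3 : ∀ d ∈ Finset.range n,
        π (∑ i, ∑ j, wedge P u v i j • U d i j ⁅ellT b i, ellT b j⁆) =
        ∑ j, (2 : ℂ) • PowerSeries.coeff (d + 1) (cotSeries (c j)) •
          π ⁅ellY b (P.root' j v • u - P.root' j u • v),
            (adX b (halfCoroot P j) ^ (d + 1)) (ellT b j)⁆ := by
      intro d _
      rw [Finset.sum_comm, map_sum]
      refine Finset.sum_congr rfl fun j _ => ?_
      rw [smul_comm, ← map_smul, two_smul_lie_ellY_pow, ← map_smul, Finset.smul_sum]
      congr 1
      refine Finset.sum_congr rfl fun i _ => ?_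
      simp only [U, LinearMap.smul_apply, LinearMap.sum_apply, smul_smul]
      congr 1
      ring
    rw [Finset.sum_congr rfl h3, Finset.sum_comm, map_sum, Finset.smul_sum]
    refine Finset.sum_congr rfl fun j _ => ?_
    rw [map_lie_ellY_truncSeries b _ n _ π hπ, Finset.smul_sum]
    simp only [map_sub, map_smul, smul_eq_mul]
    ring
  have h8 : (8 : ℂ) • π ⁅truncForm b c n u, truncForm b c n v⁆ = 0 := by
    rw [← map_smul, eight_smul_lie_truncForm b hc, map_sub, h1, map_smul,
      show (4 : ℂ) = 2 * 2 by norm_num, mul_smul, h2, Finset.smul_sum, ← Finset.sum_sub_distrib]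
    refine Finset.sum_eq_zero fun d _ => ?_
    rw [two_smul, ← map_add, ← map_sub, ← map_zero π, ← hzero d]
    congr 1
    nth_rewrite 2 [← hswap d]
    rw [← sub_sub]
    simp only [← Finset.sum_sub_distrib, hop, LinearMap.smul_apply, LinearMap.sub_apply, smul_sub]
  exact (smul_eq_zero.1 h8).resolve_left (by norm_num)

/-- The connection form with the coefficients `c_α + g(a_α)`, for `g = π cot (πX) - 1/X`. -/
def cotForm (b : P.Base) (c : ι → ℂ) : N →ₗ[ℂ] EllHat b :=
  ∑ i ∈ posRoots b, (P.root' i).smulRight (hatSeries b (cotSeries (c i)) i) - hatY b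

theorem proj_cotForm (b : P.Base) (c : ι → ℂ) (n : ℕ) (u : N) :
    Completion.proj n (cotForm b c u) = LieSubmodule.Quotient.mk (truncForm b c n u) := by
  rw [cotForm, LinearMap.sub_apply, LinearMap.sum_apply, map_sub, map_sum]
  refine Eq.trans ?_ (map_sub (LieSubmodule.Quotient.mk' (ellFiltration b n)) _ _).symm
  rw [map_sum]
  refine congrArg₂ (· - ·) (Finset.sum_congr rfl fun i _ => ?_) rfl
  rw [LinearMap.smulRight_apply, map_smul]
  exact (map_smul (LieSubmodule.Quotient.mk' (ellFiltration b n)) _ _).symm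

theorem lie_cotForm_eq_zero [P.IsReduced] [P.IsCrystallographic] (b : P.Base) {c : ι → ℂ}
    (hc : IsCotFamily P c) (u v : N) : ⁅cotForm b c u, cotForm b c v⁆ = 0 := by
  refine Completion.ext_proj fun n => ?_
  rw [Completion.proj_lie, proj_cotForm, proj_cotForm, map_zero,
    ← LieSubmodule.Quotient.mk_bracket]
  exact map_lie_truncForm_eq_zero b hc n u v
    (LieSubmodule.Quotient.mk' (ellFiltration b n)).toLinearMap
    fun a ha => LieSubmodule.Quotient.mk_eq_zero'.2 ha

end BracketComputation

/-! ### The three cotangent families and the trigonometric homomorphism -/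

section TrigonometricMap

variable {ι M N : Type*} [Fintype ι] [AddCommGroup M] [Module ℂ M] [AddCommGroup N] [Module ℂ N]
  {P : RootPairing ι ℂ M N}

theorem proj_hatSeries (b : P.Base) (f : PowerSeries ℂ) (i : ι) (n : ℕ) :
    Completion.proj n (hatSeries b f i) = LieSubmodule.Quotient.mk (truncSeries b f n i) := rfl

theorem hatSeries_add (b : P.Base) (f f' : PowerSeries ℂ) (i : ι) :
    hatSeries b (f + f') i = hatSeries b f i + hatSeries b f' i := by
  refine Completion.ext_proj fun n => ?_
  rw [map_add, proj_hatSeries, proj_hatSeries, proj_hatSeries]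
  refine Eq.trans ?_ (map_add (LieSubmodule.Quotient.mk' (ellFiltration b n)) _ _)
  congr 1
  simp only [truncSeries, map_add, add_smul, Finset.sum_add_distrib]

theorem hatSeries_C (b : P.Base) (r : ℂ) (i : ι) :
    hatSeries b (PowerSeries.C r) i = r • hatT b i := by
  refine Completion.ext_proj fun n => ?_
  rw [map_smul, proj_hatSeries]
  have h : Completion.proj n (hatT b i) = LieSubmodule.Quotient.mk' (ellFiltration b n) (ellT b i) :=
    rfl
  rw [h, ← map_smul]
  change LieSubmodule.Quotient.mk' (ellFiltration b n) _ = _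
  cases n with
  | zero =>
    -- At level 0 the truncation is an empty sum, so the claim needs t_α to vanish there, which it
    -- does since it lies in the filtration step 0.
    have h0 : r • ellT b i ∈ ellFiltration b 0 :=
      Submodule.smul_mem _ _ (mem_ellFiltration_of_weight b (Nat.zero_le 2) (EllWeight.t i))
    rw [truncSeries, Finset.range_zero, Finset.sum_empty, map_zero,
      (LieSubmodule.Quotient.mk_eq_zero _).2 h0]
  | succ n =>
    rw [truncSeries, Finset.sum_range_succ', PowerSeries.coeff_zero_C, pow_zero,
      Module.End.one_apply, Finset.sum_eq_zero, zero_add]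
    intro k _
    rw [PowerSeries.coeff_C, if_neg (Nat.succ_ne_zero k), zero_smul]

theorem hatSeries_cotSeries (b : P.Base) (c : ℂ) (i : ι) :
    hatSeries b (cotSeries c) i = (c - Real.pi * Complex.I) • hatT b i + hatSeries b hSeries i := by
  rw [cotSeries, hatSeries_add, hatSeries_C]

theorem cotForm_apply (b : P.Base) (c : ι → ℂ) (u : N) :
    cotForm b c u = ∑ i ∈ posRoots b, P.root' i u • (c i - Real.pi * Complex.I) • hatT b i +
      hatXi b u := by
  rw [cotForm, hatXi, LinearMap.sub_apply, LinearMap.add_apply, LinearMap.sum_apply,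
    LinearMap.sum_apply, LinearMap.neg_apply]
  simp only [LinearMap.smulRight_apply, hatSeries_cotSeries, smul_add, Finset.sum_add_distrib]
  abel

theorem degForm_eq (b : P.Base) (h : Torus P) : degForm b h =
    ∑ i ∈ posRoots b, (P.root' i).smulRight
        ((2 * Real.pi * Complex.I / (expRoot P i h - 1)) • hatT b i) + hatXi b := by
  refine LinearMap.ext fun u => ?_
  rw [degForm, hatXi, LinearMap.sub_apply, LinearMap.add_apply, LinearMap.add_apply,
    LinearMap.sum_apply, LinearMap.sum_apply, LinearMap.sum_apply, LinearMap.neg_apply]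
  simp only [LinearMap.smulRight_apply, hatSeries_add, hatSeries_C, smul_add,
    Finset.sum_add_distrib]
  abel

theorem expRoot_mk (i : ι) (z : N) : expRoot P i (z : Torus P) =
    Complex.exp (2 * Real.pi * Complex.I * P.root' i z) := rfl

/-- The numbers `π cot (π α(z))`. -/
def torusCot (h : Torus P) (i : ι) : ℂ :=
  Real.pi * Complex.I * (expRoot P i h + 1) / (expRoot P i h - 1)

theorem torusCot_sub {h : Torus P} (hh : h ∈ torusReg P) (i : ι) :
    torusCot h i - Real.pi * Complex.I = 2 * Real.pi * Complex.I / (expRoot P i h - 1) := by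
  have := sub_ne_zero.2 (hh i)
  rw [torusCot]
  field_simp
  ring

theorem degForm_eq_cotForm (b : P.Base) {h : Torus P} (hh : h ∈ torusReg P) :
    degForm b h = cotForm b (torusCot h) := by
  refine LinearMap.ext fun u => ?_
  rw [cotForm_apply, degForm_eq, LinearMap.add_apply, LinearMap.sum_apply]
  simp only [torusCot_sub hh, LinearMap.smulRight_apply]

/-- The cotangent relation for three arguments with sum zero, in terms of exponentials with product
1. -/
theorem isCotFamily_torusCot {h : Torus P} (hh : h ∈ torusReg P) :
    IsCotFamily P (torusCot h) := by
  have hh' := fun i => sub_ne_zero.2 (hh i)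
  induction h using QuotientAddGroup.induction_on with | _ z => ?_
  constructor
  · intro i
    have h1 := hh' i
    have h2 := hh' (P.reflectionPerm i i)
    have h3 : expRoot P (P.reflectionPerm i i) (z : Torus P) * expRoot P i z = 1 := by
      rw [expRoot_mk, expRoot_mk, ← Complex.exp_add, root'_negIdx]
      simp
    rw [torusCot, torusCot]
    generalize expRoot P i (z : Torus P) = a at *
    generalize expRoot P (P.reflectionPerm i i) (z : Torus P) = a' at *
    field_simp
    linear_combination 2 * h3
  · intro i j k h
    have h1 := hh' i
    have h2 := hh' j
    have h3 := hh' k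
    have h4 : expRoot P i (z : Torus P) * expRoot P j z * expRoot P k z = 1 := by
      rw [expRoot_mk, expRoot_mk, expRoot_mk, ← Complex.exp_add, ← Complex.exp_add, ← mul_add,
        ← mul_add, root'_of_add_eq_zero h]
      simp
    simp only [torusCot]
    generalize expRoot P i (z : Torus P) = a at *
    generalize expRoot P j (z : Torus P) = a' at *
    generalize expRoot P k (z : Torus P) = a'' at *
    have hI := Complex.I_sq
    field_simp
    rw [hI]
    linear_combination (-4) * h4

theorem height_add_eq_zero (b : P.Base) {i j k : ι} (h : P.root i + P.root j + P.root k = 0) :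
    b.height i + b.height j + b.height k = 0 := by
  let := P.indexNeg
  have h1 : P.root (-k) = P.root i + P.root j := by
    rw [RootPairing.indexNeg_neg, root_negIdx, eq_comm, ← sub_eq_zero, sub_neg_eq_add, h]
  have h2 := b.height_add h1
  rw [b.height_reflectionPerm_self] at h2
  omega

theorem height_negIdx (b : P.Base) (i : ι) : b.height (P.reflectionPerm i i) = -b.height i := by
  let := P.indexNeg
  exact b.height_reflectionPerm_self i

open scoped Classical in
/-- `± πi`, according to whether `w⁻¹ α` is positive or negative. -/
def signCot (b : P.Base) (w : P.weylGroup) (i : ι) : ℂ :=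
  if b.IsPos (P.weylGroupToPerm w⁻¹ i) then Real.pi * Complex.I else -(Real.pi * Complex.I)

theorem weylGroupToPerm_negIdx (w : P.weylGroup) (i : ι) :
    P.weylGroupToPerm w (P.reflectionPerm i i) =
      P.reflectionPerm (P.weylGroupToPerm w i) (P.weylGroupToPerm w i) := by
  apply P.root.injective
  rw [← RootPairing.weylGroup_apply_root, root_negIdx, root_negIdx, smul_neg,
    RootPairing.weylGroup_apply_root]

theorem weylGroupToPerm_add_eq_zero (w : P.weylGroup) {i j k : ι}
    (h : P.root i + P.root j + P.root k = 0) :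
    P.root (P.weylGroupToPerm w i) + P.root (P.weylGroupToPerm w j) +
      P.root (P.weylGroupToPerm w k) = 0 := by
  rw [← RootPairing.weylGroup_apply_root, ← RootPairing.weylGroup_apply_root,
    ← RootPairing.weylGroup_apply_root, ← smul_add, ← smul_add, h, smul_zero]

theorem pi_I_sq : (Real.pi * Complex.I : ℂ) ^ 2 = -(Real.pi : ℂ) ^ 2 := by
  rw [mul_pow, Complex.I_sq]; ring

/-- The heights of a zero triple are non-zero with sum 0, so exactly two of the signs agree and the
expression is (πi)²(1 - 1 - 1) = π². -/
theorem isCotFamily_signCot (b : P.Base) (w : P.weylGroup) : IsCotFamily P (signCot b w) := by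
  constructor
  · intro i
    rw [signCot, signCot, weylGroupToPerm_negIdx]
    by_cases h : b.IsPos (P.weylGroupToPerm w⁻¹ i)
    · rw [if_neg, if_pos h]
      rw [isPos_negIdx_iff]; simpa using h
    · rw [if_pos, if_neg h, neg_neg]
      rwa [isPos_negIdx_iff]
  · intro i j k h
    have h1 := height_add_eq_zero b (weylGroupToPerm_add_eq_zero w⁻¹ h)
    have hi := b.height_ne_zero (P.weylGroupToPerm w⁻¹ i)
    have hj := b.height_ne_zero (P.weylGroupToPerm w⁻¹ j)
    have hk := b.height_ne_zero (P.weylGroupToPerm w⁻¹ k)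
    have hI := pi_I_sq
    simp only [signCot, RootPairing.Base.isPos_iff]
    split_ifs <;> first | (exfalso; omega) | linear_combination -hI

open scoped Classical in
/-- The family obtained from `signCot` by changing the value at `± i`. -/
def wallCot (b : P.Base) (w : P.weylGroup) (i : ι) (s : ℂ) (j : ι) : ℂ :=
  if j = i then s else if j = P.reflectionPerm i i then -s else signCot b w j

/-- If a zero triple contains ±α, the height of w⁻¹(±α) is ±1. The other two heights are non-zero
integers adding up to ∓1, so they have opposite signs: their values sum to 0 and have product π².
Hence s drops out of the condition. -/
theorem isCotFamily_wallCot [P.IsReduced] (b : P.Base) {w : P.weylGroup} {i : ι}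
    (hw : P.weylGroupToPerm w⁻¹ i ∈ b.support) (s : ℂ) : IsCotFamily P (wallCot b w i s) := by
  have hne : ∀ j, j ≠ P.reflectionPerm j j := by
    let := P.indexNeg
    exact fun j => P.ne_neg j
  have hneg : ∀ j, wallCot b w i s (P.reflectionPerm j j) = -wallCot b w i s j := by
    intro j
    by_cases h1 : j = i
    · subst h1
      rw [wallCot, if_neg (hne j).symm, if_pos rfl, wallCot, if_pos rfl]
    by_cases h2 : j = P.reflectionPerm i i
    · subst h2
      rw [negIdx_negIdx, wallCot, if_pos rfl, wallCot, if_neg h1, if_pos rfl, neg_neg]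
    · have h3 : P.reflectionPerm j j ≠ i := fun h => h2 (by rw [← h, negIdx_negIdx])
      have h4 : P.reflectionPerm j j ≠ P.reflectionPerm i i :=
        fun h => h1 ((negIdx P).injective h)
      rw [wallCot, if_neg h3, if_neg h4, wallCot, if_neg h1, if_neg h2,
        (isCotFamily_signCot b w).neg]
  have hout : ∀ {j}, ¬(j = i ∨ j = P.reflectionPerm i i) → wallCot b w i s j = signCot b w j := by
    intro j hj
    push Not at hj
    rw [wallCot, if_neg hj.1, if_neg hj.2]
  have hin : ∀ {j k l}, P.root j + P.root k + P.root l = 0 → (j = i ∨ j = P.reflectionPerm i i) →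
      wallCot b w i s k + wallCot b w i s l = 0 ∧
        wallCot b w i s k * wallCot b w i s l = (Real.pi : ℂ) ^ 2 := by
    intro j k l h hj
    have hjk := ne_and_ne_neg_of_add_eq_zero h
    have hjl := ne_and_ne_neg_of_add_eq_zero (P := P) (i := j) (j := l) (k := k)
      (by rw [← h]; abel)
    have hk : ∀ {k}, (j ≠ k ∧ P.root j ≠ -P.root k) → ¬(k = i ∨ k = P.reflectionPerm i i) := by
      rintro k ⟨h1, h2⟩ (rfl | rfl)
      · rcases hj with rfl | rfl
        · exact h1 rfl
        · exact h2 (root_negIdx P _)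
      · rcases hj with rfl | rfl
        · exact h2 (by rw [root_negIdx, neg_neg])
        · exact h1 rfl
    rw [hout (hk hjk), hout (hk hjl)]
    have h1 := height_add_eq_zero b (weylGroupToPerm_add_eq_zero w⁻¹ h)
    have hk := b.height_ne_zero (P.weylGroupToPerm w⁻¹ k)
    have hl := b.height_ne_zero (P.weylGroupToPerm w⁻¹ l)
    have hj1 : b.height (P.weylGroupToPerm w⁻¹ j) = 1 ∨ b.height (P.weylGroupToPerm w⁻¹ j) = -1 := by
      rcases hj with rfl | rfl
      · exact Or.inl (b.height_one_of_mem_support hw)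
      · rw [weylGroupToPerm_negIdx, height_negIdx, b.height_one_of_mem_support hw]
        exact Or.inr rfl
    have hI := pi_I_sq
    simp only [signCot, RootPairing.Base.isPos_iff]
    constructor
    · split_ifs <;> first | (exfalso; omega) | ring
    · split_ifs <;> first | (exfalso; omega) | linear_combination -hI
  refine ⟨hneg, fun j k l h => ?_⟩
  by_cases hj : j = i ∨ j = P.reflectionPerm i i
  · obtain ⟨h1, h2⟩ := hin h hj
    linear_combination wallCot b w i s j * h1 + h2
  by_cases hk : k = i ∨ k = P.reflectionPerm i i
  · obtain ⟨h1, h2⟩ := hin (j := k) (k := l) (l := j) (by rw [← h]; abel) hk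
    linear_combination wallCot b w i s k * h1 + h2
  by_cases hl : l = i ∨ l = P.reflectionPerm i i
  · obtain ⟨h1, h2⟩ := hin (j := l) (k := j) (l := k) (by rw [← h]; abel) hl
    linear_combination wallCot b w i s l * h1 + h2
  rw [hout hj, hout hk, hout hl]
  exact (isCotFamily_signCot b w).add_eq j k l h

theorem cotForm_wallCot [P.IsReduced] (b : P.Base) (w : P.weylGroup) {i : ι} (hi : b.IsPos i)
    (s : ℂ) (u : N) : cotForm b (wallCot b w i s) u =
      cotForm b (signCot b w) u + (P.root' i u * (s - signCot b w i)) • hatT b i := by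
  classical
  rw [cotForm_apply, cotForm_apply, add_right_comm, add_left_inj]
  rw [← Finset.add_sum_erase _ _ (mem_posRoots.2 hi),
    ← Finset.add_sum_erase (posRoots b) (fun j => P.root' j u • (signCot b w j - _) • hatT b j)
      (mem_posRoots.2 hi), add_right_comm]
  refine congrArg₂ (· + ·) ?_ (Finset.sum_congr rfl fun j hj => ?_)
  · rw [wallCot, if_pos rfl]
    module
  · obtain ⟨h1, h2⟩ := Finset.mem_erase.1 hj
    rw [wallCot, if_neg h1, if_neg]
    rintro rfl
    exact (isPos_negIdx_iff b i).1 (mem_posRoots.1 h2) hi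

/-- Raising the wall value by 1 adds exactly t_α to the form on the half coroot of α, where α = 1,
and leaves its value on v unchanged. Both forms have commuting values; their difference is the
claim. -/
theorem lie_hatT_cotForm_signCot [P.IsReduced] [P.IsCrystallographic] (b : P.Base)
    {w : P.weylGroup} {i : ι} (hi : b.IsPos i) (hw : P.weylGroupToPerm w⁻¹ i ∈ b.support) {v : N}
    (hv : P.root' i v = 0) : ⁅hatT b i, cotForm b (signCot b w) v⁆ = 0 := by
  have h := lie_cotForm_eq_zero b (isCotFamily_wallCot b hw (signCot b w i + 1)) (halfCoroot P i) v
  rw [cotForm_wallCot b w hi, cotForm_wallCot b w hi, hv, zero_mul, zero_smul, add_zero,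
    root'_halfCoroot_self, add_sub_cancel_left, one_mul, one_smul, add_lie,
    lie_cotForm_eq_zero b (isCotFamily_signCot b w), zero_add] at h
  exact h

open scoped Classical in
theorem cotForm_signCot (b : P.Base) (w : P.weylGroup) (u : N) : cotForm b (signCot b w) u =
    hatXi b u - (2 * Real.pi * Complex.I) •
      ∑ j ∈ (posRoots b).filter (fun j => ¬ b.IsPos (P.weylGroupToPerm w⁻¹ j)),
          P.root' j u • hatT b j := by
  rw [cotForm_apply, Finset.sum_filter, Finset.smul_sum, sub_eq_add_neg, add_comm,
    ← Finset.sum_neg_distrib]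
  congr 1
  refine Finset.sum_congr rfl fun j _ => ?_
  rw [signCot]
  by_cases h : b.IsPos (P.weylGroupToPerm w⁻¹ j)
  · rw [if_pos h, if_neg (by simpa using h)]
    simp
  · rw [if_neg h, if_pos h]
    module

theorem lie_hatXi_hatXi [P.IsReduced] [P.IsCrystallographic] (b : P.Base) (u v : N) :
    ⁅hatXi b u, hatXi b v⁆ = 0 := by
  classical
  have h : ∀ u, cotForm b (signCot b 1) u = hatXi b u := by
    intro u
    rw [cotForm_signCot, Finset.sum_eq_zero, smul_zero, sub_zero]
    -- For w = 1 no positive root becomes negative, so the correction sum is empty.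
    intro j hj
    obtain ⟨h1, h2⟩ := Finset.mem_filter.1 hj
    rw [inv_one, map_one] at h2
    exact absurd (mem_posRoots.1 h1) h2
  rw [← h, ← h]
  exact lie_cotForm_eq_zero b (isCotFamily_signCot b 1) u v

/-- The descent of a homomorphism of Lie algebras to the quotient by an ideal. -/
def lieQuotLift {L L' : Type*} [LieRing L] [LieAlgebra ℂ L] [LieRing L'] [LieAlgebra ℂ L']
    (I : LieIdeal ℂ L) (F : L →ₗ⁅ℂ⁆ L') (h : I ≤ F.ker) : L ⧸ I →ₗ⁅ℂ⁆ L' where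
  toLinearMap := Submodule.liftQ I.toSubmodule F.toLinearMap fun a ha => F.mem_ker.1 (h ha)
  map_lie' := by
    intro a c
    obtain ⟨a, rfl⟩ := LieSubmodule.Quotient.surjective_mk' I a
    obtain ⟨c, rfl⟩ := LieSubmodule.Quotient.surjective_mk' I c
    exact F.map_lie a c

/-- The values on generators of the homomorphism from the trigonometric Lie algebra. -/
def trigGenMap (b : P.Base) (c : ℂ) : TrigGen ι N → EllHat b
  | TrigGen.t i => hatT b i
  | TrigGen.X u => (c / (2 * Real.pi * Complex.I)) • hatXi b u

theorem hatT_negIdx (b : P.Base) (i : ι) : hatT b (P.reflectionPerm i i) = hatT b i := by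
  rw [hatT, ellT_negIdx, hatT]

theorem lift_trigGenMap_eq_zero [P.IsReduced] [P.IsCrystallographic] (b : P.Base) (c : ℂ)
    {a : FreeLieAlgebra ℂ (TrigGen ι N)} (ha : TrigRel b c a) :
    FreeLieAlgebra.lift ℂ (trigGenMap b c) a = 0 := by
  classical
  cases ha with
  | t_neg i j h =>
    rw [map_sub, FreeLieAlgebra.lift_of_apply, FreeLieAlgebra.lift_of_apply,
      P.root_eq_neg_iff.1 h]
    exact sub_eq_zero.2 (hatT_negIdx b i)
  | X_add u v =>
    rw [map_sub, map_add]
    simp only [FreeLieAlgebra.lift_of_apply, trigGenMap, map_add, smul_add, sub_self]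
  | X_smul r u =>
    rw [map_sub, map_smul]
    simp only [FreeLieAlgebra.lift_of_apply, trigGenMap, map_smul]
    rw [smul_comm, sub_self]
  | tt Ψ hΨ _ i hi =>
    have h := congrArg (toCompletion (ellFiltration b)) (lie_ellT_sum b hΨ hi)
    rw [LieHom.map_lie, map_zero] at h
    rw [LieHom.map_lie, FreeLieAlgebra.lift_of_apply, ← h, trigGenMap, hatT]
    congr 1
    rw [← LieHom.coe_toLinearMap, ← LieHom.coe_toLinearMap, map_sum, map_sum]
    exact Finset.sum_congr (by congr!) fun j _ => FreeLieAlgebra.lift_of_apply _ _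
  | XX u v =>
    rw [LieHom.map_lie, FreeLieAlgebra.lift_of_apply, FreeLieAlgebra.lift_of_apply]
    simp only [trigGenMap]
    rw [smul_lie, lie_smul, lie_hatXi_hatXi, smul_zero, smul_zero]
  | tX i hi w hw u hu =>
    have h := lie_hatT_cotForm_signCot b hi hw hu
    rw [cotForm_signCot] at h
    -- Scaling ξ by c/(2πi) turns the coefficient 2πi of the correction sum into c, so every
    -- normalization is handled at once.
    have h2 := two_pi_I_ne_zero
    have h3 : FreeLieAlgebra.lift ℂ (trigGenMap b c) (gX ι u - c •
        ∑ j ∈ (posRoots b).filter (fun j => ¬ b.IsPos (P.weylGroupToPerm w⁻¹ j)),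
          P.root' j u • gt N j) = (c / (2 * Real.pi * Complex.I)) • (hatXi b u -
        (2 * Real.pi * Complex.I) •
        ∑ j ∈ (posRoots b).filter (fun j => ¬ b.IsPos (P.weylGroupToPerm w⁻¹ j)),
          P.root' j u • hatT b j) := by
      rw [map_sub, map_smul, FreeLieAlgebra.lift_of_apply, smul_sub, smul_smul,
        div_mul_cancel₀ _ h2, ← LieHom.coe_toLinearMap, map_sum]
      congr 2
      refine Finset.sum_congr rfl fun j _ => ?_
      rw [map_smul, LieHom.coe_toLinearMap, FreeLieAlgebra.lift_of_apply]
      rfl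
    rw [LieHom.map_lie, FreeLieAlgebra.lift_of_apply, h3, lie_smul]
    refine Eq.trans ?_ (smul_zero (c / (2 * Real.pi * Complex.I)))
    rw [← h]
    rfl

/-- The homomorphism from the trigonometric Lie algebra to the completed elliptic one. -/
def trigHom [P.IsReduced] [P.IsCrystallographic] (b : P.Base) (c : ℂ) : TrigLie b c →ₗ⁅ℂ⁆ EllHat b :=
  lieQuotLift (trigIdeal b c) (FreeLieAlgebra.lift ℂ (trigGenMap b c)) (by
    rw [trigIdeal, LieSubmodule.lieSpan_le]
    exact fun a ha => LieHom.mem_ker.2 (lift_trigGenMap_eq_zero b c ha))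

theorem trigHom_trigT [P.IsReduced] [P.IsCrystallographic] (b : P.Base) (c : ℂ) (i : ι) :
    trigHom b c (trigT b c i) = hatT b i :=
  FreeLieAlgebra.lift_of_apply (trigGenMap b c) (TrigGen.t i)

theorem trigHom_trigX [P.IsReduced] [P.IsCrystallographic] (b : P.Base) (c : ℂ) (u : N) :
    trigHom b c (trigX b c u) = (c / (2 * Real.pi * Complex.I)) • hatXi b u :=
  FreeLieAlgebra.lift_of_apply (trigGenMap b c) (TrigGen.X u)

theorem trigLie_hom_ext (b : P.Base) (c : ℂ) {L' : Type*} [LieRing L'] [LieAlgebra ℂ L']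
    {φ ψ : TrigLie b c →ₗ⁅ℂ⁆ L'} (ht : ∀ i, φ (trigT b c i) = ψ (trigT b c i))
    (hX : ∀ u, φ (trigX b c u) = ψ (trigX b c u)) : φ = ψ := by
  let q : FreeLieAlgebra ℂ (TrigGen ι N) →ₗ⁅ℂ⁆ TrigLie b c :=
    { (LieSubmodule.Quotient.mk' (trigIdeal b c)).toLinearMap with
      map_lie' := LieSubmodule.Quotient.mk_bracket _ _ _ }
  have h : φ.comp q = ψ.comp q := by
    refine FreeLieAlgebra.hom_ext fun x => ?_
    cases x with
    | t i => exact ht i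
    | X u => exact hX u
  refine LieHom.ext fun a => ?_
  obtain ⟨a, rfl⟩ := LieSubmodule.Quotient.surjective_mk' (trigIdeal b c) a
  exact LieHom.congr_fun h a

theorem trigHom_trigForm [P.IsReduced] [P.IsCrystallographic] (b : P.Base) (h : Torus P) (u : N) :
    trigHom b (2 * Real.pi * Complex.I) (trigForm b h u) = degForm b h u := by
  rw [degForm_eq, trigForm, LinearMap.add_apply, LinearMap.add_apply, map_add,
    trigHom_trigX, div_self two_pi_I_ne_zero, one_smul, LinearMap.sum_apply, LinearMap.sum_apply,
    ← LieHom.coe_toLinearMap, map_sum]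
  congr 1
  refine Finset.sum_congr rfl fun i _ => ?_
  rw [LinearMap.smulRight_apply, LinearMap.smulRight_apply, map_smul, map_smul,
    LieHom.coe_toLinearMap, trigHom_trigT]

end TrigonometricMap

/-! ### Limit of the theta function -/

section Theta

open Complex Filter
open UpperHalfPlane (atImInfty)

/-- The deviation from `1` of the `s`-th factor of the theta function. -/
def thetaTerm (τ : UpperHalfPlane) (s : ℕ) (z : ℂ) : ℂ :=
  exp (2 * Real.pi * I * τ) ^ (s + 1) *
    (2 - exp (2 * Real.pi * I * z) - exp (-(2 * Real.pi * I * z))) /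
      (1 - exp (2 * Real.pi * I * τ) ^ (s + 1)) ^ 2

/-- The function `(e^{πiz} - e^{-πiz}) / (2πi) = sin (πz) / π`. -/
def sinPi (z : ℂ) : ℂ :=
  (exp (Real.pi * I * z) - exp (-(Real.pi * I * z))) / (2 * Real.pi * I)

theorem norm_exp_le_half {τ : UpperHalfPlane} (hτ : 1 ≤ τ.im) :
    ‖exp (2 * Real.pi * I * τ)‖ ≤ 1 / 2 := by
  rw [norm_exp]
  have h : (2 * Real.pi * I * (τ : ℂ)).re = -(2 * Real.pi * τ.im) := by
    simp [mul_re, mul_im]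
  rw [h, Real.exp_neg, one_div]
  have h3 := Real.pi_gt_three
  have h2 : 2 ≤ 2 * Real.pi * τ.im + 1 := by nlinarith
  exact inv_anti₀ two_pos (h2.trans (Real.add_one_le_exp _))

theorem norm_exp_pow_le {τ : UpperHalfPlane} (hτ : 1 ≤ τ.im) (s : ℕ) :
    ‖exp (2 * Real.pi * I * τ) ^ (s + 1)‖ ≤ (1 / 2) ^ (s + 1) := by
  rw [norm_pow]
  exact pow_le_pow_left₀ (norm_nonneg _) (norm_exp_le_half hτ) _

theorem half_le_norm_one_sub {τ : UpperHalfPlane} (hτ : 1 ≤ τ.im) (s : ℕ) :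
    1 / 2 ≤ ‖1 - exp (2 * Real.pi * I * τ) ^ (s + 1)‖ := by
  have h1 := norm_exp_pow_le hτ s
  have h2 : ((1 : ℝ) / 2) ^ (s + 1) ≤ 1 / 2 := by
    rw [pow_succ]
    have : ((1 : ℝ) / 2) ^ s ≤ 1 := pow_le_one₀ (by norm_num) (by norm_num)
    linarith
  have h3 := norm_sub_norm_le (1 : ℂ) (exp (2 * Real.pi * I * τ) ^ (s + 1))
  rw [norm_one] at h3
  linarith

theorem one_sub_ne_zero {τ : UpperHalfPlane} (hτ : 1 ≤ τ.im) (s : ℕ) :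
    1 - exp (2 * Real.pi * I * τ) ^ (s + 1) ≠ 0 := by
  rw [← norm_pos_iff]
  linarith [half_le_norm_one_sub hτ s]

theorem norm_exp_mul_le {z : ℂ} {R : ℝ} (hz : ‖z‖ ≤ R) :
    ‖exp (2 * Real.pi * I * z)‖ ≤ Real.exp (2 * Real.pi * R) := by
  rw [norm_exp]
  refine Real.exp_le_exp.2 ((re_le_norm _).trans ?_)
  rw [norm_mul]
  have : ‖(2 * Real.pi * I : ℂ)‖ = 2 * Real.pi := by
    simp [abs_of_pos Real.pi_pos]
  rw [this]
  exact mul_le_mul_of_nonneg_left hz (by positivity)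

/-- For Im τ ≥ 1 one has |q| ≤ 1/2. The resulting geometric bound depends neither on τ nor on z in a
disc, and serves both for holomorphy of the product and for its limit. -/
theorem norm_thetaTerm_le {τ : UpperHalfPlane} (hτ : 1 ≤ τ.im) {z : ℂ} {R : ℝ} (hz : ‖z‖ ≤ R)
    (s : ℕ) : ‖thetaTerm τ s z‖ ≤ (1 / 2) ^ s * (4 * (1 + Real.exp (2 * Real.pi * R))) := by
  have h1 := norm_exp_pow_le hτ s
  have h2 := half_le_norm_one_sub hτ s
  have h3 := norm_exp_mul_le hz
  have h4 : ‖exp (-(2 * Real.pi * I * z))‖ ≤ Real.exp (2 * Real.pi * R) := by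
    rw [← mul_neg]
    exact norm_exp_mul_le (by rwa [norm_neg])
  have h5 : ‖2 - exp (2 * Real.pi * I * z) - exp (-(2 * Real.pi * I * z))‖ ≤
      2 * (1 + Real.exp (2 * Real.pi * R)) := by
    refine (norm_sub_le _ _).trans ?_
    have := norm_sub_le 2 (exp (2 * Real.pi * I * z))
    rw [Complex.norm_ofNat] at this
    linarith
  rw [thetaTerm, norm_div, norm_mul, norm_pow (1 - _), div_le_iff₀ (by positivity)]
  have h6 : (1 : ℝ) / 4 ≤ ‖1 - exp (2 * Real.pi * I * τ) ^ (s + 1)‖ ^ 2 := by nlinarith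
  calc _ ≤ (1 / 2) ^ (s + 1) * (2 * (1 + Real.exp (2 * Real.pi * R))) :=
        mul_le_mul h1 h5 (norm_nonneg _) (by positivity)
    _ = (1 / 2) ^ s * (4 * (1 + Real.exp (2 * Real.pi * R))) * (1 / 4) := by ring
    _ ≤ _ := mul_le_mul_of_nonneg_left h6 (by positivity)

theorem summable_thetaTerm_bound (R : ℝ) :
    Summable fun s : ℕ => (1 / 2 : ℝ) ^ s * (4 * (1 + Real.exp (2 * Real.pi * R))) :=
  summable_geometric_two.mul_right _

theorem theta_eq {τ : UpperHalfPlane} (hτ : 1 ≤ τ.im) (z : ℂ) :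
    theta z τ = sinPi z * ∏' s : ℕ, (1 + thetaTerm τ s z) := by
  rw [theta, sinPi]
  congr 1
  refine tprod_congr fun s => ?_
  have h := one_sub_ne_zero hτ s
  have h2 : exp (2 * Real.pi * I * z) * exp (-(2 * Real.pi * I * z)) = 1 := by
    rw [← exp_add, add_neg_cancel, exp_zero]
  rw [thetaTerm]
  field_simp
  linear_combination exp (2 * Real.pi * I * τ) ^ (2 * (s + 1)) * h2

theorem differentiable_sinPi : Differentiable ℂ sinPi := by
  unfold sinPi
  fun_prop

theorem differentiable_thetaTerm (τ : UpperHalfPlane) (s : ℕ) :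
    Differentiable ℂ (thetaTerm τ s) := by
  unfold thetaTerm
  fun_prop

theorem differentiable_tprod_thetaTerm {τ : UpperHalfPlane} (hτ : 1 ≤ τ.im) :
    Differentiable ℂ fun z => ∏' s : ℕ, (1 + thetaTerm τ s z) := by
  intro z
  have hp := (summable_thetaTerm_bound (‖z‖ + 1)).hasProdLocallyUniformlyOn_nat_one_add
    (f := thetaTerm τ) (K := Metric.ball 0 (‖z‖ + 1)) Metric.isOpen_ball
    (Eventually.of_forall fun n x hx =>
      norm_thetaTerm_le hτ (mem_ball_zero_iff.1 hx).le n)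
    (fun n => (differentiable_thetaTerm τ n).continuous.continuousOn)
  have hd := hp.tendstoLocallyUniformlyOn_finsetRange.differentiableOn
    (Eventually.of_forall fun n => by
      refine Differentiable.differentiableOn ?_
      exact Differentiable.fun_finsetProd fun i _ =>
        (differentiable_const 1).add (differentiable_thetaTerm τ i)) Metric.isOpen_ball
  exact hd.differentiableAt (Metric.isOpen_ball.mem_nhds (by simp))

theorem differentiable_theta {τ : UpperHalfPlane} (hτ : 1 ≤ τ.im) :
    Differentiable ℂ (theta · τ) := by
  rw [funext (theta_eq hτ)]
  exact differentiable_sinPi.mul (differentiable_tprod_thetaTerm hτ)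

theorem eventually_one_le_im : ∀ᶠ τ in atImInfty, 1 ≤ τ.im :=
  tendsto_comap.eventually (eventually_ge_atTop 1)

theorem tendsto_exp_atImInfty :
    Tendsto (fun τ : UpperHalfPlane => exp (2 * Real.pi * I * τ)) atImInfty (𝓝 0) := by
  rw [tendsto_zero_iff_norm_tendsto_zero]
  have h : ∀ τ : UpperHalfPlane, ‖exp (2 * Real.pi * I * τ)‖ =
      Real.exp (-(2 * Real.pi * τ.im)) := by
    intro τ
    rw [norm_exp]
    congr 1
    simp [mul_re, mul_im]
  simp only [h]
  refine Real.tendsto_exp_neg_atTop_nhds_zero.comp ?_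
  exact tendsto_comap.const_mul_atTop (by positivity)

/-- Each factor tends to 1 as q → 0, and the geometric bound allows dominated convergence for the
product. The joint filter in τ and z encodes locally uniform convergence. -/
theorem tendsto_theta (z : ℂ) : Tendsto (fun p : UpperHalfPlane × ℂ => theta p.2 p.1)
    (atImInfty ×ˢ 𝓝 z) (𝓝 (sinPi z)) := by
  have h1 : Tendsto (fun p : UpperHalfPlane × ℂ => ∏' s : ℕ, (1 + thetaTerm p.1 s p.2))
      (atImInfty ×ˢ 𝓝 z) (𝓝 (∏' _ : ℕ, (1 + 0))) := by
    refine tendsto_tprod_one_add_of_dominated_convergence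
      (f := fun (p : UpperHalfPlane × ℂ) s => thetaTerm p.1 s p.2) (g := fun _ => (0 : ℂ))
      (summable_thetaTerm_bound (‖z‖ + 1)) (fun s => ?_) ?_
    · have hq : Tendsto (fun p : UpperHalfPlane × ℂ => exp (2 * Real.pi * I * p.1) ^ (s + 1))
          (atImInfty ×ˢ 𝓝 z) (𝓝 (0 ^ (s + 1))) :=
        (tendsto_exp_atImInfty.comp tendsto_fst).pow _
      have hu : Tendsto (fun p : UpperHalfPlane × ℂ => 2 - exp (2 * Real.pi * I * p.2) -
          exp (-(2 * Real.pi * I * p.2))) (atImInfty ×ˢ 𝓝 z)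
          (𝓝 (2 - exp (2 * Real.pi * I * z) - exp (-(2 * Real.pi * I * z)))) :=
        ((by fun_prop : Continuous fun w : ℂ => 2 - exp (2 * Real.pi * I * w) -
          exp (-(2 * Real.pi * I * w))).tendsto z).comp tendsto_snd
      rw [zero_pow (Nat.succ_ne_zero s)] at hq
      have := (hq.mul hu).div ((hq.const_sub 1).pow 2) (by simp)
      rw [zero_mul, zero_div] at this
      exact this
    · have h2 : ∀ᶠ w in 𝓝 z, ‖w‖ ≤ ‖z‖ + 1 :=
        (continuous_norm.tendsto z).eventually_le_const (by linarith)
      filter_upwards [eventually_one_le_im.prod_mk h2] with p hp s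
      exact norm_thetaTerm_le hp.1 hp.2 s
  have h3 := ((differentiable_sinPi.continuous.tendsto z).comp
    (tendsto_snd (f := atImInfty))).mul h1
  simp only [add_zero, tprod_one, mul_one] at h3
  refine h3.congr' ?_
  filter_upwards [eventually_one_le_im.prod_inl (𝓝 z)] with p hp
  exact (theta_eq hp p.2).symm

/-- By Weierstrass, locally uniform convergence of holomorphic functions passes to derivatives. -/
theorem tendstoLocallyUniformlyOn_iteratedDeriv_theta (n : ℕ) :
    TendstoLocallyUniformlyOn (fun τ => iteratedDeriv n (theta · τ)) (iteratedDeriv n sinPi)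
      atImInfty Set.univ := by
  induction n with
  | zero =>
    simp only [iteratedDeriv_zero]
    rw [tendstoLocallyUniformlyOn_univ,
      tendstoLocallyUniformly_iff_forall_tendsto]
    intro z
    have h1 : Tendsto (fun p : UpperHalfPlane × ℂ => sinPi p.2) (atImInfty ×ˢ 𝓝 z)
        (𝓝 (sinPi z)) := (differentiable_sinPi.continuous.tendsto z).comp tendsto_snd
    exact (h1.prodMk_nhds (tendsto_theta z)).mono_right (nhds_le_uniformity _)
  | succ n ih =>
    simp only [iteratedDeriv_succ]
    refine ih.deriv ?_ isOpen_univ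
    filter_upwards [eventually_one_le_im] with τ hτ
    exact ((differentiable_theta hτ).contDiff.differentiable_iteratedDeriv n
      (WithTop.coe_lt_top (n : ℕ∞))).differentiableOn

theorem contDiff_sinPi : ContDiff ℂ ⊤ sinPi := differentiable_sinPi.contDiff

theorem tendsto_iteratedDeriv_theta (n : ℕ) (z : ℂ) :
    Tendsto (fun p : UpperHalfPlane × ℂ => iteratedDeriv n (theta · p.1) p.2)
      (atImInfty ×ˢ 𝓝 z) (𝓝 (iteratedDeriv n sinPi z)) := by
  have h := tendstoLocallyUniformly_iff_forall_tendsto.1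
    (tendstoLocallyUniformlyOn_univ.1 (tendstoLocallyUniformlyOn_iteratedDeriv_theta n)) z
  have h1 : Tendsto (fun p : UpperHalfPlane × ℂ => iteratedDeriv n sinPi p.2)
      (atImInfty ×ˢ 𝓝 z) (𝓝 (iteratedDeriv n sinPi z)) :=
    ((contDiff_sinPi.continuous_iteratedDeriv n le_top).tendsto z).comp tendsto_snd
  exact Uniform.tendsto_nhds_right.2 ((Uniform.tendsto_nhds_right.1 h1).uniformity_trans h)

theorem theta_zero (τ : UpperHalfPlane) : theta 0 τ = 0 := by
  simp [theta]

theorem hasDerivAt_sinPi_zero : HasDerivAt sinPi 1 0 := by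
  have h1 : HasDerivAt (fun z : ℂ => Real.pi * I * z) (Real.pi * I) 0 := by
    simpa using (hasDerivAt_id (0 : ℂ)).const_mul (Real.pi * I : ℂ)
  have h2 := (h1.cexp.sub h1.neg.cexp).div_const (2 * Real.pi * I)
  refine h2.congr_deriv ?_
  simp
  field_simp
  norm_num

/-- At 0 the sine factor vanishes with derivative 1, while every factor of the product equals 1. -/
theorem deriv_theta_zero {τ : UpperHalfPlane} (hτ : 1 ≤ τ.im) : deriv (theta · τ) 0 = 1 := by
  rw [funext (theta_eq hτ)]
  have h := hasDerivAt_sinPi_zero.mul (differentiable_tprod_thetaTerm hτ 0).hasDerivAt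
  refine h.deriv.trans ?_
  simp [sinPi, thetaTerm]
  norm_num

end Theta

/-! ### Limit of the kernel k -/

section Kernel

open Filter
open UpperHalfPlane (atImInfty)

/-- The expansion in powers of `x` of `f (z + x) / (f z * f x) - 1 / x`, for a function `f` with
`f 0 = 0` and `f' 0 = 1`. -/
def kernelSeries (f : ℂ → ℂ) (z : ℂ) : PowerSeries ℂ :=
  shiftedQuotient (PowerSeries.C (f z)⁻¹ * taylor f z)
    (PowerSeries.mk fun n => PowerSeries.coeff (n + 1) (taylor f 0))

theorem constantCoeff_taylor (f : ℂ → ℂ) (z : ℂ) :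
    PowerSeries.constantCoeff (taylor f z) = f z := by
  rw [← PowerSeries.coeff_zero_eq_constantCoeff_apply, taylor, PowerSeries.coeff_mk]
  simp

theorem taylor_zero_eq {f : ℂ → ℂ} (h : f 0 = 0) : taylor f 0 =
    PowerSeries.X * PowerSeries.mk fun n => PowerSeries.coeff (n + 1) (taylor f 0) := by
  have := PowerSeries.sub_const_eq_X_mul_shift (taylor f 0)
  rwa [constantCoeff_taylor, h, map_zero, sub_zero] at this

theorem constantCoeff_shift_taylor (f : ℂ → ℂ) :
    PowerSeries.constantCoeff (PowerSeries.mk fun n => PowerSeries.coeff (n + 1) (taylor f 0)) =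
      deriv f 0 := by
  rw [← PowerSeries.coeff_zero_eq_constantCoeff_apply, PowerSeries.coeff_mk, taylor,
    PowerSeries.coeff_mk]
  simp [iteratedDeriv_one]

theorem constantCoeff_C_mul_taylor {f : ℂ → ℂ} {z : ℂ} (hz : f z ≠ 0) :
    PowerSeries.constantCoeff (PowerSeries.C (f z)⁻¹ * taylor f z) = 1 := by
  rw [map_mul, constantCoeff_taylor, PowerSeries.constantCoeff_C, inv_mul_cancel₀ hz]

/-- Because θ(0) = 0 and θ'(0) = 1, the Taylor series at 0 is X times a unit, so the pole cancels
and no Laurent series remains. In this form the coefficients visibly depend continuously on those of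
θ. -/
theorem kSeries_eq {τ : UpperHalfPlane} (hτ : 1 ≤ τ.im) {z : ℂ} (hz : theta z τ ≠ 0) :
    kSeries z τ = kernelSeries (theta · τ) z := by
  have h1 := constantCoeff_shift_taylor (theta · τ)
  rw [deriv_theta_zero hτ] at h1
  have h2 := constantCoeff_C_mul_taylor (f := (theta · τ)) hz
  rw [kernelSeries, ← regularPart_div_sub (h2.trans h1.symm) (by rw [h1]; exact one_ne_zero),
    ← taylor_zero_eq (theta_zero τ), kSeries, map_mul, HahnSeries.ofPowerSeries_C]
  congr 2
  have h3 : HahnSeries.C (Γ := ℤ) (theta z τ)⁻¹ = (HahnSeries.C (theta z τ))⁻¹ := map_inv₀ _ _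
  rw [h3, div_mul_eq_div_div, div_eq_inv_mul (HahnSeries.ofPowerSeries ℤ ℂ (taylor _ z))]

variable {α : Type*} {l : Filter α}

theorem tendsto_coeff_mul {a v : α → PowerSeries ℂ} {a₀ v₀ : PowerSeries ℂ}
    (ha : ∀ n, Tendsto (fun p => PowerSeries.coeff n (a p)) l (𝓝 (PowerSeries.coeff n a₀)))
    (hv : ∀ n, Tendsto (fun p => PowerSeries.coeff n (v p)) l (𝓝 (PowerSeries.coeff n v₀)))
    (n : ℕ) :
    Tendsto (fun p => PowerSeries.coeff n (a p * v p)) l (𝓝 (PowerSeries.coeff n (a₀ * v₀))) := by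
  simp only [PowerSeries.coeff_mul]
  exact tendsto_finsetSum _ fun ij _ => (ha ij.1).mul (hv ij.2)

/-- Follows by strong induction from the recursion for the coefficients of an inverse. -/
theorem tendsto_coeff_inv {v : α → PowerSeries ℂ} {v₀ : PowerSeries ℂ}
    (hv : ∀ n, Tendsto (fun p => PowerSeries.coeff n (v p)) l (𝓝 (PowerSeries.coeff n v₀)))
    (h0 : PowerSeries.constantCoeff v₀ ≠ 0) (n : ℕ) :
    Tendsto (fun p => PowerSeries.coeff n (v p)⁻¹) l (𝓝 (PowerSeries.coeff n v₀⁻¹)) := by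
  have h1 : Tendsto (fun p => (PowerSeries.constantCoeff (v p))⁻¹) l
      (𝓝 (PowerSeries.constantCoeff v₀)⁻¹) := by
    have := hv 0
    simp only [PowerSeries.coeff_zero_eq_constantCoeff_apply] at this
    exact this.inv₀ h0
  induction n using Nat.strong_induction_on with
  | _ n ih =>
    simp only [PowerSeries.coeff_inv n]
    split_ifs with hn
    · exact h1
    · refine h1.neg.mul (tendsto_finsetSum _ fun ij _ => ?_)
      split_ifs with hij
      · exact (hv ij.1).mul (ih ij.2 hij)
      · exact tendsto_const_nhds

theorem tendsto_coeff_shiftedQuotient {a v : α → PowerSeries ℂ} {a₀ v₀ : PowerSeries ℂ}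
    (ha : ∀ n, Tendsto (fun p => PowerSeries.coeff n (a p)) l (𝓝 (PowerSeries.coeff n a₀)))
    (hv : ∀ n, Tendsto (fun p => PowerSeries.coeff n (v p)) l (𝓝 (PowerSeries.coeff n v₀)))
    (h0 : PowerSeries.constantCoeff v₀ ≠ 0) (n : ℕ) :
    Tendsto (fun p => PowerSeries.coeff n (shiftedQuotient (a p) (v p))) l
      (𝓝 (PowerSeries.coeff n (shiftedQuotient a₀ v₀))) := by
  refine tendsto_coeff_mul (fun k => ?_) (tendsto_coeff_inv hv h0) n
  simp only [PowerSeries.coeff_mk, map_sub]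
  exact (ha _).sub (hv _)

theorem tendsto_coeff_taylor_theta (z : ℂ) (n : ℕ) :
    Tendsto (fun p : UpperHalfPlane × ℂ => PowerSeries.coeff n (taylor (theta · p.1) p.2))
      (atImInfty ×ˢ 𝓝 z) (𝓝 (PowerSeries.coeff n (taylor sinPi z))) := by
  simp only [taylor, PowerSeries.coeff_mk]
  exact (tendsto_iteratedDeriv_theta n z).div_const _

theorem eventually_kSeries_eq {z : ℂ} (hz : sinPi z ≠ 0) :
    ∀ᶠ p : UpperHalfPlane × ℂ in atImInfty ×ˢ 𝓝 z,
      kSeries p.2 p.1 = kernelSeries (theta · p.1) p.2 := by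
  filter_upwards [eventually_one_le_im.prod_inl (𝓝 z), (tendsto_theta z).eventually_ne hz]
    with p h1 h2
  exact kSeries_eq h1 h2

theorem tendsto_coeff_kSeries {z : ℂ} (hz : sinPi z ≠ 0) (n : ℕ) :
    Tendsto (fun p : UpperHalfPlane × ℂ => PowerSeries.coeff n (kSeries p.2 p.1))
      (atImInfty ×ˢ 𝓝 z) (𝓝 (PowerSeries.coeff n (kernelSeries sinPi z))) := by
  refine Tendsto.congr' ((eventually_kSeries_eq hz).mono fun p hp =>
    congrArg (PowerSeries.coeff n) hp.symm) ?_
  refine tendsto_coeff_shiftedQuotient (fun k => ?_) (fun k => ?_) ?_ n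
  · simp only [PowerSeries.coeff_C_mul]
    exact ((tendsto_theta z).inv₀ hz).mul (tendsto_coeff_taylor_theta z k)
  · simp only [PowerSeries.coeff_mk]
    have h : Tendsto (fun p : UpperHalfPlane × ℂ => (p.1, (0 : ℂ))) (atImInfty ×ˢ 𝓝 z)
        (atImInfty ×ˢ 𝓝 0) := tendsto_fst.prodMk tendsto_const_nhds
    have := (tendsto_coeff_taylor_theta 0 (k + 1)).comp h
    exact this
  · rw [constantCoeff_shift_taylor, hasDerivAt_sinPi_zero.deriv]
    exact one_ne_zero

open Complex in
theorem iteratedDeriv_sinPi (n : ℕ) (z : ℂ) : iteratedDeriv n sinPi z =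
    ((Real.pi * I) ^ n * exp (Real.pi * I * z) -
      (-(Real.pi * I)) ^ n * exp (-(Real.pi * I * z))) / (2 * Real.pi * I) := by
  have h : sinPi = fun z => ((2 * Real.pi * I)⁻¹ : ℂ) *
      (exp (Real.pi * I * z) - exp (-(Real.pi * I) * z)) := by
    funext z
    rw [sinPi, div_eq_inv_mul, neg_mul]
  rw [h, iteratedDeriv_const_mul_field, iteratedDeriv_fun_sub (by fun_prop) (by fun_prop),
    iteratedDeriv_cexp_const_mul, iteratedDeriv_cexp_const_mul, div_eq_inv_mul, ← neg_mul _ z]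

theorem taylor_sinPi (z : ℂ) : taylor sinPi z = PowerSeries.C (2 * Real.pi * Complex.I)⁻¹ *
    (PowerSeries.C (Complex.exp (Real.pi * Complex.I * z)) * expS (1 / 2) -
      PowerSeries.C (Complex.exp (-(Real.pi * Complex.I * z))) * expS (-(1 / 2))) := by
  ext n
  have h1 : 2 * Real.pi * Complex.I * (1 / 2) = Real.pi * Complex.I := by ring
  have h2 : 2 * Real.pi * Complex.I * -(1 / 2) = -(Real.pi * Complex.I) := by ring
  rw [taylor, PowerSeries.coeff_mk, iteratedDeriv_sinPi, PowerSeries.coeff_C_mul, map_sub,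
    PowerSeries.coeff_C_mul, PowerSeries.coeff_C_mul, expS, expS, PowerSeries.coeff_rescale,
    PowerSeries.coeff_rescale, h1, h2, PowerSeries.coeff_exp,
    map_div₀, map_one, map_natCast]
  ring

theorem sinPi_ne_zero {z : ℂ} (h : Complex.exp (2 * Real.pi * Complex.I * z) ≠ 1) :
    sinPi z ≠ 0 := by
  intro h0
  apply h
  rw [sinPi, div_eq_zero_iff, or_iff_left two_pi_I_ne_zero, sub_eq_zero] at h0
  rw [show 2 * Real.pi * Complex.I * z = Real.pi * Complex.I * z + Real.pi * Complex.I * z by ring,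
    Complex.exp_add]
  nth_rw 2 [h0]
  rw [← Complex.exp_add, add_neg_cancel, Complex.exp_zero]

/-- This is π sin(π(z+x)) / (sin πz sin πx) = π cot πz + π cot πx, verified after multiplication by
X(e^{2πiX} - 1), with all exponentials expressed through e^{±πiX} and e^{±πiz}. -/
theorem kernelSeries_sinPi {z : ℂ} (h : Complex.exp (2 * Real.pi * Complex.I * z) ≠ 1) :
    kernelSeries sinPi z = PowerSeries.C
      (2 * Real.pi * Complex.I / (Complex.exp (2 * Real.pi * Complex.I * z) - 1)) + hSeries := by
  have hs0 : sinPi 0 = 0 := by simp [sinPi]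
  have h1 := constantCoeff_shift_taylor sinPi
  rw [hasDerivAt_sinPi_zero.deriv] at h1
  have h2 := X_mul_mul_shiftedQuotient
    ((constantCoeff_C_mul_taylor (sinPi_ne_zero h)).trans h1.symm) (by rw [h1]; exact one_ne_zero)
  rw [← kernelSeries, ← taylor_zero_eq hs0] at h2
  have h3 := congrArg (PowerSeries.X * ·) h2
  simp only [mul_sub] at h3
  rw [← taylor_zero_eq hs0, taylor_sinPi, taylor_sinPi] at h3
  have h4 := X_mul_hSeries
  have h5 := expS_mul (1 / 2) (-(1 / 2))
  have h6 := expS_mul (1 / 2) (1 / 2)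
  rw [add_neg_cancel, expS_zero] at h5
  rw [show (1 / 2 + 1 / 2 : ℂ) = 1 by norm_num] at h6
  have h7 : PowerSeries.X * (expS 1 - 1) ≠ 0 :=
    mul_ne_zero PowerSeries.X_ne_zero (sub_ne_zero.2 (expS_ne_one one_ne_zero))
  apply mul_left_cancel₀ h7
  rw [mul_add, h4]
  have hw : Complex.exp (Real.pi * Complex.I * z) * Complex.exp (-(Real.pi * Complex.I * z)) = 1 :=
    by rw [← Complex.exp_add, add_neg_cancel, Complex.exp_zero]
  have hw2 : Complex.exp (2 * Real.pi * Complex.I * z) =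
      Complex.exp (Real.pi * Complex.I * z) ^ 2 := by
    rw [← Complex.exp_nat_mul]
    congr 1
    push_cast
    ring
  have hs := sinPi_ne_zero h
  rw [hw2, ← sub_ne_zero] at h
  rw [hw2]
  have hc := two_pi_I_ne_zero
  simp only [sinPi, mul_zero, neg_zero, Complex.exp_zero, map_one, one_mul] at h3 hs
  generalize Complex.exp (Real.pi * Complex.I * z) = w at *
  generalize Complex.exp (-(Real.pi * Complex.I * z)) = w' at *
  generalize (2 * Real.pi * Complex.I : ℂ) = c at *
  have hww : w - w' ≠ 0 := fun h0 => hs (by rw [h0, zero_div])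
  -- With w = e^{πiz}, these are the coefficients of e^{πiX} and e^{-πiX} in the Taylor series of
  -- sin(πz)/π divided by its value at z.
  have hs1 : ((w - w') / c)⁻¹ * c⁻¹ * w = 1 + (w ^ 2 - 1)⁻¹ := by
    field_simp
    linear_combination w * hw
  have hs2 : ((w - w') / c)⁻¹ * c⁻¹ * w' = (w ^ 2 - 1)⁻¹ := by
    field_simp
    linear_combination w * hw
  have hs3 : c⁻¹ * c = 1 := inv_mul_cancel₀ hc
  replace hs1 := congrArg (PowerSeries.C (R := ℂ)) hs1
  replace hs2 := congrArg (PowerSeries.C (R := ℂ)) hs2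
  replace hs3 := congrArg (PowerSeries.C (R := ℂ)) hs3
  rw [div_eq_mul_inv]
  simp only [map_mul, map_add, map_one] at hs1 hs2 hs3 ⊢
  generalize PowerSeries.C (w ^ 2 - 1)⁻¹ = d at *
  generalize PowerSeries.C ((w - w') / c)⁻¹ = r at *
  generalize PowerSeries.C c⁻¹ = p at *
  generalize PowerSeries.C c = C at *
  generalize PowerSeries.C w = W at *
  generalize PowerSeries.C w' = W' at *
  rw [← h6]
  generalize expS (1 / 2) = E at *
  generalize expS (-(1 / 2)) = E' at *
  have ha : r * (p * (W * E - W' * E')) = (1 + d) * E - d * E' := by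
    linear_combination E * hs1 - E' * hs2
  rw [ha] at h3
  generalize kernelSeries sinPi z = K at *
  linear_combination C * E * h3 + (-PowerSeries.X * K * (E * E - 1) - (E * E - 1)) * hs3 +
    (C * p * PowerSeries.X * K - C * PowerSeries.X * d + C * p) * h5

end Kernel

/-! ### Topology of the completion -/

section CompletionTopology

open Filter

variable {L : Type*} [LieRing L] [LieAlgebra ℂ L] {F : ℕ → LieIdeal ℂ L}

instance : ContinuousAdd (Completion F) :=
  continuousAdd_iInf fun n => by
    let := moduleTopology ℂ (L ⧸ F n)
    have := ModuleTopology.continuousAdd ℂ (L ⧸ F n)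
    exact continuousAdd_induced (Completion.proj n : Completion F →ₗ[ℂ] L ⧸ F n)

instance : ContinuousSMul ℂ (Completion F) :=
  continuousSMul_iInf fun n => by
    let := moduleTopology ℂ (L ⧸ F n)
    have := ModuleTopology.continuousSMul ℂ (L ⧸ F n)
    exact continuousSMul_induced (Completion.proj n : Completion F →ₗ[ℂ] L ⧸ F n)

theorem tendsto_completion {α : Type*} {l : Filter α} {f : α → Completion F} {a : Completion F}
    (h : ∀ n, Tendsto (fun p => Completion.proj n (f p)) l
      (@nhds _ (moduleTopology ℂ (L ⧸ F n)) (Completion.proj n a))) : Tendsto f l (𝓝 a) := by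
  rw [nhds_iInf, tendsto_iInf]
  intro n
  rw [@nhds_induced _ _ (moduleTopology ℂ (L ⧸ F n)), tendsto_comap_iff]
  exact h n

end CompletionTopology

/-! ### Flatness and convergence of the connections -/

section Limit

open Filter
open UpperHalfPlane (atImInfty)

theorem differentiableAt_const_div_exp_sub_one {x c : ℂ} (hx : Complex.exp (c * x) ≠ 1) :
    DifferentiableAt ℂ (fun x => c / (Complex.exp (c * x) - 1)) x :=
  DifferentiableAt.fun_div (by fun_prop) (by fun_prop) (sub_ne_zero.2 hx)

theorem tendsto_slope_comp_line {D : ℂ → ℂ} {x : ℂ} (hD : DifferentiableAt ℂ D x) (y : ℂ) :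
    Tendsto (fun s : ℂ => s⁻¹ • (D (x + (0 + s) * y) - D (x + 0 * y))) (𝓝[≠] 0)
      (𝓝 (deriv D x * y)) := by
  have h1 : HasDerivAt (fun s : ℂ => x + s * y) y 0 := by
    simpa using ((hasDerivAt_id (0 : ℂ)).mul_const y).const_add x
  have h2 : HasDerivAt D (deriv D x) (x + 0 * y) := by
    rw [zero_mul, add_zero]
    exact hD.hasDerivAt
  have h3 := hasDerivAt_iff_tendsto_slope_zero.1 (h2.comp (0 : ℂ) h1)
  simpa only [Function.comp_apply] using h3

section Algebraic

variable {ι M N : Type*} [Fintype ι] [AddCommGroup M] [Module ℂ M] [AddCommGroup N] [Module ℂ N]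
  {P : RootPairing ι ℂ M N}

/-- At each finite level only finitely many coefficients occur, multiplying fixed vectors. -/
theorem tendsto_hatSeries (b : P.Base) {α : Type*} {l : Filter α} {f : α → PowerSeries ℂ}
    {f₀ : PowerSeries ℂ}
    (hf : ∀ n, Tendsto (fun p => PowerSeries.coeff n (f p)) l (𝓝 (PowerSeries.coeff n f₀)))
    (i : ι) : Tendsto (fun p => hatSeries b (f p) i) l (𝓝 (hatSeries b f₀ i)) := by
  refine tendsto_completion fun n => ?_
  let := moduleTopology ℂ (EllLie b ⧸ ellFiltration b n)
  have := ModuleTopology.continuousAdd ℂ (EllLie b ⧸ ellFiltration b n)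
  have := ModuleTopology.continuousSMul ℂ (EllLie b ⧸ ellFiltration b n)
  have h : ∀ g : PowerSeries ℂ, Completion.proj n (hatSeries b g i) =
      ∑ k ∈ Finset.range n, PowerSeries.coeff k g •
        LieSubmodule.Quotient.mk' (ellFiltration b n) ((adX b (halfCoroot P i) ^ k) (ellT b i)) := by
    intro g
    rw [proj_hatSeries]
    change LieSubmodule.Quotient.mk' (ellFiltration b n) _ = _
    rw [truncSeries, map_sum]
    exact Finset.sum_congr rfl fun k _ => map_smul _ _ _
  simp only [h]
  exact tendsto_finsetSum _ fun k _ => (hf k).smul_const _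

/-- Only the scalar coefficients depend on z, each through a single α(z). The derivative along u of
the v-component is therefore symmetric in u and v, the form is closed, and flatness reduces to the
vanishing of the bracket. -/
theorem isFlatOn_degForm [P.IsRootSystem] [P.IsCrystallographic] [P.IsReduced] (b : P.Base) :
    IsFlatOn (fun z : N => degForm b (z : Torus P)) {z : N | (z : Torus P) ∈ torusReg P} := by
  intro z hz u v
  let D : ℂ → ℂ := fun x => 2 * Real.pi * Complex.I / (Complex.exp (2 * Real.pi * Complex.I * x) - 1)
  have hD : ∀ (w : N) (x : N), degForm b (w : Torus P) x =
      ∑ i ∈ posRoots b, P.root' i x • D (P.root' i w) • hatT b i + hatXi b x := by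
    intro w x
    rw [degForm_eq, LinearMap.add_apply, LinearMap.sum_apply]
    rfl
  have key : ∀ x y : N, Tendsto
      (fun s : ℂ => s⁻¹ • (degForm b ((z + s • x : N) : Torus P) y - degForm b (z : Torus P) y))
      (𝓝[≠] 0)
      (𝓝 (∑ i ∈ posRoots b,
        (P.root' i y * (deriv D (P.root' i z) * P.root' i x)) • hatT b i)) := by
    intro x y
    have h1 : ∀ s : ℂ,
        s⁻¹ • (degForm b ((z + s • x : N) : Torus P) y - degForm b (z : Torus P) y) =
        ∑ i ∈ posRoots b, (P.root' i y * (s⁻¹ • (D (P.root' i z + (0 + s) * P.root' i x) -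
          D (P.root' i z + 0 * P.root' i x)))) • hatT b i := by
      intro s
      rw [hD, hD, add_sub_add_right_eq_sub, ← Finset.sum_sub_distrib, Finset.smul_sum]
      refine Finset.sum_congr rfl fun i _ => ?_
      rw [map_add, map_smul, smul_eq_mul, zero_add, zero_mul, add_zero, smul_eq_mul]
      module
    simp only [h1]
    refine tendsto_finsetSum _ fun i _ => Tendsto.smul_const (Tendsto.const_mul _ ?_) _
    exact tendsto_slope_comp_line (differentiableAt_const_div_exp_sub_one (hz i)) _
  refine ⟨_, _, key u v, key v u, ?_⟩
  change _ = ⁅degForm b (z : Torus P) u, degForm b (z : Torus P) v⁆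
  rw [degForm_eq_cotForm b hz, lie_cotForm_eq_zero b (isCotFamily_torusCot hz), sub_eq_zero]
  refine Finset.sum_congr rfl fun i _ => ?_
  congr 1
  ring

end Algebraic

section Analytic

variable {ι M N : Type*} [Fintype ι] [AddCommGroup M] [Module ℂ M]
    [NormedAddCommGroup N] [NormedSpace ℂ N] {P : RootPairing ι ℂ M N}

theorem continuous_root' [P.IsRootSystem] (i : ι) : Continuous (P.root' i) := by
  have : Module.Finite ℂ N := by
    rw [Module.finite_def, ← (RootPairing.IsRootSystem.span_coroot_eq_top (P := P))]
    exact Submodule.fg_span (Set.finite_range _)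
  exact (P.root' i).continuous_of_finiteDimensional

theorem eventually_mem_ellReg [P.IsRootSystem] {z : N} (hz : (z : Torus P) ∈ torusReg P) :
    ∀ᶠ p : UpperHalfPlane × N in atImInfty ×ˢ 𝓝 z, p.2 ∈ ellReg P p.1 := by
  refine eventually_all.2 fun i => ?_
  have hc := continuous_root' (P := P) i
  have h1 : ∀ᶠ w in 𝓝 z, Complex.exp (2 * Real.pi * Complex.I * P.root' i w) ≠ 1 :=
    ((by fun_prop : Continuous fun w => Complex.exp
      (2 * Real.pi * Complex.I * P.root' i w)).tendsto z).eventually_ne (hz i)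
  have h2 : ∀ᶠ w in 𝓝 z, |(P.root' i w).im| < |(P.root' i z).im| + 1 :=
    ((by fun_prop : Continuous fun w => |(P.root' i w).im|).tendsto z).eventually_lt_const
      (lt_add_one _)
  have h3 : ∀ᶠ τ in atImInfty, |(P.root' i z).im| + 1 ≤ τ.im :=
    tendsto_comap.eventually (eventually_ge_atTop _)
  filter_upwards [h3.prod_mk (h1.and h2)] with p hp m n h
  obtain ⟨h3, h1, h2⟩ := hp
  -- For n = 0 the equation would give e^{2πiα} = 1, excluded near z. For n ≠ 0 the imaginary part
  -- of α would be at least Im τ in absolute value, above its local bound.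
  rcases eq_or_ne n 0 with rfl | hn
  · apply h1
    rw [h, Complex.exp_eq_one_iff]
    exact ⟨m, by push_cast; ring⟩
  · have h4 : (P.root' i p.2).im = n * p.1.im := by
      rw [h]
      simp
    have h5 : (1 : ℝ) ≤ |(n : ℝ)| := by exact_mod_cast Int.one_le_abs hn
    rw [h4, abs_mul, abs_of_pos p.1.im_pos] at h2
    nlinarith [p.1.im_pos]

theorem tendsto_kzbForm [P.IsRootSystem] (b : P.Base) {z : N} (hz : (z : Torus P) ∈ torusReg P)
    (u : N) : Tendsto (fun p : UpperHalfPlane × N => kzbForm b p.1 p.2 u) (atImInfty ×ˢ 𝓝 z)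
      (𝓝 (degForm b (z : Torus P) u)) := by
  have h1 : ∀ p : UpperHalfPlane × N, kzbForm b p.1 p.2 u = ∑ i ∈ posRoots b,
      P.root' i u • hatSeries b (kSeries (P.root' i p.2) p.1) i + -hatY b u := by
    intro p
    rw [kzbForm, LinearMap.sub_apply, LinearMap.sum_apply, sub_eq_add_neg]
    rfl
  have h2 : degForm b (z : Torus P) u = ∑ i ∈ posRoots b, P.root' i u • hatSeries b
      (PowerSeries.C (2 * Real.pi * Complex.I / (expRoot P i z - 1)) + hSeries) i +
        -hatY b u := by
    rw [degForm, LinearMap.sub_apply, LinearMap.sum_apply, sub_eq_add_neg]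
    rfl
  simp only [h1]
  rw [h2]
  refine Tendsto.add_const _ (tendsto_finsetSum _ fun i _ => Tendsto.const_smul ?_ _)
  refine tendsto_hatSeries b (fun n => ?_) i
  rw [expRoot_mk, ← kernelSeries_sinPi (hz i)]
  have h : Tendsto (fun p : UpperHalfPlane × N => (p.1, P.root' i p.2)) (atImInfty ×ˢ 𝓝 z)
      (atImInfty ×ˢ 𝓝 (P.root' i z)) :=
    tendsto_fst.prodMk (((continuous_root' i).tendsto z).comp tendsto_snd)
  have h3 := (tendsto_coeff_kSeries (sinPi_ne_zero (hz i)) n).comp h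
  simpa only [Function.comp_def] using h3

end Analytic

end Limit

end KZB

end

/-! ### The main theorem -/

theorem mainTheorem8 {ι M N : Type*} [Fintype ι] [AddCommGroup M] [Module ℂ M]
    [NormedAddCommGroup N] [NormedSpace ℂ N] (P : RootPairing ι ℂ M N) [P.IsRootSystem]
    [P.IsCrystallographic] [P.IsReduced] (b : P.Base) :
    -- the KZB connections converge to the degenerate connection, locally uniformly on `H_reg`
    (∀ z : N, (z : KZB.Torus P) ∈ KZB.torusReg P →
      (∀ᶠ p : UpperHalfPlane × N in UpperHalfPlane.atImInfty ×ˢ 𝓝 z, p.2 ∈ KZB.ellReg P p.1) ∧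
      ∀ u : N, Filter.Tendsto (fun p : UpperHalfPlane × N => KZB.kzbForm b p.1 p.2 u)
        (UpperHalfPlane.atImInfty ×ˢ 𝓝 z) (𝓝 (KZB.degForm b (z : KZB.Torus P) u))) ∧
    -- the degenerate connection is flat
    KZB.IsFlatOn (fun z : N => KZB.degForm b (z : KZB.Torus P))
      {z : N | (z : KZB.Torus P) ∈ KZB.torusReg P} ∧
    -- the degenerate connection has the form of a trigonometric connection
    (∀ h ∈ KZB.torusReg P, KZB.degForm b h =
      ∑ i ∈ KZB.posRoots b, (P.root' i).smulRight
        ((2 * Real.pi * Complex.I / (KZB.expRoot P i h - 1)) • KZB.hatT b i) + KZB.hatXi b) ∧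
    -- the induced map from the trigonometric Lie algebra
    (∃ φ : KZB.TrigLie b (2 * Real.pi * Complex.I) →ₗ⁅ℂ⁆ KZB.EllHat b,
      (∀ i, φ (KZB.trigT b (2 * Real.pi * Complex.I) i) = KZB.hatT b i) ∧
      (∀ u, φ (KZB.trigX b (2 * Real.pi * Complex.I) u) = KZB.hatXi b u) ∧
      (∀ h ∈ KZB.torusReg P, ∀ u, φ (KZB.trigForm b h u) = KZB.degForm b h u) ∧
      ∀ ψ : KZB.TrigLie b (2 * Real.pi * Complex.I) →ₗ⁅ℂ⁆ KZB.EllHat b,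
        (∀ i, ψ (KZB.trigT b (2 * Real.pi * Complex.I) i) = KZB.hatT b i) →
        (∀ u, ψ (KZB.trigX b (2 * Real.pi * Complex.I) u) = KZB.hatXi b u) → ψ = φ) ∧
    -- the same map in the normalization `d - ∑ dα/(e^α - 1) t_α - ∑ X(u^i) du_i`
    (∃! φ : KZB.TrigLie b 1 →ₗ⁅ℂ⁆ KZB.EllHat b,
      (∀ i, φ (KZB.trigT b 1 i) = KZB.hatT b i) ∧
      (∀ u, φ (KZB.trigX b 1 u) = (2 * Real.pi * Complex.I)⁻¹ • KZB.hatXi b u)) := by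
  refine ⟨fun z hz => ⟨KZB.eventually_mem_ellReg hz, KZB.tendsto_kzbForm b hz⟩,
    KZB.isFlatOn_degForm b, fun h _ => KZB.degForm_eq b h,
    ⟨KZB.trigHom b _, KZB.trigHom_trigT b _, fun u => ?_, fun h _ u => KZB.trigHom_trigForm b h u,
      fun ψ ht hX => KZB.trigLie_hom_ext b _ (fun i => ?_) fun u => ?_⟩,
    ⟨KZB.trigHom b 1, ⟨KZB.trigHom_trigT b 1, fun u => ?_⟩,
      fun ψ hψ => KZB.trigLie_hom_ext b _ (fun i => ?_) fun u => ?_⟩⟩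
  · rw [KZB.trigHom_trigX, div_self Complex.two_pi_I_ne_zero, one_smul]
  · rw [ht, KZB.trigHom_trigT]
  · rw [hX, KZB.trigHom_trigX, div_self Complex.two_pi_I_ne_zero, one_smul]
  · rw [KZB.trigHom_trigX, one_div]
  · rw [hψ.1, KZB.trigHom_trigT]
  · rw [hψ.2, KZB.trigHom_trigX, one_div]
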